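/- Let $d,\eta>0$, $\xi\in\mathbb R$, $\mathbf l_{mn}=(md+n\xi,\;n\eta)$ for $m,n\in\mathbb Z$, and write $\mathbf t=(x,y)$ for a target and $\mathbf s=(x',y')$ for a source in the plane. Let $\rho_0=3+\sqrt8$. For $M\ge 1$ and a function $f$ on $[-\eta/2,\eta/2]$ let $p_M[f]$ be the polynomial of degree at most $M-1$ that interpolates $f$ at the $M$ Gauss–Legendre nodes (the roots of the Legendre polynomial $P_M$, rescaled from $[-1,1]$ to $[-\eta/2,\eta/2]$). Consider the following south and north kernels. They are built from the Green's functions (real analytic for $\mathbf t\neq\mathbf s$) of four equations. (1) Modified Helmholtz equation, $\beta>0$, and (3) modified Stokes equations, $\beta>0$: $$K_2^{south}(\mathbf t,\mathbf s)=\sum_{n\le -2}\sum_{m\in\mathbb Z}G(\mathbf t,\mathbf s+\mathbf l_{mn}),\qquad K_2^{north}(\mathbf t,\mathbf s)=\sum_{n\ge 2}\sum_{m\in\mathbb Z}G(\mathbf t,\mathbf s+\mathbf l_{mn}),$$ where $G(\mathbf t,\mathbf s)=\frac1{2\pi}K_0(\beta|\mathbf t-\mathbf s|)$ for (1), and for (3)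 $G(\mathbf t,\mathbf s)$ is any entry of the modified Stokeslet $\begin{pmatrix}-\partial_{yy}&\partial_{xy}\\ \partial_{xy}&-\partial_{xx}\end{pmatrix}G_{MB}$ at $\mathbf t-\mathbf s$, with $G_{MB}(\mathbf t)=-\frac1{2\pi\beta^2}\left[K_0(\beta|\mathbf t|)-\log(1/|\mathbf t|)\right]$. (2) Poisson equation and (4) Stokes equations, where the image sums diverge and the kernels are the charge-neutral limits $\beta\to0$. With $\alpha_m=2\pi m/d$, $Q_m=|\alpha_m|\eta-i\alpha_m\xi$, for the Poisson equation $$K_2^{south}=-\frac{yy'}{2d\eta}+\frac1{2d}\sum_{m\ne0}\frac1{|\alpha_m|}\frac{e^{-2Q_m}}{1-e^{-Q_m}}e^{-|\alpha_m|(y-y')+i\alpha_m(x-x')},\qquad K_2^{north}=-\frac{yy'}{2d\eta}+\frac1{2d}\sum_{m\ne0}\frac1{|\alpha_m|}\frac{e^{-2\overline{Q_m}}}{1-e^{-\overline{Q_m}}}e^{|\alpha_m|(y-y')+i\alpha_m(x-x')},$$ and for the Stokes equations, with $\sigma=\operatorname{sign}(m)$, $K_2^{south}$ and $K_2^{north}$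 are the entries of $$-\frac{yy'}{2d\eta}\begin{pmatrix}1&0\\0&0\end{pmatrix}+\frac1{4d}\sum_{m\neq0}\left\{\frac{1}{|\alpha_m|}I-\Big(y-y'+\tfrac{2-e^{-Q_m}}{1-e^{-Q_m}}\eta\Big)\begin{pmatrix}1&i\sigma\\ i\sigma&-1\end{pmatrix}\right\}\frac{e^{-2Q_m}}{1-e^{-Q_m}}e^{-|\alpha_m|(y-y')+i\alpha_m(x-x')},$$ $$-\frac{yy'}{2d\eta}\begin{pmatrix}1&0\\0&0\end{pmatrix}+\frac1{4d}\sum_{m\neq0}\left\{\frac{1}{|\alpha_m|}I-\Big(y-y'-\tfrac{2-e^{-\overline{Q_m}}}{1-e^{-\overline{Q_m}}}\eta\Big)\begin{pmatrix}-1&i\sigma\\ i\sigma&1\end{pmatrix}\right\}\frac{e^{-2\overline{Q_m}}}{1-e^{-\overline{Q_m}}}e^{|\alpha_m|(y-y')+i\alpha_m(x-x')}.$$ Then the iterated image sums in (1) and (3) converge for all $\mathbf t,\mathbf s$ with $y,y'\in[-\eta/2,\eta/2]$. Moreover, for each of these kernels $K$ there is a constant $C$, depending only on the kernel and on $d,\xi,\eta$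 (and $\beta$), such that for all $M\ge1$, all $x,x'\in\mathbb R$ and all $y,y'\in[-\eta/2,\eta/2]$: * the error at $y$ of interpolating in the target coordinate satisfies $\big|K(\mathbf t,\mathbf s)-p_M[K((x,\cdot),\mathbf s)](y)\big|\le C\rho_0^{-M}$; * the error at $y'$ of interpolating in the source coordinate satisfies $\big|K(\mathbf t,\mathbf s)-p_M[K(\mathbf t,(x',\cdot))](y')\big|\le C\rho_0^{-M}$. -/

import Mathlib

open Polynomial

noncomputable section

namespace PeriodicImages

/-! ### Legendre polynomials and Gauss-Legendre interpolation -/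

/-- The Legendre polynomials, by the three-term recurrence
`(l+2) P_{l+2} = (2l+3) X P_{l+1} - (l+1) P_l`, with `P_0 = 1` and `P_1 = X`. -/
def legendre : ℕ → ℝ[X]
  | 0 => 1
  | 1 => X
  | l + 2 =>
      C (1 / ((l : ℝ) + 2)) *
        (C (2 * (l : ℝ) + 3) * X * legendre (l + 1) - C ((l : ℝ) + 1) * legendre l)

/-- The Legendre nodes of order `M`: the (real) roots of `P_M`. -/
def legendreNodes (M : ℕ) : Finset ℝ := (legendre M).roots.toFinset

/-- The interpolating polynomial of `f` at the order `M` Legendre nodes rescaled from `[-1, 1]`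
to `[-η/2, η/2]`. -/
def glInterpolant (η : ℝ) (M : ℕ) (f : ℝ → ℂ) : ℂ[X] :=
  Lagrange.interpolate (legendreNodes M) (fun t => ((η / 2 * t : ℝ) : ℂ))
    (fun t => f (η / 2 * t))

/-- The convergence factor `ρ₀ = 3 + √8`. -/
def rho0 : ℝ := 3 + Real.sqrt 8

/-- The error estimates for a kernel `K (x, y) (x', y')`: there is a constant `C`, independent of
the number `M` of nodes and of the positions of target and source, such that the error of
Gauss-Legendre interpolation of order `M`, both in the target coordinate `y` and in the source
coordinate `y'`, is at most `C ρ₀ ^ (-M)`. -/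
def InterpolationEstimates (η : ℝ) (K : ℝ × ℝ → ℝ × ℝ → ℂ) : Prop :=
  ∃ C : ℝ, ∀ M : ℕ, 1 ≤ M → ∀ x x' : ℝ,
    ∀ y ∈ Set.Icc (-η / 2) (η / 2), ∀ y' ∈ Set.Icc (-η / 2) (η / 2),
      ‖K (x, y) (x', y') -
          (glInterpolant η M fun v => K (x, v) (x', y')).eval (y : ℂ)‖
        ≤ C * (rho0 ^ M)⁻¹ ∧
      ‖K (x, y) (x', y') -
          (glInterpolant η M fun v => K (x, y) (x', v)).eval (y' : ℂ)‖
        ≤ C * (rho0 ^ M)⁻¹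

/-! ### Image sums -/

/-- The lattice vector `l_{mn} = m (d, 0) + n (ξ, η)`. -/
def latticeVector (d ξ η : ℝ) (m n : ℤ) : ℝ × ℝ := (m * d + n * ξ, n * η)

/-- The south kernel `∑_{n ≤ -2} ∑_m G (t, s + l_{mn})`. -/
def southKernel (d ξ η : ℝ) (G : ℝ × ℝ → ℝ × ℝ → ℝ) (t s : ℝ × ℝ) : ℝ :=
  ∑' n : Set.Iic (-2 : ℤ), ∑' m : ℤ, G t (s + latticeVector d ξ η m n)

/-- The north kernel `∑_{n ≥ 2} ∑_m G (t, s + l_{mn})`. -/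
def northKernel (d ξ η : ℝ) (G : ℝ × ℝ → ℝ × ℝ → ℝ) (t s : ℝ × ℝ) : ℝ :=
  ∑' n : Set.Ici (2 : ℤ), ∑' m : ℤ, G t (s + latticeVector d ξ η m n)

/-- The iterated series defining the south and north kernels converge for all targets and sources
in the strip `|y|, |y'| ≤ η/2` (which contains the unit cell). -/
def ImageSumsConverge (d ξ η : ℝ) (G : ℝ × ℝ → ℝ × ℝ → ℝ) : Prop :=
  ∀ t s : ℝ × ℝ, t.2 ∈ Set.Icc (-η / 2) (η / 2) → s.2 ∈ Set.Icc (-η / 2) (η / 2) →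
    (∀ n : ℤ, n ≤ -2 ∨ 2 ≤ n → Summable fun m : ℤ => G t (s + latticeVector d ξ η m n)) ∧
    (Summable fun n : Set.Iic (-2 : ℤ) => ∑' m : ℤ, G t (s + latticeVector d ξ η m n)) ∧
    (Summable fun n : Set.Ici (2 : ℤ) => ∑' m : ℤ, G t (s + latticeVector d ξ η m n))

/-! ### Green's functions -/

/-- The Euclidean length of a vector in the plane (`ℝ × ℝ` carries the sup norm). -/
def radius (p : ℝ × ℝ) : ℝ := Real.sqrt (p.1 ^ 2 + p.2 ^ 2)

/-- The modified Bessel function `K₀ (z) = ∫_0^∞ exp (-z cosh τ) dτ`, for `z > 0`. -/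
def besselK0 (z : ℝ) : ℝ := ∫ τ in Set.Ioi (0 : ℝ), Real.exp (-z * Real.cosh τ)

/-- The free-space Green's function of the modified Helmholtz equation. -/
def modifiedHelmholtzGreen (β : ℝ) (t s : ℝ × ℝ) : ℝ :=
  1 / (2 * Real.pi) * besselK0 (β * radius (t - s))

/-- The partial derivative in the first coordinate. -/
def partialX (f : ℝ × ℝ → ℝ) (p : ℝ × ℝ) : ℝ := deriv (fun a => f (a, p.2)) p.1

/-- The partial derivative in the second coordinate. -/
def partialY (f : ℝ × ℝ → ℝ) (p : ℝ × ℝ) : ℝ := deriv (fun b => f (p.1, b)) p.2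

/-- The fundamental solution of the modified biharmonic equation. -/
def modifiedBiharmonicGreen (β : ℝ) (p : ℝ × ℝ) : ℝ :=
  -(1 / (2 * Real.pi * β ^ 2)) * (besselK0 (β * radius p) - Real.log (1 / radius p))

/-- The modified Stokeslet `(∇ ⊗ ∇ - Δ I) G_MB`, evaluated at `t - s`. -/
def modifiedStokeslet (β : ℝ) (t s : ℝ × ℝ) : Matrix (Fin 2) (Fin 2) ℝ :=
  !![-partialY (partialY (modifiedBiharmonicGreen β)) (t - s),
      partialX (partialY (modifiedBiharmonicGreen β)) (t - s);
      partialX (partialY (modifiedBiharmonicGreen β)) (t - s),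
      -partialX (partialX (modifiedBiharmonicGreen β)) (t - s)]

/-! ### The Poisson and Stokes kernels

For `β = 0` the image sums diverge. The kernels are then the `β → 0` limits, under charge
neutrality and up to an additive constant in the potential, of the kernels of the modified
equations. They are given by absolutely convergent Fourier series in `x - x'`, with a term
proportional to `y y'` as the limit of the zeroth mode. -/

/-- The wave number `α_m = 2 π m / d`. -/
def waveNumber (d : ℝ) (m : ℤ) : ℝ := 2 * Real.pi * m / d

/-- `Q_m = |α_m| η - i α_m ξ`. -/
def Qexp (d ξ η : ℝ) (m : ℤ) : ℂ :=
  ((|waveNumber d m| * η : ℝ) : ℂ) - Complex.I * ((waveNumber d m * ξ : ℝ) : ℂ)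

/-- The plane wave `exp (c (y - y') + i α_m (x - x'))`. -/
def planeWave (d c : ℝ) (m : ℤ) (t s : ℝ × ℝ) : ℂ :=
  Complex.exp (((c * (t.2 - s.2) : ℝ) : ℂ) +
    Complex.I * ((waveNumber d m * (t.1 - s.1) : ℝ) : ℂ))

/-- The south kernel for the Poisson equation. -/
def poissonSouth (d ξ η : ℝ) (t s : ℝ × ℝ) : ℂ :=
  -(1 / (2 * d * η) : ℂ) * t.2 * s.2 +
    1 / (2 * d : ℂ) * ∑' m : ℤ, if m = 0 then 0 else
      1 / ((|waveNumber d m| : ℝ) : ℂ) *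
        (Complex.exp (-2 * Qexp d ξ η m) / (1 - Complex.exp (-Qexp d ξ η m))) *
        planeWave d (-|waveNumber d m|) m t s

/-- The north kernel for the Poisson equation. -/
def poissonNorth (d ξ η : ℝ) (t s : ℝ × ℝ) : ℂ :=
  -(1 / (2 * d * η) : ℂ) * t.2 * s.2 +
    1 / (2 * d : ℂ) * ∑' m : ℤ, if m = 0 then 0 else
      1 / ((|waveNumber d m| : ℝ) : ℂ) *
        (Complex.exp (-2 * star (Qexp d ξ η m)) / (1 - Complex.exp (-star (Qexp d ξ η m)))) *
        planeWave d |waveNumber d m| m t s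

/-- The contribution of the zeroth mode to the Stokes kernels. -/
def stokesZerothMode (d η : ℝ) (t s : ℝ × ℝ) : Matrix (Fin 2) (Fin 2) ℂ :=
  (-(1 / (2 * d * η) : ℂ) * t.2 * s.2) • !![1, 0; 0, 0]

/-- The south kernel for the Stokes equations (entry `i`, `j`). -/
def stokesSouth (d ξ η : ℝ) (i j : Fin 2) (t s : ℝ × ℝ) : ℂ :=
  stokesZerothMode d η t s i j +
    1 / (4 * d : ℂ) * ∑' m : ℤ, if m = 0 then 0 else
      ((1 / ((|waveNumber d m| : ℝ) : ℂ)) • (1 : Matrix (Fin 2) (Fin 2) ℂ) -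
        (t.2 - s.2 + (2 - Complex.exp (-Qexp d ξ η m)) /
          (1 - Complex.exp (-Qexp d ξ η m)) * η : ℂ) •
          !![1, Complex.I * (m.sign : ℂ); Complex.I * (m.sign : ℂ), -1]) i j *
        (Complex.exp (-2 * Qexp d ξ η m) / (1 - Complex.exp (-Qexp d ξ η m))) *
        planeWave d (-|waveNumber d m|) m t s

/-- The north kernel for the Stokes equations (entry `i`, `j`). -/
def stokesNorth (d ξ η : ℝ) (i j : Fin 2) (t s : ℝ × ℝ) : ℂ :=
  stokesZerothMode d η t s i j +
    1 / (4 * d : ℂ) * ∑' m : ℤ, if m = 0 then 0 else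
      ((1 / ((|waveNumber d m| : ℝ) : ℂ)) • (1 : Matrix (Fin 2) (Fin 2) ℂ) -
        (t.2 - s.2 - (2 - Complex.exp (-star (Qexp d ξ η m))) /
          (1 - Complex.exp (-star (Qexp d ξ η m))) * η : ℂ) •
          !![-1, Complex.I * (m.sign : ℂ); Complex.I * (m.sign : ℂ), 1]) i j *
        (Complex.exp (-2 * star (Qexp d ξ η m)) / (1 - Complex.exp (-star (Qexp d ξ η m)))) *
        planeWave d |waveNumber d m| m t s

end PeriodicImages

end

namespace PeriodicImages

/-! ### Legendre polynomials and their roots -/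

/-! The nearest images left in a south kernel are two rows away. In the variable `w = y - y' + 2 *
η` the kernel is singular only for `w ≤ 0`, while `w` runs over an interval of length `η` that
starts at distance at least `η` from 0. Rescaled to `[-1, 1]`, the singularity lies no closer than
the point 3, and `ρ₀ = 3 + √8` is the parameter of the Bernstein ellipse through 3. The usual
ellipse argument would lose a factor at this boundary, so the exact rate needs the strength of the
singularity.

Interpolation. Each kernel is expanded about the end of the interval farthest from the singularity,
in powers of `1 + u`, with coefficients `O(4^(-k) / √(k+1))` (`HasLogDecay`). The error of
interpolating `(1 + u)^k` is largest at `u = 1` and nonnegative there (`abs_powError_le`). Weighted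
by `4^(-k)`, these errors sum to the error for `4 / (3 - u)` at `u = 1`, which is exactly `2 /
P_M(3)` (`hasSum_powError`). Only `k ≥ M` contribute, so the weight `1 / √(k+1)` gains `1 / √M`;
this matches `P_M(3) ≥ ρ₀^M / (5 √M)`, a consequence of Laplace's integral (`rho0_pow_le`).

Coefficients. A mode `exp (-κ w) / κ` or `w * exp (-κ w)` has its `k`th coefficient at `w = W`
bounded by `modeBound W k κ`. Over equally spaced rates the sum of these is comparable with a Gamma
integral. The weight concentrates at `κ W ≈ k` with spread `√k`, so the sum is `O(W^(-k) / √(k+1))`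
(`exists_tsum_modeBound_le`). The Poisson and Stokes kernels are already series of such modes, up to
the term in `y y'`.

Image sums. For the modified equations, Poisson summation turns each row of images into a series of
modes. The decay in `x` that it requires comes from shifting the contour in the plane wave integral
of the Bessel functions (`integral_exp_mul_waveExponent`). The coefficients for the modified
Stokeslet are differences between the rates `√(α² + β²)` and `|α|`. The mean value theorem reduces
them to `modeBound` at an intermediate rate (`exists_mode_sub_le`), which uses the cancellation
between the Bessel and logarithmic parts. The rows then sum geometrically. North kernels follow from
`(m, n) ↦ (-m, -n)` with target and source exchanged. -/

theorem legendre_succ_succ (l : ℕ) : legendre (l + 2) =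
    C (1 / ((l : ℝ) + 2)) *
      (C (2 * (l : ℝ) + 3) * X * legendre (l + 1) - C ((l : ℝ) + 1) * legendre l) := by
  rw [legendre]

theorem legendre_recurrence (l : ℕ) :
    C ((l : ℝ) + 2) * legendre (l + 2) =
      C (2 * (l : ℝ) + 3) * X * legendre (l + 1) - C ((l : ℝ) + 1) * legendre l := by
  have h : (l : ℝ) + 2 ≠ 0 := by positivity
  rw [legendre_succ_succ, ← mul_assoc, ← C_mul, mul_one_div_cancel h, C_1, one_mul]

theorem aeval_legendre_recurrence {A : Type*} [CommRing A] [Algebra ℝ A] (l : ℕ) (x : A) :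
    ((l : A) + 2) * aeval x (legendre (l + 2)) =
      (2 * (l : A) + 3) * x * aeval x (legendre (l + 1)) - ((l : A) + 1) * aeval x (legendre l) := by
  have h := congrArg (aeval x) (legendre_recurrence l)
  simp only [map_mul, map_sub, aeval_C, aeval_X, map_add, map_natCast, map_one,
    map_ofNat (algebraMap ℝ A)] at h
  exact h

theorem natDegree_legendre_le_and_coeff_pos (n : ℕ) :
    (legendre n).natDegree ≤ n ∧ 0 < (legendre n).coeff n := by
  induction n using Nat.twoStepInduction with
  | zero => simp [legendre]
  | one => simp [legendre]
  | more n ih0 ih1 =>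
    rw [legendre_succ_succ]
    refine ⟨?_, ?_⟩
    · refine (natDegree_C_mul_le _ _).trans ((natDegree_sub_le _ _).trans (max_le ?_ ?_))
      · rw [mul_assoc]
        refine (natDegree_C_mul_le _ _).trans (natDegree_mul_le.trans ?_)
        rw [natDegree_X]; omega
      · exact (natDegree_C_mul_le _ _).trans (by omega)
    · rw [coeff_C_mul, coeff_sub, mul_assoc, coeff_C_mul, coeff_C_mul, coeff_X_mul,
        coeff_eq_zero_of_natDegree_lt (by omega : (legendre n).natDegree < n + 2)]
      have := ih1.2
      simp only [mul_zero, sub_zero]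
      positivity

theorem natDegree_legendre (n : ℕ) : (legendre n).natDegree = n :=
  le_antisymm (natDegree_legendre_le_and_coeff_pos n).1
    (le_natDegree_of_ne_zero (natDegree_legendre_le_and_coeff_pos n).2.ne')

theorem leadingCoeff_legendre_pos (n : ℕ) : 0 < (legendre n).leadingCoeff := by
  rw [leadingCoeff, natDegree_legendre]
  exact (natDegree_legendre_le_and_coeff_pos n).2

theorem legendre_ne_zero (n : ℕ) : legendre n ≠ 0 :=
  leadingCoeff_ne_zero.mp (leadingCoeff_legendre_pos n).ne'

theorem eval_legendre_recurrence (l : ℕ) (x : ℝ) :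
    ((l : ℝ) + 2) * (legendre (l + 2)).eval x =
      (2 * (l : ℝ) + 3) * x * (legendre (l + 1)).eval x - ((l : ℝ) + 1) * (legendre l).eval x := by
  simpa [← coe_aeval_eq_eval] using aeval_legendre_recurrence l x

theorem eval_one_legendre (n : ℕ) : (legendre n).eval 1 = 1 := by
  induction n using Nat.twoStepInduction with
  | zero => simp [legendre]
  | one => simp [legendre]
  | more n ih0 ih1 =>
    have h := eval_legendre_recurrence n 1
    rw [ih0, ih1] at h
    have : (n : ℝ) + 2 ≠ 0 := by positivity
    exact mul_left_cancel₀ this (by linarith)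

theorem eval_neg_legendre (n : ℕ) (x : ℝ) :
    (legendre n).eval (-x) = (-1) ^ n * (legendre n).eval x := by
  induction n using Nat.twoStepInduction with
  | zero => simp [legendre]
  | one => simp [legendre]
  | more n ih0 ih1 =>
    have h := eval_legendre_recurrence n (-x)
    rw [ih0, ih1] at h
    have : (n : ℝ) + 2 ≠ 0 := by positivity
    refine mul_left_cancel₀ this ?_
    linear_combination h - (-1) ^ n * eval_legendre_recurrence n x

/-- The recurrence rearranges to `(l+2)(P_{l+2} - P_{l+1}) = (l+1)(P_{l+1} - P_l) + (2l+3)(x-1)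
P_{l+1}`, and both terms on the right are nonnegative. This excludes zeros in `[1, ∞)` and bounds
`P_M(3)` below. -/
theorem monotone_eval_legendre {x : ℝ} (hx : 1 ≤ x) (n : ℕ) :
    1 ≤ (legendre n).eval x ∧ (legendre n).eval x ≤ (legendre (n + 1)).eval x := by
  induction n with
  | zero => simp [legendre, hx]
  | succ n ih =>
    refine ⟨ih.1.trans ih.2, ?_⟩
    have h := eval_legendre_recurrence n x
    have : (0 : ℝ) < (n : ℝ) + 2 := by positivity
    refine le_of_mul_le_mul_left ?_ this
    rw [h]
    have h1 := ih.1.trans ih.2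
    nlinarith [mul_nonneg (by positivity : (0 : ℝ) ≤ n) (sub_nonneg.2 ih.2),
      mul_nonneg (mul_nonneg (by positivity : (0 : ℝ) ≤ 2 * (n : ℝ) + 3) (sub_nonneg.2 hx))
        (zero_le_one.trans h1)]

/-- The Christoffel-Darboux identity. -/
theorem christoffel_darboux {A : Type*} [CommRing A] [Algebra ℝ A] (x y : A) (n : ℕ) :
    (∑ k ∈ Finset.range (n + 1),
        (2 * (k : A) + 1) * (aeval x (legendre k) * aeval y (legendre k))) * (x - y) =
      ((n : A) + 1) * (aeval x (legendre (n + 1)) * aeval y (legendre n) -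
        aeval x (legendre n) * aeval y (legendre (n + 1))) := by
  induction n with
  | zero => simp [legendre]
  | succ n ih =>
    rw [Finset.sum_range_succ, add_mul, ih]
    have hx := aeval_legendre_recurrence n x
    have hy := aeval_legendre_recurrence n y
    push_cast
    linear_combination - aeval y (legendre (n + 1)) * hx + aeval x (legendre (n + 1)) * hy

/-- The confluent form of the Christoffel-Darboux identity. -/
theorem christoffel_darboux_derivative (n : ℕ) :
    ∑ k ∈ Finset.range (n + 1), (2 * (k : ℝ[X]) + 1) * legendre k ^ 2 =
      ((n : ℝ[X]) + 1) * (derivative (legendre (n + 1)) * legendre n -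
        derivative (legendre n) * legendre (n + 1)) := by
  induction n with
  | zero => simp [legendre]
  | succ n ih =>
    rw [Finset.sum_range_succ, ih]
    have h := legendre_recurrence n
    have h' := congrArg derivative h
    simp only [map_add, map_natCast, map_mul, map_ofNat, map_one] at h h'
    simp [derivative_mul] at h'
    push_cast
    linear_combination - legendre (n + 1) * h' + derivative (legendre (n + 1)) * h

/-- At a double zero the right side of the confluent Christoffel-Darboux identity would vanish, but
the left side is a sum of squares whose term `k = 0` is 1. -/
theorem derivative_legendre_ne_zero_of_root {n : ℕ} {x : ℝ} (hx : (legendre n).eval x = 0) :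
    (derivative (legendre n)).eval x ≠ 0 := by
  intro h
  cases n with
  | zero => simp [legendre] at hx
  | succ n =>
    have := congrArg (eval x) (christoffel_darboux_derivative n)
    simp only [eval_finsetSum, eval_mul, eval_add, eval_pow, eval_sub, hx, h] at this
    have h2 : 0 < ∑ k ∈ Finset.range (n + 1), (2 * (k : ℝ) + 1) * (legendre k).eval x ^ 2 := by
      refine Finset.sum_pos' (fun k _ => by positivity) ⟨0, by simp, by simp [legendre]⟩
    simp at this
    linarith

theorem conj_aeval (p : ℝ[X]) (z : ℂ) : aeval (star z) p = star (aeval z p) := by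
  have := aeval_algHom_apply Complex.conjAe.toAlgHom z p
  simpa using this

/-- Christoffel-Darboux at `z` and its conjugate: the right side vanishes, and the sum on the left
is positive, so `z - star z = 0`. -/
theorem im_eq_zero_of_legendre_root {n : ℕ} {z : ℂ} (hz : aeval z (legendre n) = 0) :
    z.im = 0 := by
  cases n with
  | zero => simp [legendre] at hz
  | succ n =>
    have h := christoffel_darboux z (star z) n
    simp only [conj_aeval, hz, star_zero, zero_mul, mul_zero, sub_zero] at h
    rcases mul_eq_zero.1 h with h | h
    · exfalso
      have h1 : ∀ k : ℕ, (2 * (k : ℂ) + 1) * (aeval z (legendre k) * star (aeval z (legendre k))) =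
          (((2 * (k : ℝ) + 1) * ‖aeval z (legendre k)‖ ^ 2 : ℝ) : ℂ) := fun k => by
        rw [← starRingEnd_apply, Complex.mul_conj, Complex.normSq_eq_norm_sq]; push_cast; ring
      simp_rw [h1] at h
      norm_cast at h
      have h2 : 0 < ∑ k ∈ Finset.range (n + 1),
          ((2 * k + 1 : ℕ) : ℝ) * ‖aeval z (legendre k)‖ ^ 2 := by
        refine Finset.sum_pos' (fun k _ => by positivity) ⟨0, by simp, by simp [legendre]⟩
      exact h2.ne' h
    · exact Complex.conj_eq_iff_im.1 (sub_eq_zero.1 h).symm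

/-! ### The Gauss-Legendre nodes -/

theorem splits_legendre (n : ℕ) : (legendre n).Splits := by
  refine Splits.of_splits_map (algebraMap ℝ ℂ) (IsAlgClosed.splits _) fun z hz => ?_
  rw [mem_roots', IsRoot.def, eval_map_algebraMap] at hz
  exact ⟨z.re, Complex.ext (by simp) (by simp [im_eq_zero_of_legendre_root hz.2])⟩

theorem nodup_roots_legendre (n : ℕ) : (legendre n).roots.Nodup := by
  rw [Multiset.nodup_iff_count_le_one]
  intro x
  rw [count_roots]
  by_contra! h
  obtain ⟨h0, h1⟩ := (one_lt_rootMultiplicity_iff_isRoot (legendre_ne_zero n)).1 h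
  exact derivative_legendre_ne_zero_of_root h0 h1

theorem card_legendreNodes (n : ℕ) : (legendreNodes n).card = n := by
  rw [legendreNodes, Multiset.toFinset_card_of_nodup (nodup_roots_legendre n),
    ← (splits_legendre n).natDegree_eq_card_roots, natDegree_legendre]

theorem legendre_eq_nodal (n : ℕ) :
    legendre n = C (legendre n).leadingCoeff * Lagrange.nodal (legendreNodes n) id := by
  conv_lhs => rw [(splits_legendre n).eq_prod_roots]
  rw [Lagrange.nodal, legendreNodes, Finset.prod, Multiset.toFinset_val,
    (nodup_roots_legendre n).dedup]
  rfl

theorem mem_legendreNodes {n : ℕ} {x : ℝ} : x ∈ legendreNodes n ↔ (legendre n).eval x = 0 := by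
  simp [legendreNodes, legendre_ne_zero]

theorem neg_mem_legendreNodes {n : ℕ} {x : ℝ} (hx : x ∈ legendreNodes n) :
    -x ∈ legendreNodes n := by
  rw [mem_legendreNodes] at *
  rw [eval_neg_legendre, hx, mul_zero]

theorem legendreNodes_subset (n : ℕ) {x : ℝ} (hx : x ∈ legendreNodes n) : x ∈ Set.Ioo (-1) 1 := by
  have key : ∀ y ∈ legendreNodes n, y < 1 := fun y hy => by
    by_contra! h
    have := (monotone_eval_legendre h n).1
    rw [mem_legendreNodes.1 hy] at this
    linarith
  exact ⟨by linarith [key _ (neg_mem_legendreNodes hx)], key x hx⟩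

end PeriodicImages

namespace PeriodicImages

/-! ### Laplace's integral and growth of the Legendre polynomials -/

open intervalIntegral in
/-- Laplace's integral for the Legendre polynomials. -/
theorem laplace_integral {z w : ℂ} (h : w ^ 2 = z ^ 2 - 1) (n : ℕ) :
    (∫ φ in (0 : ℝ)..Real.pi, (z + w * Real.cos φ) ^ n) = Real.pi * aeval z (legendre n) := by
  have hint : ∀ k : ℕ, IntervalIntegrable (fun φ : ℝ => (z + w * Real.cos φ) ^ k)
      MeasureTheory.volume 0 Real.pi := fun k => by
    apply Continuous.intervalIntegrable; fun_prop
  induction n using Nat.twoStepInduction with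
  | zero => simp [legendre]
  | one =>
    have h1 : (∫ φ in (0 : ℝ)..Real.pi, w * (Real.cos φ : ℂ)) = 0 := by
      rw [integral_const_mul, integral_ofReal, integral_cos]; simp
    simp only [pow_one, legendre, aeval_X]
    rw [integral_add (by simp) (by apply Continuous.intervalIntegrable; fun_prop), h1]
    simp
  | more n ih0 ih1 =>
    -- The recurrence holds for the integrals because its integrand is an exact derivative, of a
    -- function that vanishes at 0 and `π`. The relation `w² = z² - 1` enters only here.
    have hd : ∀ φ ∈ Set.uIcc 0 Real.pi, HasDerivAt
        (fun φ : ℝ => w * (Real.sin φ : ℂ) * (z + w * Real.cos φ) ^ (n + 1))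
        (((n : ℂ) + 2) * (z + w * Real.cos φ) ^ (n + 2) -
          (2 * (n : ℂ) + 3) * z * (z + w * Real.cos φ) ^ (n + 1) +
            ((n : ℂ) + 1) * (z + w * Real.cos φ) ^ n) φ := fun φ _ => by
      have hs : HasDerivAt (fun φ : ℝ => (Real.sin φ : ℂ)) (Real.cos φ : ℂ) φ :=
        (Real.hasDerivAt_sin φ).ofReal_comp
      have hc : HasDerivAt (fun φ : ℝ => (Real.cos φ : ℂ)) ((-Real.sin φ : ℝ) : ℂ) φ :=
        (Real.hasDerivAt_cos φ).ofReal_comp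
      have := (hs.const_mul w).mul (((hc.const_mul w).const_add z).pow (n + 1))
      refine this.congr_deriv ?_
      have hsc : (Real.sin φ : ℂ) ^ 2 + (Real.cos φ : ℂ) ^ 2 = 1 := by
        exact_mod_cast Real.sin_sq_add_cos_sq φ
      simp only [Nat.add_sub_cancel, Pi.pow_apply]
      push_cast
      linear_combination ((n : ℂ) + 1) * (z + w * Complex.cos φ) ^ n *
        (- w ^ 2 * (by push_cast at hsc; exact hsc : Complex.sin φ ^ 2 + Complex.cos φ ^ 2 = 1) - h)
    have hi := integral_eq_sub_of_hasDerivAt hd (by apply Continuous.intervalIntegrable; fun_prop)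
    rw [integral_add (((hint _).const_mul _).sub ((hint _).const_mul _)) ((hint _).const_mul _),
      integral_sub ((hint _).const_mul _) ((hint _).const_mul _), integral_const_mul,
      integral_const_mul, integral_const_mul, ih0, ih1] at hi
    simp only [Real.sin_pi, Real.sin_zero, Complex.ofReal_zero, mul_zero, zero_mul, sub_zero] at hi
    have h2 : (n : ℂ) + 2 ≠ 0 := by exact_mod_cast (by positivity : (n : ℝ) + 2 ≠ 0)
    refine mul_left_cancel₀ h2 ?_
    linear_combination hi - (Real.pi : ℂ) * aeval_legendre_recurrence n z

/-- With `w = i √(1 - x²)` the base in Laplace's integral has squared modulus `x² + (1 - x²) cos² φ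
≤ 1`. -/
theorem abs_eval_legendre_le_one (n : ℕ) {x : ℝ} (hx : x ∈ Set.Icc (-1) 1) :
    |(legendre n).eval x| ≤ 1 := by
  have hx2 : 0 ≤ 1 - x ^ 2 := by nlinarith [hx.1, hx.2]
  have h := laplace_integral (z := x) (w := Complex.I * Real.sqrt (1 - x ^ 2)) (by
    rw [mul_pow, ← Complex.ofReal_pow, Real.sq_sqrt hx2]; push_cast; simp) n
  have hb : ‖∫ φ in (0 : ℝ)..Real.pi,
      ((x : ℂ) + Complex.I * Real.sqrt (1 - x ^ 2) * Real.cos φ) ^ n‖ ≤ 1 * |Real.pi - 0| := by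
    refine intervalIntegral.norm_integral_le_of_norm_le_const fun φ _ => ?_
    rw [norm_pow]
    refine pow_le_one₀ (norm_nonneg _) ?_
    rw [← sq_le_one_iff₀ (norm_nonneg _), ← Complex.normSq_eq_norm_sq, mul_assoc, mul_comm Complex.I,
      ← Complex.ofReal_mul, Complex.normSq_add_mul_I, mul_pow, Real.sq_sqrt hx2]
    nlinarith [Real.cos_sq_le_one φ]
  rw [h, norm_mul, sub_zero, one_mul, Complex.norm_real, Real.norm_eq_abs] at hb
  have hr : aeval (x : ℂ) (legendre n) = (((legendre n).eval x : ℝ) : ℂ) := by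
    rw [← Complex.coe_algebraMap, aeval_algebraMap_apply, coe_aeval_eq_eval]
  rw [hr, Complex.norm_real, Real.norm_eq_abs] at hb
  exact le_of_mul_le_mul_left (by simpa using hb) (abs_pos.2 Real.pi_ne_zero)

theorem rho0_pos : 0 < rho0 := by unfold rho0; positivity

/-- Laplace's method: the base `3 + √8 cos φ` peaks at `φ = 0` with value `ρ₀`, and on a window of
width `1 / √n` its `n`th power keeps a fixed fraction of `ρ₀^n`. The lost factor `√n` is recovered
later from the decay of the Taylor coefficients. -/
theorem rho0_pow_le (n : ℕ) (hn : 1 ≤ n) :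
    rho0 ^ n ≤ 5 * (Real.sqrt n * (legendre n).eval 3) := by
  have h8 : Real.sqrt 8 ^ 2 = 8 := Real.sq_sqrt (by norm_num)
  have h8' : Real.sqrt 8 ≤ 3 := by nlinarith [Real.sqrt_nonneg 8]
  have h0 := Real.sqrt_nonneg 8
  have h := laplace_integral (z := (3 : ℝ)) (w := (Real.sqrt 8 : ℝ)) (by
    rw [← Complex.ofReal_pow, h8]; norm_num) n
  rw [← Complex.coe_algebraMap, aeval_algebraMap_apply, coe_aeval_eq_eval,
    Complex.coe_algebraMap] at h
  norm_cast at h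
  rw [intervalIntegral.integral_ofReal, Complex.ofReal_inj] at h
  set s := (Real.sqrt n)⁻¹ with hs
  have hn' : (1 : ℝ) ≤ n := by exact_mod_cast hn
  have hsn : 0 < Real.sqrt n := Real.sqrt_pos.2 (by linarith)
  have hs0 : 0 < s := by positivity
  have hs1 : s ≤ 1 := inv_le_one_of_one_le₀ (by simpa using hn')
  have hs2 : n * s ^ 2 = 1 := by
    rw [hs, inv_pow, Real.sq_sqrt (by linarith)]; field_simp
  have hc : Continuous fun φ : ℝ => (3 + Real.sqrt 8 * Real.cos φ) ^ n := by fun_prop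
  have hpi := Real.pi_gt_three
  have key : s * (3 / 4 * rho0 ^ n) ≤ ∫ φ in (0 : ℝ)..Real.pi, (3 + Real.sqrt 8 * Real.cos φ) ^ n := by
    calc s * (3 / 4 * rho0 ^ n) = ∫ φ in (0 : ℝ)..s, 3 / 4 * rho0 ^ n := by simp; ring
      _ ≤ ∫ φ in (0 : ℝ)..s, (3 + Real.sqrt 8 * Real.cos φ) ^ n := by
        refine intervalIntegral.integral_mono_on hs0.le (by simp) (hc.intervalIntegrable _ _) ?_
        intro φ hφ
        -- `cos φ ≥ 1 - φ²/2`, and `√8 / 2 ≤ ρ₀ / 4` because `√8 ≤ 3`.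
        have h1 : rho0 * (1 - φ ^ 2 / 4) ≤ 3 + Real.sqrt 8 * Real.cos φ := by
          have := Real.one_sub_sq_div_two_le_cos (x := φ)
          unfold rho0
          nlinarith [mul_le_mul_of_nonneg_left this h0, sq_nonneg φ,
            mul_nonneg (sub_nonneg.2 h8') (sq_nonneg φ)]
        have hφ2 : φ ^ 2 ≤ s ^ 2 := pow_le_pow_left₀ hφ.1 hφ.2 2
        have h2 : 1 + (n : ℝ) * (-(φ ^ 2 / 4)) ≤ (1 + -(φ ^ 2 / 4)) ^ n :=
          one_add_mul_le_pow (by nlinarith) n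
        have h3 : 3 / 4 ≤ (1 - φ ^ 2 / 4) ^ n := by
          rw [sub_eq_add_neg]
          nlinarith
        calc 3 / 4 * rho0 ^ n ≤ (1 - φ ^ 2 / 4) ^ n * rho0 ^ n := by
              have := rho0_pos; gcongr
          _ = (rho0 * (1 - φ ^ 2 / 4)) ^ n := by rw [← mul_pow, mul_comm]
          _ ≤ _ := pow_le_pow_left₀ (mul_nonneg rho0_pos.le (by nlinarith)) h1 n
      _ ≤ _ := by
        rw [← intervalIntegral.integral_add_adjacent_intervals (hc.intervalIntegrable 0 s)
          (hc.intervalIntegrable s Real.pi)]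
        have : 0 ≤ ∫ φ in s..Real.pi, (3 + Real.sqrt 8 * Real.cos φ) ^ n :=
          intervalIntegral.integral_nonneg (by linarith) fun φ _ => by
            have := Real.neg_one_le_cos φ
            refine pow_nonneg (by nlinarith) n
        linarith
  rw [h] at key
  have hP := (monotone_eval_legendre (by norm_num : (1 : ℝ) ≤ 3) n).1
  have : rho0 ^ n * (3 / 4) ≤ Real.sqrt n * (Real.pi * (legendre n).eval 3) := by
    have := mul_le_mul_of_nonneg_left key hsn.le
    rw [hs, ← mul_assoc, mul_inv_cancel₀ hsn.ne'] at this
    linarith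
  -- The constant 5 comes from `4 π / 3 < 5`.
  nlinarith [Real.pi_lt_d2, mul_nonneg hsn.le (zero_le_one.trans hP)]

end PeriodicImages

namespace PeriodicImages

/-! ### Interpolation of functions with a singularity at distance two -/

/-- Synthetic division by `X - a` with `0 ≤ a` forms sums of coefficients weighted by powers of `a`,
so it preserves nonnegativity; the linear factors are divided out one at a time. -/
theorem exists_nonneg_quotient {p : ℝ[X]} (hp : ∀ n, 0 ≤ p.coeff n) (S : Finset ℝ) {v : ℝ → ℝ}
    (hv : ∀ t ∈ S, 0 ≤ v t) :
    ∃ q r : ℝ[X], p = Lagrange.nodal S v * q + r ∧ r.degree < S.card ∧ ∀ n, 0 ≤ q.coeff n := by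
  classical
  induction S using Finset.induction_on with
  | empty => exact ⟨p, 0, by simp, by simp, hp⟩
  | insert a S ha ih =>
    obtain ⟨q, r, h, hr, hq⟩ := ih fun t ht => hv t (Finset.mem_insert_of_mem ht)
    have h1 := modByMonic_add_div q (X - C (v a))
    rw [modByMonic_X_sub_C_eq_C_eval] at h1
    refine ⟨q /ₘ (X - C (v a)), C (q.eval (v a)) * Lagrange.nodal S v + r, ?_, ?_, fun n => ?_⟩
    · rw [Lagrange.nodal_insert_eq_nodal ha, h]
      nth_rewrite 1 [← h1]
      ring
    · rw [Finset.card_insert_of_notMem ha]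
      refine (degree_add_le _ _).trans_lt (max_lt ?_ (hr.trans (by norm_cast; omega)))
      rw [← smul_eq_C_mul]
      refine (degree_smul_le _ _).trans_lt ?_
      rw [Lagrange.degree_nodal]; norm_cast; omega
    · rw [coeff_divByMonic_X_sub_C]
      exact Finset.sum_nonneg fun i _ =>
        mul_nonneg (pow_nonneg (hv a (Finset.mem_insert_self a S)) _) (hq i)

/-- The fundamental Lagrange polynomials for the Legendre nodes. -/
noncomputable def legendreBasis (M : ℕ) (t u : ℝ) : ℝ := (Lagrange.basis (legendreNodes M) id t).eval u

theorem sum_legendreBasis_eq_eval {M : ℕ} {r : ℝ[X]} (hr : r.degree < M) {f : ℝ → ℝ}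
    (hf : ∀ t ∈ legendreNodes M, f t = r.eval t) (u : ℝ) :
    ∑ t ∈ legendreNodes M, f t * legendreBasis M t u = r.eval u := by
  have := Lagrange.eq_interpolate_of_eval_eq (s := legendreNodes M) (v := id) f
    Function.injective_id.injOn (f := r) (by rwa [card_legendreNodes]) (fun t ht => (hf t ht).symm)
  rw [this, Lagrange.interpolate_apply, eval_finsetSum]
  simp [legendreBasis]

/-- The error of interpolating `(1 + u) ^ k` at the Legendre nodes. -/
noncomputable def powError (M k : ℕ) (u : ℝ) : ℝ :=
  (1 + u) ^ k - ∑ t ∈ legendreNodes M, (1 + t) ^ k * legendreBasis M t u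

theorem powError_eq_zero {M k : ℕ} (h : k < M) (u : ℝ) : powError M k u = 0 := by
  rw [powError, sum_legendreBasis_eq_eval (r := (1 + X) ^ k) _ (by simp)]
  · simp
  · refine (degree_pow_le _ _).trans_lt ?_
    rw [add_comm, ← C_1, degree_X_add_C]
    simpa using h

/-- In the variable `1 + u` the nodes are positive, so the error is the nodal polynomial times a
polynomial in `1 + u` with nonnegative coefficients. Both factors are largest in modulus at `u = 1`:
the second by monotonicity, the first because `|P_M| ≤ 1 = P_M(1)`. -/
theorem abs_powError_le (M k : ℕ) {u : ℝ} (hu : u ∈ Set.Icc (-1) 1) :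
    |powError M k u| ≤ powError M k 1 := by
  obtain ⟨q, r, h, hr, hq⟩ := exists_nonneg_quotient (p := X ^ k)
    (fun n => by rw [coeff_X_pow]; split_ifs <;> norm_num) (legendreNodes M)
    (v := fun t => 1 + t) (fun t ht => by have := (legendreNodes_subset M ht).1; linarith)
  rw [card_legendreNodes] at hr
  have hval : ∀ u : ℝ, (1 + u) ^ k =
      (Lagrange.nodal (legendreNodes M) id).eval u * q.eval (1 + u) + r.eval (1 + u) := fun u => by
    have := congrArg (eval (1 + u)) h
    simpa [Lagrange.eval_nodal] using this
  have herr : ∀ u : ℝ, powError M k u =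
      (Lagrange.nodal (legendreNodes M) id).eval u * q.eval (1 + u) := fun u => by
    rw [powError, sum_legendreBasis_eq_eval (r := r.comp (1 + X))]
    · rw [hval u]; simp
    · by_cases h0 : r = 0
      · simp [h0]
      · have h1 : (1 + X : ℝ[X]).natDegree = 1 := by rw [add_comm, ← C_1, natDegree_X_add_C]
        have h2 := natDegree_comp (p := r) (q := 1 + X)
        rw [h1, mul_one] at h2
        refine degree_le_natDegree.trans_lt ?_
        rw [h2, ← degree_eq_natDegree h0]
        exact hr
    · intro t ht
      have := Lagrange.eval_nodal_at_node (v := id) ht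
      rw [id] at this
      rw [hval t, this]; simp
  have hn : ∀ u : ℝ, (Lagrange.nodal (legendreNodes M) id).eval u =
      (legendre M).eval u / (legendre M).leadingCoeff := fun u => by
    rw [eq_div_iff (leadingCoeff_legendre_pos M).ne']
    conv_rhs => rw [legendre_eq_nodal]
    rw [eval_mul, eval_C, mul_comm]
  have hqn : ∀ x : ℝ, 0 ≤ x → 0 ≤ q.eval x := fun x hx => by
    rw [eval_eq_sum_range]; exact Finset.sum_nonneg fun i _ => mul_nonneg (hq i) (pow_nonneg hx i)
  have hqm : q.eval (1 + u) ≤ q.eval (1 + 1) := by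
    rw [eval_eq_sum_range, eval_eq_sum_range]
    exact Finset.sum_le_sum fun i _ => mul_le_mul_of_nonneg_left
      (pow_le_pow_left₀ (by linarith [hu.1]) (by linarith [hu.2]) i) (hq i)
  have hlc := leadingCoeff_legendre_pos M
  rw [herr, herr, hn, hn, eval_one_legendre, abs_mul, abs_div, abs_of_pos hlc,
    abs_of_nonneg (hqn _ (by linarith [hu.1]))]
  refine mul_le_mul ?_ hqm (hqn _ (by linarith [hu.1])) (by positivity)
  exact div_le_div_of_nonneg_right (abs_eval_legendre_le_one M hu) hlc.le

/-- The geometric series of `(1 + u) / 4` is `4 / (3 - u)`. The interpolant of `1 / (3 - u)` is `(1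
- P_M(u) / P_M(3)) / (3 - u)`, which leaves the error `P_M(u) / (P_M(3) (3 - u))`. -/
theorem hasSum_powError (M : ℕ) :
    HasSum (fun k => powError M k 1 * (4⁻¹ : ℝ) ^ k) (2 / (legendre M).eval 3) := by
  have hgeo : ∀ u ∈ Set.Icc (-1 : ℝ) 1,
      HasSum (fun k => (1 + u) ^ k * (4⁻¹ : ℝ) ^ k) (4 * (3 - u)⁻¹) := fun u hu => by
    have := hasSum_geometric_of_lt_one (r := (1 + u) * 4⁻¹) (by nlinarith [hu.1])
      (by nlinarith [hu.2])
    simp_rw [← mul_pow]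
    convert this using 1
    rw [show 1 - (1 + u) * 4⁻¹ = (3 - u) * 4⁻¹ by ring, mul_inv, inv_inv, mul_comm]
  have h := (hgeo 1 (by norm_num)).sub (hasSum_sum (s := legendreNodes M) fun t ht =>
    (hgeo t (Set.Ioo_subset_Icc_self (legendreNodes_subset M ht))).mul_right (legendreBasis M t 1))
  have hP := (monotone_eval_legendre (by norm_num : (1 : ℝ) ≤ 3) M).1
  have h1 : ∀ k, powError M k 1 * (4⁻¹ : ℝ) ^ k = (1 + 1) ^ k * 4⁻¹ ^ k -
      ∑ t ∈ legendreNodes M, (1 + t) ^ k * 4⁻¹ ^ k * legendreBasis M t 1 := fun k => by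
    rw [powError, sub_mul, Finset.sum_mul]
    congr 1
    exact Finset.sum_congr rfl fun t _ => by ring
  have h2 : 2 / (legendre M).eval 3 = 4 * (3 - 1)⁻¹ -
      ∑ t ∈ legendreNodes M, 4 * (3 - t)⁻¹ * legendreBasis M t 1 := by
    -- `q` is minus the interpolant of `1 / (3 - u)`.
    obtain ⟨q, hq⟩ : X - C 3 ∣ 1 - C ((legendre M).eval 3)⁻¹ * legendre M := by
      rw [dvd_iff_isRoot, IsRoot.def]; simp; field_simp; simp
    have hqe : ∀ u : ℝ, u ≤ 1 →
        q.eval u = (((legendre M).eval 3)⁻¹ * (legendre M).eval u - 1) * (3 - u)⁻¹ := fun u hu => by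
      have := congrArg (eval u) hq
      simp at this
      rw [eq_mul_inv_iff_mul_eq₀ (by linarith)]
      linarith
    have hqd : q.degree < M := by
      by_cases hq0 : q = 0
      · simp [hq0]
      have h1 := congrArg natDegree hq
      rw [natDegree_mul (X_sub_C_ne_zero _) hq0, natDegree_X_sub_C] at h1
      have h2 : (1 - C ((legendre M).eval 3)⁻¹ * legendre M).natDegree ≤ M := by
        refine (natDegree_sub_le _ _).trans (max_le (by simp) ?_)
        exact (natDegree_C_mul_le _ _).trans (natDegree_legendre M).le
      refine degree_le_natDegree.trans_lt ?_
      norm_cast; omega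
    have h3 := sum_legendreBasis_eq_eval hqd (f := fun t => - (3 - t)⁻¹) (fun t ht => by
      rw [hqe t (legendreNodes_subset M ht).2.le, mem_legendreNodes.1 ht]; ring) 1
    rw [hqe 1 le_rfl, eval_one_legendre] at h3
    simp only [neg_mul, Finset.sum_neg_distrib] at h3
    simp_rw [mul_assoc, ← Finset.mul_sum]
    rw [neg_eq_iff_eq_neg.1 h3]
    field_simp
    norm_num
  simp_rw [h1]
  rw [h2]
  exact h

/-- Powers below `M` are reproduced exactly. For the others `1 / √(k+1) ≤ 1 / √M`, which absorbs the
`√M` of `rho0_pow_le`; the constant is `10 = 2 * 5`. -/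
theorem norm_interpolation_error_le {M : ℕ} (hM : 1 ≤ M) {c : ℕ → ℂ} {A : ℝ} {f : ℝ → ℂ}
    (hc : ∀ k, ‖c k‖ ≤ A * (4⁻¹ : ℝ) ^ k / Real.sqrt (k + 1))
    (hf : ∀ u ∈ Set.Icc (-1 : ℝ) 1, HasSum (fun k => c k * (1 + u : ℂ) ^ k) (f u))
    {u : ℝ} (hu : u ∈ Set.Icc (-1 : ℝ) 1) :
    ‖f u - ∑ t ∈ legendreNodes M, f t * (legendreBasis M t u : ℂ)‖ ≤ 10 * A * (rho0 ^ M)⁻¹ := by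
  have h := (hf u hu).sub (hasSum_sum (s := legendreNodes M) fun t ht =>
    (hf t (Set.Ioo_subset_Icc_self (legendreNodes_subset M ht))).mul_right (legendreBasis M t u : ℂ))
  have hM' : (0 : ℝ) < M := by exact_mod_cast hM
  have hs : 0 < Real.sqrt M := Real.sqrt_pos.2 hM'
  have hA : 0 ≤ A := by simpa using (norm_nonneg _).trans (hc 0)
  have hP := (monotone_eval_legendre (by norm_num : (1 : ℝ) ≤ 3) M).1
  have hb : ∀ k, ‖c k * (1 + u : ℂ) ^ k -
      ∑ t ∈ legendreNodes M, c k * (1 + t : ℂ) ^ k * (legendreBasis M t u : ℂ)‖ ≤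
        A / Real.sqrt M * (powError M k 1 * (4⁻¹ : ℝ) ^ k) := fun k => by
    have h1 : c k * (1 + u : ℂ) ^ k -
        ∑ t ∈ legendreNodes M, c k * (1 + t : ℂ) ^ k * (legendreBasis M t u : ℂ) =
          c k * (powError M k u : ℝ) := by
      simp only [powError]
      push_cast
      rw [mul_sub, Finset.mul_sum]
      congr 1
      exact Finset.sum_congr rfl fun t _ => by ring
    rw [h1, norm_mul, Complex.norm_real, Real.norm_eq_abs]
    rcases lt_or_ge k M with hk | hk
    · rw [powError_eq_zero hk, powError_eq_zero hk]; simp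
    · have h2 : Real.sqrt M ≤ Real.sqrt (k + 1) :=
        Real.sqrt_le_sqrt (by exact_mod_cast hk.trans (Nat.le_succ k))
      calc ‖c k‖ * |powError M k u| ≤ A * (4⁻¹ : ℝ) ^ k / Real.sqrt M * powError M k 1 := by
            refine mul_le_mul ((hc k).trans ?_) (abs_powError_le M k hu) (abs_nonneg _) (by positivity)
            gcongr
        _ = _ := by ring
  refine (tsum_of_norm_bounded ((hasSum_powError M).mul_left (A / Real.sqrt M)) hb).trans_eq' ?_ |>.trans ?_
  · rw [h.tsum_eq]
  · have hr := rho0_pow_le M hM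
    have hr0 : 0 < rho0 ^ M := pow_pos rho0_pos M
    rw [div_mul_div_comm, ← div_eq_mul_inv, div_le_div_iff₀ (by positivity) hr0]
    nlinarith [mul_le_mul_of_nonneg_left hr hA]

end PeriodicImages

namespace PeriodicImages

/-! ### Interpolation estimates from Taylor coefficients -/

theorem eval_glInterpolant {η : ℝ} (hη : 0 < η) (M : ℕ) (f : ℝ → ℂ) (u : ℝ) :
    (glInterpolant η M f).eval ((η / 2 * u : ℝ) : ℂ) =
      ∑ t ∈ legendreNodes M, f (η / 2 * t) * (legendreBasis M t u : ℂ) := by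
  rw [glInterpolant, Lagrange.interpolate_apply, eval_finsetSum]
  refine Finset.sum_congr rfl fun t _ => ?_
  rw [eval_mul, eval_C, legendreBasis, Lagrange.basis, Lagrange.basis, eval_prod, eval_prod,
    Complex.ofReal_prod]
  congr 1
  refine Finset.prod_congr rfl fun j _ => ?_
  have h : (η : ℂ) ≠ 0 := by exact_mod_cast hη.ne'
  simp only [Lagrange.basisDivisor, eval_mul, eval_C, eval_sub, eval_X, id]
  push_cast
  rw [← mul_sub, ← mul_sub, mul_inv]
  field_simp

/-- The node set is symmetric, and both sides are polynomials in `u` of degree below `M` with the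
same nodal values. This carries the estimate for expansions about the left end over to the right
end. -/
theorem legendreBasis_neg {M : ℕ} {t : ℝ} (ht : t ∈ legendreNodes M) (u : ℝ) :
    legendreBasis M (-t) u = legendreBasis M t (-u) := by
  have h := sum_legendreBasis_eq_eval (M := M) (r := (Lagrange.basis (legendreNodes M) id t).comp (-X))
    (f := fun s => if s = -t then 1 else 0) (by
      have h1 : (Lagrange.basis (legendreNodes M) id t).natDegree ≤ M - 1 := by
        rw [Lagrange.natDegree_basis Function.injective_id.injOn ht, card_legendreNodes]
      have h2 : 0 < M := by
        rw [← card_legendreNodes M]; exact Finset.card_pos.2 ⟨t, ht⟩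
      refine degree_le_natDegree.trans_lt ?_
      rw [natDegree_comp, natDegree_neg, natDegree_X, mul_one]
      norm_cast
      omega) (fun s hs => by
      rw [eval_comp, eval_neg, eval_X]
      split_ifs with h
      · rw [h, neg_neg]
        exact (Lagrange.eval_basis_self (v := id) Function.injective_id.injOn ht).symm
      · exact (Lagrange.eval_basis_of_ne (v := id) (fun h' => h (by rw [h', neg_neg]))
          (neg_mem_legendreNodes hs)).symm) u
  simp only [ite_mul, one_mul, zero_mul, Finset.sum_ite_eq', neg_mem_legendreNodes ht, if_true] at h
  rw [h, eval_comp, legendreBasis]; simp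

/-- On `[0, η]` the function `f` is the sum of a power series whose coefficients decay like those of
a function with a logarithmic singularity at distance `2 η` from the origin. -/
def HasLogDecay (η A : ℝ) (f : ℝ → ℂ) : Prop :=
  ∃ c : ℕ → ℂ, (∀ k, ‖c k‖ ≤ A * ((2 * η) ^ k)⁻¹ / Real.sqrt (k + 1)) ∧
    ∀ z ∈ Set.Icc 0 η, HasSum (fun k => c k * (z : ℂ) ^ k) (f z)

/-- Under `y = η u / 2` an expansion about `-η/2` becomes one in powers of `1 + u`, and `(2 η)^(-k)
(η / 2)^k = 4^(-k)`. -/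
theorem HasLogDecay.interpolation_error_le_of_left {η A : ℝ} (hη : 0 < η) {f : ℝ → ℂ}
    (hf : HasLogDecay η A fun z => f (-η / 2 + z)) {M : ℕ} (hM : 1 ≤ M) {y : ℝ}
    (hy : y ∈ Set.Icc (-η / 2) (η / 2)) :
    ‖f y - (glInterpolant η M f).eval (y : ℂ)‖ ≤ 10 * A * (rho0 ^ M)⁻¹ := by
  obtain ⟨c, hc, hs⟩ := hf
  obtain ⟨u, rfl⟩ : ∃ u, η / 2 * u = y := ⟨y / (η / 2), by field_simp⟩
  have hu : u ∈ Set.Icc (-1 : ℝ) 1 := ⟨by nlinarith [hy.1], by nlinarith [hy.2]⟩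
  rw [eval_glInterpolant hη]
  refine norm_interpolation_error_le hM (c := fun k => c k * ((η / 2 : ℝ) : ℂ) ^ k) (fun k => ?_)
    (f := fun u => f (η / 2 * u)) (fun u hu => ?_) hu
  · rw [norm_mul, norm_pow, Complex.norm_real, Real.norm_of_nonneg (by positivity)]
    refine (mul_le_mul_of_nonneg_right (hc k) (by positivity)).trans_eq ?_
    rw [inv_pow, div_mul_eq_mul_div, mul_assoc, ← inv_pow, ← mul_pow, ← inv_pow]
    congr 3
    field_simp
    norm_num
  · have h := hs (η / 2 * (1 + u)) ⟨by nlinarith [hu.1], by nlinarith [hu.2]⟩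
    beta_reduce at h
    rw [show -η / 2 + η / 2 * (1 + u) = η / 2 * u by ring] at h
    convert h using 2 with k
    push_cast
    rw [mul_pow]
    ring

theorem HasLogDecay.interpolation_error_le_of_right {η A : ℝ} (hη : 0 < η) {f : ℝ → ℂ}
    (hf : HasLogDecay η A fun z => f (η / 2 - z)) {M : ℕ} (hM : 1 ≤ M) {y : ℝ}
    (hy : y ∈ Set.Icc (-η / 2) (η / 2)) :
    ‖f y - (glInterpolant η M f).eval (y : ℂ)‖ ≤ 10 * A * (rho0 ^ M)⁻¹ := by
  have h := HasLogDecay.interpolation_error_le_of_left hη (f := fun v => f (-v)) (A := A)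
    (by convert hf using 3; ring) hM (y := -y) ⟨by linarith [hy.2], by linarith [hy.1]⟩
  rw [neg_neg] at h
  convert h using 3
  obtain ⟨u, rfl⟩ : ∃ u, η / 2 * u = y := ⟨y / (η / 2), by field_simp⟩
  rw [← mul_neg, eval_glInterpolant hη, eval_glInterpolant hη]
  refine Finset.sum_bij' (fun t _ => -t) (fun t _ => -t) (fun t ht => neg_mem_legendreNodes ht)
    (fun t ht => neg_mem_legendreNodes ht) (by simp) (by simp) fun t ht => ?_
  rw [legendreBasis_neg ht]; simp

/-! ### Closure properties of `HasLogDecay` -/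

theorem HasLogDecay.mono {η A B : ℝ} (hη : 0 < η) {f : ℝ → ℂ} (hf : HasLogDecay η A f)
    (h : A ≤ B) : HasLogDecay η B f := by
  obtain ⟨c, hc, hs⟩ := hf
  exact ⟨c, fun k => (hc k).trans (by gcongr), hs⟩

theorem HasLogDecay.congr {η A : ℝ} {f g : ℝ → ℂ} (hf : HasLogDecay η A f)
    (h : ∀ z ∈ Set.Icc 0 η, f z = g z) : HasLogDecay η A g := by
  obtain ⟨c, hc, hs⟩ := hf
  exact ⟨c, hc, fun z hz => h z hz ▸ hs z hz⟩

theorem HasLogDecay.add {η A B : ℝ} {f g : ℝ → ℂ} (hf : HasLogDecay η A f)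
    (hg : HasLogDecay η B g) : HasLogDecay η (A + B) fun z => f z + g z := by
  obtain ⟨c, hc, hs⟩ := hf
  obtain ⟨c', hc', hs'⟩ := hg
  refine ⟨fun k => c k + c' k, fun k => ?_, fun z hz => ?_⟩
  · refine (norm_add_le _ _).trans ((add_le_add (hc k) (hc' k)).trans_eq ?_)
    ring
  · simpa only [add_mul] using (hs z hz).add (hs' z hz)

theorem HasLogDecay.const_mul {η A : ℝ} {f : ℝ → ℂ} (hf : HasLogDecay η A f) (a : ℂ) :
    HasLogDecay η (‖a‖ * A) fun z => a * f z := by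
  obtain ⟨c, hc, hs⟩ := hf
  refine ⟨fun k => a * c k, fun k => ?_, fun z hz => ?_⟩
  · rw [norm_mul]
    refine (mul_le_mul_of_nonneg_left (hc k) (norm_nonneg a)).trans_eq ?_
    ring
  · simpa only [mul_assoc] using (hs z hz).mul_left a

theorem hasLogDecay_linear {η : ℝ} (hη : 0 < η) (a b : ℂ) :
    HasLogDecay η (‖a‖ + 4 * η * ‖b‖) fun z => a + b * z := by
  refine ⟨fun k => if k = 0 then a else if k = 1 then b else 0, fun k => ?_, fun z _ => ?_⟩
  · rcases k with _ | _ | k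
    · simp only [if_true, pow_zero, inv_one, mul_one]
      simp
      positivity
    · have : Real.sqrt 2 ≤ 2 := by rw [Real.sqrt_le_left (by norm_num)]; norm_num
      have h2 : 0 < Real.sqrt 2 := by positivity
      norm_num
      rw [show (‖a‖ + 4 * η * ‖b‖) * (η⁻¹ * (1 / 2)) / Real.sqrt 2 =
        (‖a‖ + 4 * η * ‖b‖) / (2 * η * Real.sqrt 2) by field_simp, le_div_iff₀ (by positivity)]
      nlinarith [norm_nonneg a, norm_nonneg b, mul_le_mul_of_nonneg_left this
        (mul_nonneg hη.le (norm_nonneg b))]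
    · simp
      positivity
  · have : HasSum (fun k : ℕ => (if k = 0 then a else if k = 1 then b else 0) * (z : ℂ) ^ k)
        (∑ k ∈ {0, 1}, (if k = 0 then a else if k = 1 then b else 0) * (z : ℂ) ^ k) :=
      hasSum_sum_of_ne_finset_zero fun k hk => by
        simp at hk; simp [hk]
    simpa using this

/-- Superposition of power series. -/
theorem HasLogDecay.tsum {ι : Type*} {η A : ℝ} (hη : 0 < η) {f : ι → ℝ → ℂ} {c : ι → ℕ → ℂ}
    {b : ι → ℕ → ℝ} (hs : ∀ i, ∀ z ∈ Set.Icc 0 η, HasSum (fun k => c i k * (z : ℂ) ^ k) (f i z))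
    (hcb : ∀ i k, ‖c i k‖ ≤ b i k) (hb : ∀ k, Summable fun i => b i k)
    (hA : ∀ k, ∑' i, b i k ≤ A * ((2 * η) ^ k)⁻¹ / Real.sqrt (k + 1)) :
    (∀ z ∈ Set.Icc 0 η, Summable fun i => f i z) ∧ HasLogDecay η A fun z => ∑' i, f i z := by
  have hb0 : ∀ i k, 0 ≤ b i k := fun i k => (norm_nonneg _).trans (hcb i k)
  have hA0 : 0 ≤ A := by simpa using (tsum_nonneg fun i => hb0 i 0).trans (hA 0)
  have hcs : ∀ k, Summable fun i => c i k := fun k =>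
    Summable.of_norm_bounded (hb k) fun i => hcb i k
  have hsum : ∀ z ∈ Set.Icc 0 η, Summable fun p : ℕ × ι => c p.2 p.1 * (z : ℂ) ^ p.1 := by
    intro z hz
    -- Since `z ≤ η < 2 η`, the double series converges absolutely and can be reordered.
    have hz' : z / (2 * η) < 1 := by rw [div_lt_one (by positivity)]; linarith [hz.2]
    have : Summable fun p : ℕ × ι => b p.2 p.1 * z ^ p.1 := by
      have hnn : 0 ≤ fun p : ℕ × ι => b p.2 p.1 * z ^ p.1 := fun p =>
        mul_nonneg (hb0 p.2 p.1) (pow_nonneg hz.1 _)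
      refine (summable_prod_of_nonneg hnn).2 ⟨fun k => (hb k).mul_right (z ^ k), ?_⟩
      refine Summable.of_nonneg_of_le (fun k => tsum_nonneg fun i =>
        mul_nonneg (hb0 _ _) (pow_nonneg hz.1 _)) (fun k => ?_)
        ((summable_geometric_of_lt_one (div_nonneg hz.1 (by positivity)) hz').mul_left A)
      change ∑' i, b i k * z ^ k ≤ _
      rw [tsum_mul_right, div_pow, div_eq_inv_mul, ← mul_assoc]
      refine mul_le_mul_of_nonneg_right ((hA k).trans ?_) (pow_nonneg hz.1 _)
      refine div_le_self (by positivity) ?_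
      rw [Real.one_le_sqrt]
      linarith [k.cast_nonneg (α := ℝ)]
    refine Summable.of_norm_bounded this fun p => ?_
    rw [norm_mul, norm_pow, Complex.norm_real, Real.norm_of_nonneg hz.1]
    exact mul_le_mul_of_nonneg_right (hcb _ _) (pow_nonneg hz.1 _)
  have hsw : ∀ z ∈ Set.Icc 0 η, Summable fun p : ι × ℕ => c p.1 p.2 * (z : ℂ) ^ p.2 :=
    fun z hz => (hsum z hz).prod_symm
  refine ⟨fun z hz => ?_, fun k => ∑' i, c i k, fun k => ?_, fun z hz => ?_⟩
  · have := (hsw z hz).prod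
    exact this.congr fun i => (hs i z hz).tsum_eq
  · exact (tsum_of_norm_bounded (hb k).hasSum fun i => hcb i k).trans (hA k)
  · have h1 : ∑' i, f i z = ∑' k, ∑' i, c i k * (z : ℂ) ^ k := by
      have h2 := Summable.tsum_comm' (f := fun k i => c i k * (z : ℂ) ^ k) (hsum z hz)
        (fun k => (hcs k).mul_right ((z : ℂ) ^ k)) (fun i => (hs i z hz).summable)
      rw [← h2]
      exact tsum_congr fun i => ((hs i z hz).tsum_eq).symm
    beta_reduce
    rw [h1]
    simp_rw [← tsum_mul_right]
    exact (hsum z hz).prod.hasSum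

end PeriodicImages

namespace PeriodicImages

open MeasureTheory Set

/-! ### Sums over the modes -/

theorem integral_pow_mul_exp_neg (n : ℕ) {W : ℝ} (hW : 0 < W) :
    ∫ x in Ioi (0 : ℝ), x ^ n * Real.exp (-(W * x)) = n.factorial / W ^ (n + 1) := by
  have h := Real.integral_rpow_mul_exp_neg_mul_Ioi (a := n + 1) (r := W) (by positivity) hW
  rw [Real.Gamma_nat_eq_factorial] at h
  simp only [add_sub_cancel_right, Real.rpow_natCast] at h
  rw [h, ← Nat.cast_add_one, Real.rpow_natCast, one_div, inv_pow]
  field_simp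

theorem integrableOn_pow_mul_exp_neg (n : ℕ) {W : ℝ} (hW : 0 < W) :
    IntegrableOn (fun x : ℝ => x ^ n * Real.exp (-(W * x))) (Ioi 0) := by
  have h := integrableOn_rpow_mul_exp_neg_mul_rpow (p := 1) (s := n) (b := W)
    (by have := n.cast_nonneg (α := ℝ); linarith) one_pos hW
  simpa [Real.rpow_natCast] using h

/-- The size of the `k`th Taylor coefficient at distance `W` of the modes `exp (-κ w) / κ` and
`w exp (-κ w)`. -/
noncomputable def modeBound (W : ℝ) (k : ℕ) (κ : ℝ) : ℝ :=
  (1 + |κ * W - k|) * (κ ^ k / κ) * Real.exp (-(W * κ)) / k.factorial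

theorem modeBound_nonneg (W : ℝ) (k : ℕ) {κ : ℝ} (hκ : 0 ≤ κ) : 0 ≤ modeBound W k κ := by
  unfold modeBound; positivity

/-- Up to the factor `j! / W^(j+1)` the weight makes `x W` a Gamma variable of shape `j + 1`, whose
mean and variance are both `j + 1`. -/
theorem integral_modeBound_majorant (j : ℕ) {W : ℝ} (hW : 0 < W) (E D : ℝ) :
    IntegrableOn (fun x : ℝ => (E + D * (x * W - (j + 1)) ^ 2) * (x ^ j * Real.exp (-(W * x))))
      (Ioi 0) ∧
    ∫ x in Ioi (0 : ℝ), (E + D * (x * W - (j + 1)) ^ 2) * (x ^ j * Real.exp (-(W * x))) =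
      (E + D * (j + 1)) * j.factorial / W ^ (j + 1) := by
  have e : (fun x : ℝ => (E + D * (x * W - (j + 1)) ^ 2) * (x ^ j * Real.exp (-(W * x)))) =
      fun x => (E + D * (j + 1) ^ 2) * (x ^ j * Real.exp (-(W * x))) +
        (-(2 * D * W * (j + 1)) * (x ^ (j + 1) * Real.exp (-(W * x))) +
        D * W ^ 2 * (x ^ (j + 2) * Real.exp (-(W * x)))) := by
    ext x; ring
  rw [e]
  have h0 := (integrableOn_pow_mul_exp_neg j hW).const_mul (E + D * (j + 1) ^ 2)
  have h1 := (integrableOn_pow_mul_exp_neg (j + 1) hW).const_mul (-(2 * D * W * (j + 1)))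
  have h2 := (integrableOn_pow_mul_exp_neg (j + 2) hW).const_mul (D * W ^ 2)
  have h12 : IntegrableOn (fun x => -(2 * D * W * (j + 1)) * (x ^ (j + 1) * Real.exp (-(W * x))) +
      D * W ^ 2 * (x ^ (j + 2) * Real.exp (-(W * x)))) (Ioi 0) := h1.add h2
  refine ⟨h0.add h12, ?_⟩
  rw [integral_add h0 h12, integral_add h1 h2, integral_const_mul, integral_const_mul,
    integral_const_mul, integral_pow_mul_exp_neg _ hW, integral_pow_mul_exp_neg _ hW,
    integral_pow_mul_exp_neg _ hW, Nat.factorial_succ (j + 1), Nat.factorial_succ j]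
  push_cast
  field_simp
  ring

/-- With `k = j + 1`, the integral of `κ^(k-1) exp (-W κ) / k!` is `W^(-k) / k`, and the deviation
`|κ W - k|` has mean of order `√k`; together they give `W^(-k) / √k`. The constant must not depend
on the sequence of rates, which will later vary with `k`. -/
theorem sum_modeBound_succ_le {W a b : ℝ} (hW : 0 < W) (ha : 0 < a) (hb : 0 ≤ b) :
    ∃ C, ∀ κ : ℕ → ℝ, (∀ m : ℕ, a * m ≤ κ m ∧ κ m ≤ a * m + b) → (∀ m, 0 < κ m) → ∀ j N : ℕ,
      ∑ m ∈ Finset.range N, modeBound W (j + 1) (κ m) ≤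
        C * (W ^ (j + 1))⁻¹ / Real.sqrt ((j : ℝ) + 1 + 1) := by
  set E : ℝ := 1 + (a + b) * W with hE
  have hE0 : 0 < E := by positivity
  refine ⟨Real.exp ((a + b) * W) / a * (2 * (E + 1)), fun κ hκ hκ0 j N => ?_⟩
  set k : ℝ := (j : ℝ) + 1 with hk
  have hk1 : 1 ≤ k := by rw [hk]; linarith [j.cast_nonneg (α := ℝ)]
  set s := Real.sqrt k with hs
  have hs1 : 1 ≤ s := Real.one_le_sqrt.2 hk1
  have hss : s * s = k := Real.mul_self_sqrt (by linarith)
  set g : ℝ → ℝ := fun x => (E + s / 2 + 1 / (2 * s) * (x * W - k) ^ 2) *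
    (x ^ j * Real.exp (-(W * x))) with hg
  have hgc : Continuous g := by fun_prop
  obtain ⟨hgi, hgv⟩ := integral_modeBound_majorant j hW (E + s / 2) (1 / (2 * s))
  have hg0 : ∀ x, 0 ≤ x → 0 ≤ g x := fun x hx => by simp only [hg]; positivity
  -- The cell of `m` starts at `a m + b ≥ κ m`. Passing from `κ m` to a point of the cell thus
  -- increases the power and costs at most `exp ((a + b) W)` in the exponential.
  have hcell : ∀ m : ℕ, modeBound W (j + 1) (κ m) ≤
      Real.exp ((a + b) * W) / a / (j + 1).factorial *
        ∫ x in (a * m + b)..(a * (m + 1 : ℕ) + b), g x := fun m => by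
    obtain ⟨h1, h2⟩ := hκ m
    have hpt : ∀ x ∈ Icc (a * m + b) (a * (m + 1 : ℕ) + b),
        (1 + |κ m * W - k|) * (κ m ^ j * Real.exp (-(W * κ m))) ≤
          Real.exp ((a + b) * W) * g x := fun x hx => by
      push_cast at hx
      have hx1 : κ m ≤ x := h2.trans hx.1
      have hx2 : x ≤ κ m + (a + b) := by nlinarith [hx.2]
      have h3 : |κ m * W - k| ≤ |x * W - k| + (a + b) * W := by
        have : |κ m * W - k - (x * W - k)| ≤ (a + b) * W := by
          rw [abs_le]; constructor <;> nlinarith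
        have := abs_sub_abs_le_abs_sub (κ m * W - k) (x * W - k)
        linarith
      -- Arithmetic-geometric mean inequality, with the weight `s = √k` that balances the two terms
      -- against the variance `k`.
      have h4 : |x * W - k| ≤ s / 2 + 1 / (2 * s) * (x * W - k) ^ 2 := by
        rw [← sub_nonneg]
        have : s / 2 + 1 / (2 * s) * (x * W - k) ^ 2 - |x * W - k| =
            (s - |x * W - k|) ^ 2 / (2 * s) := by
          rw [← sq_abs (x * W - k)]
          field_simp
          ring
        rw [this]; positivity
      have h5 : Real.exp (-(W * κ m)) ≤ Real.exp ((a + b) * W) * Real.exp (-(W * x)) := by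
        rw [← Real.exp_add, Real.exp_le_exp]; nlinarith
      calc (1 + |κ m * W - k|) * (κ m ^ j * Real.exp (-(W * κ m)))
          ≤ (E + s / 2 + 1 / (2 * s) * (x * W - k) ^ 2) *
            (x ^ j * (Real.exp ((a + b) * W) * Real.exp (-(W * x)))) := by
            have := (hκ0 m).le
            have h6 : 1 + |κ m * W - k| ≤ E + s / 2 + 1 / (2 * s) * (x * W - k) ^ 2 := by linarith
            have hx0 : 0 ≤ x := this.trans hx1
            refine mul_le_mul h6 ?_ (by positivity) (by linarith [abs_nonneg (κ m * W - k)])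
            gcongr
        _ = _ := by simp only [hg]; ring
    have hint := intervalIntegral.integral_mono_on (μ := volume) (by push_cast; nlinarith) (by simp)
      ((hgc.const_mul _).intervalIntegrable _ _) hpt
    rw [intervalIntegral.integral_const, intervalIntegral.integral_const_mul] at hint
    have e1 : a * ((m + 1 : ℕ) : ℝ) + b - (a * m + b) = a := by push_cast; ring
    rw [e1, smul_eq_mul] at hint
    have hf : (0 : ℝ) < (j + 1).factorial := by positivity
    have e2 : modeBound W (j + 1) (κ m) =
        a * ((1 + |κ m * W - k|) * (κ m ^ j * Real.exp (-(W * κ m)))) / a / (j + 1).factorial := by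
      have := (hκ0 m).ne'
      simp only [modeBound, hk]
      push_cast
      field_simp
      ring
    rw [e2]
    refine (div_le_div_of_nonneg_right (div_le_div_of_nonneg_right hint ha.le) hf.le).trans_eq ?_
    ring
  calc ∑ m ∈ Finset.range N, modeBound W (j + 1) (κ m)
      ≤ ∑ m ∈ Finset.range N, Real.exp ((a + b) * W) / a / (j + 1).factorial *
        ∫ x in (a * m + b)..(a * (m + 1 : ℕ) + b), g x := Finset.sum_le_sum fun m _ => hcell m
    _ = Real.exp ((a + b) * W) / a / (j + 1).factorial * ∫ x in (b)..(a * N + b), g x := by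
      rw [← Finset.mul_sum, intervalIntegral.sum_integral_adjacent_intervals
        (a := fun m : ℕ => a * (m : ℝ) + b) fun m _ => hgc.intervalIntegrable _ _]
      simp
    _ ≤ Real.exp ((a + b) * W) / a / (j + 1).factorial * ∫ x in Ioi 0, g x := by
      refine mul_le_mul_of_nonneg_left ?_ (by positivity)
      have hbN : b ≤ a * N + b := by
        have : 0 ≤ a * (N : ℝ) := by positivity
        linarith
      rw [intervalIntegral.integral_of_le hbN]
      refine setIntegral_mono_set hgi ?_ ?_
      · filter_upwards [ae_restrict_mem measurableSet_Ioi] with x hx using hg0 x hx.le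
      · exact LE.le.eventuallyLE fun x hx => lt_of_le_of_lt hb hx.1
    _ ≤ _ := by
      simp only [hg]
      rw [hgv]
      have h2 : Real.sqrt (k + 1) ≤ 2 * s := by
        rw [Real.sqrt_le_left (by positivity)]
        nlinarith
      have h3 : 0 < Real.sqrt (k + 1) := Real.sqrt_pos.2 (by linarith)
      have e : Real.exp ((a + b) * W) / a / (j + 1).factorial *
          ((E + s / 2 + 1 / (2 * s) * (j + 1)) * j.factorial / W ^ (j + 1)) =
          Real.exp ((a + b) * W) / a * (W ^ (j + 1))⁻¹ * ((E + s) / k) := by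
        rw [← hk, ← hss, Nat.factorial_succ]
        push_cast
        rw [← hk, ← hss]
        field_simp
        ring
      rw [e]
      have h4 : (E + s) / k ≤ 2 * (E + 1) / Real.sqrt (k + 1) := by
        rw [div_le_div_iff₀ (by linarith) h3]
        nlinarith [mul_le_mul_of_nonneg_left h2 (by positivity : 0 ≤ E + s),
          mul_nonneg (mul_nonneg hE0.le (by positivity : 0 ≤ s)) (sub_nonneg.2 hs1)]
      calc _ ≤ Real.exp ((a + b) * W) / a * (W ^ (j + 1))⁻¹ * (2 * (E + 1) / Real.sqrt (k + 1)) := by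
            gcongr
        _ = _ := by ring

/-- The comparison with an integral fails at `k = 0`, where `1 / κ` is not integrable at 0; the
lower bound on the rates reduces this case to `k = 1`. -/
theorem modeBound_zero_le {W δ κ : ℝ} (hW : 0 < W) (hδ : 0 < δ) (hκ : δ ≤ κ) :
    modeBound W 0 κ ≤ 2 / δ * modeBound W 1 κ := by
  have h0 : 0 < κ := hδ.trans_le hκ
  have h1 : 0 < κ * W := by positivity
  have h2 : 1 + κ * W ≤ 2 * (1 + |κ * W - 1|) := by
    cases abs_cases (κ * W - 1) <;> linarith
  simp only [modeBound, pow_zero, pow_one, Nat.factorial, Nat.cast_zero, sub_zero, abs_of_pos h1,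
    Nat.cast_one, div_self h0.ne', mul_one, div_one]
  norm_num
  calc (1 + κ * W) * κ⁻¹ * Real.exp (-(W * κ))
      ≤ (2 * (1 + |κ * W - 1|)) * δ⁻¹ * Real.exp (-(W * κ)) := by gcongr
    _ = _ := by ring

/-- Sums of the mode bounds over all wave numbers. -/
theorem exists_tsum_modeBound_le {W a b δ : ℝ} (hW : 0 < W) (ha : 0 < a) (hb : 0 ≤ b)
    (hδ : 0 < δ) : ∃ C, 0 ≤ C ∧ ∀ κ : ℤ → ℝ,
      (∀ m : ℤ, a * |(m : ℝ)| ≤ κ m ∧ κ m ≤ a * |(m : ℝ)| + b ∧ δ ≤ κ m) → ∀ k : ℕ,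
      (Summable fun m => modeBound W k (κ m)) ∧
        ∑' m, modeBound W k (κ m) ≤ C * (W ^ k)⁻¹ / Real.sqrt (k + 1) := by
  obtain ⟨C₁, hC₁⟩ := sum_modeBound_succ_le hW ha (b := a + b) (by positivity)
  have hsucc : ∀ κ : ℤ → ℝ,
      (∀ m : ℤ, a * |(m : ℝ)| ≤ κ m ∧ κ m ≤ a * |(m : ℝ)| + b ∧ δ ≤ κ m) → ∀ j : ℕ,
      (Summable fun m => modeBound W (j + 1) (κ m)) ∧ ∑' m, modeBound W (j + 1) (κ m) ≤
        2 * (C₁ * (W ^ (j + 1))⁻¹ / Real.sqrt ((j : ℝ) + 1 + 1)) := by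
    intro κ hκ j
    have h0 : ∀ m, 0 < κ m := fun m => hδ.trans_le (hκ m).2.2
    have hn := fun m => modeBound_nonneg W (j + 1) (h0 m).le
    have hp := hC₁ (fun m => κ m) (fun m => by
      have := hκ m
      simp only [Int.cast_natCast, abs_of_nonneg (Nat.cast_nonneg m : (0 : ℝ) ≤ m)] at this
      exact ⟨this.1, by linarith⟩) (fun m => h0 _) j
    -- `|-(m + 1)| = m + 1` shifts the window by `a`, which is why `sum_modeBound_succ_le` is
    -- applied with `a + b` in place of `b`.
    have hq := hC₁ (fun m => κ (-(m + 1))) (fun m => by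
      have := hκ (-(m + 1))
      push_cast at this
      rw [abs_neg, abs_of_nonneg (by positivity)] at this
      constructor <;> linarith) (fun m => h0 _) j
    have h1 := (summable_of_sum_range_le (fun m => hn _) hp).hasSum
    have h2 := (summable_of_sum_range_le (fun m => hn _) hq).hasSum
    have h3 := HasSum.of_nat_of_neg_add_one (f := fun m => modeBound W (j + 1) (κ m)) h1 h2
    refine ⟨h3.summable, h3.tsum_eq.trans_le ?_⟩
    linarith [Real.tsum_le_of_sum_range_le (fun m => hn _) hp,
      Real.tsum_le_of_sum_range_le (fun m => hn _) hq]
  -- The bound on the empty sum forces `C₁ ≥ 0`.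
  have hC₁0 : 0 ≤ C₁ := by
    have := hC₁ (fun m => a * m + a) (fun m => ⟨by linarith, by linarith⟩)
      (fun m => by positivity) 0 0
    simp only [Finset.range_zero, Finset.sum_empty] at this
    rw [le_div_iff₀ (by positivity), zero_mul] at this
    exact nonneg_of_mul_nonneg_left this (by positivity)
  refine ⟨2 * C₁ + 4 / δ * C₁ * W⁻¹, by positivity, fun κ hκ k => ?_⟩
  have h0 : ∀ m, 0 < κ m := fun m => hδ.trans_le (hκ m).2.2
  rcases k with _ | j
  · obtain ⟨h1, h2⟩ := hsucc κ hκ 0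
    have hle := fun m => modeBound_zero_le hW hδ (hκ m).2.2
    have hs := Summable.of_nonneg_of_le (fun m => modeBound_nonneg W 0 (h0 m).le) hle
      (h1.mul_left (2 / δ))
    refine ⟨hs, (hs.tsum_le_tsum hle (h1.mul_left (2 / δ))).trans ?_⟩
    rw [tsum_mul_left]
    refine (mul_le_mul_of_nonneg_left h2 (by positivity)).trans ?_
    simp only [pow_zero, zero_add, pow_one, Nat.cast_zero, inv_one, mul_one, Real.sqrt_one, div_one]
    have : C₁ * W⁻¹ / Real.sqrt (1 + 1) ≤ C₁ * W⁻¹ :=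
      div_le_self (by positivity) (Real.one_le_sqrt.2 (by norm_num))
    calc 2 / δ * (2 * (C₁ * W⁻¹ / Real.sqrt (1 + 1))) ≤ 2 / δ * (2 * (C₁ * W⁻¹)) := by gcongr
      _ = 4 / δ * C₁ * W⁻¹ := by ring
      _ ≤ _ := by linarith
  · obtain ⟨h1, h2⟩ := hsucc κ hκ j
    refine ⟨h1, h2.trans ?_⟩
    push_cast
    rw [← mul_div_assoc, ← mul_assoc]
    gcongr
    have : 0 ≤ 4 / δ * C₁ * W⁻¹ := by positivity
    linarith

end PeriodicImages

namespace PeriodicImages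

/-! ### Series of modes -/

theorem interpolationEstimates_swap {η : ℝ} {K : ℝ × ℝ → ℝ × ℝ → ℂ}
    (h : InterpolationEstimates η K) : InterpolationEstimates η fun t s => K s t := by
  obtain ⟨C, hC⟩ := h
  exact ⟨C, fun M hM x x' y hy y' hy' => (hC M hM x' x y' hy' y hy).symm⟩

/-- Interpolation estimates for kernels that depend on `y - y'` up to a multiple of `y y'`. -/
theorem interpolationEstimates_of_hasLogDecay {η A : ℝ} (hη : 0 < η) {K : ℝ × ℝ → ℝ × ℝ → ℂ}
    {F : ℝ → ℝ → ℂ} {e : ℂ}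
    (hK : ∀ x x' : ℝ, ∀ y ∈ Set.Icc (-η / 2) (η / 2), ∀ y' ∈ Set.Icc (-η / 2) (η / 2),
      K (x, y) (x', y') = e * y * y' + F (x - x') (y - y' + 2 * η))
    (hF : ∀ X w₀ : ℝ, 2 * η ≤ w₀ → HasLogDecay η A fun z => F X (w₀ - z)) :
    InterpolationEstimates η K := by
  set B : ℝ := ‖e‖ * (η / 2) * (η / 2) + 4 * η * (‖e‖ * (η / 2)) with hB
  have hlin : ∀ y' ∈ Set.Icc (-η / 2) (η / 2), ∀ ε ε' : ℂ, ‖ε‖ = 1 → ‖ε'‖ = 1 →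
      HasLogDecay η B fun z => e * (η / 2 : ℝ) * y' * ε + e * y' * ε' * z :=
        fun y' hy' ε ε' hε hε' => by
    have h1 : |y'| ≤ η / 2 := abs_le.2 ⟨by linarith [hy'.1], hy'.2⟩
    refine (hasLogDecay_linear hη _ _).mono hη ?_
    simp only [norm_mul, hε, hε', Complex.norm_real, Real.norm_eq_abs, abs_of_pos (half_pos hη), mul_one]
    rw [hB]
    gcongr
  refine ⟨10 * (B + A), fun M hM x x' y hy y' hy' => ⟨?_, ?_⟩⟩
  -- The target is expanded about the top edge and the source about the bottom edge, where `y - y'`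
  -- is largest. The centre then satisfies `w₀ ≥ 2 η`, because the other coordinate is confined to
  -- the strip.
  · refine HasLogDecay.interpolation_error_le_of_right hη (f := fun v => K (x, v) (x', y')) ?_ hM hy
    refine ((hlin y' hy' 1 (-1) (by simp) (by simp)).congr
      (g := fun z => e * (η / 2 - z : ℝ) * y') fun z hz => by push_cast; ring).add
      (hF (x - x') (η / 2 - y' + 2 * η) (by linarith [hy'.2])) |>.congr fun z hz => ?_
    rw [hK _ _ _ ⟨by linarith [hz.2], by linarith [hz.1]⟩ _ hy']
    congr 2
    ring
  · refine HasLogDecay.interpolation_error_le_of_left hη (f := fun v => K (x, y) (x', v)) ?_ hM hy'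
    refine ((hlin y hy (-1) 1 (by simp) (by simp)).congr
      (g := fun z => e * y * (-η / 2 + z : ℝ)) fun z hz => ?_).add
      (hF (x - x') (y + η / 2 + 2 * η) (by linarith [hy.1])) |>.congr fun z hz => ?_
    · push_cast; ring
    · rw [hK _ _ _ hy _ ⟨by linarith [hz.1], by linarith [hz.2]⟩]
      congr 2
      ring

/-- Multiplying the exponential series by `z` shifts the index, which turns `z` into the factor `k /
κ` in the `k`th coefficient. -/
theorem hasSum_mode {κ : ℝ} (hκ : κ ≠ 0) (p q : ℂ) (w₀ z : ℝ) :
    HasSum (fun k : ℕ => (p + q * (w₀ - k / κ : ℝ)) * (Real.exp (-(w₀ * κ)) *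
      (κ ^ k / k.factorial) : ℝ) * (z : ℂ) ^ k)
      ((p + q * (w₀ - z : ℝ)) * (Real.exp (-((w₀ - z) * κ)) : ℝ)) := by
  have h0 : HasSum (fun k : ℕ => (κ * z) ^ k / k.factorial) (Real.exp (κ * z)) := by
    rw [Real.exp_eq_exp_ℝ]
    exact NormedSpace.expSeries_div_hasSum_exp (κ * z)
  have h1 : HasSum (fun k : ℕ => k * ((κ * z) ^ k / k.factorial)) (κ * z * Real.exp (κ * z)) := by
    rw [← hasSum_nat_add_iff' 1]
    simp only [Finset.range_one, Finset.sum_singleton, Nat.cast_zero, zero_mul, sub_zero]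
    have e : (fun k : ℕ => ((k + 1 : ℕ) : ℝ) * ((κ * z) ^ (k + 1) / (k + 1).factorial)) =
        fun k : ℕ => κ * z * ((κ * z) ^ k / k.factorial) := by
      ext k
      rw [Nat.factorial_succ]
      push_cast
      have : (k : ℝ) + 1 ≠ 0 := by positivity
      field_simp
      ring
    rw [e]
    exact h0.mul_left (κ * z)
  have h2 := ((Complex.hasSum_ofReal.2 (h0.mul_left (Real.exp (-(w₀ * κ))))).mul_left (p + q * w₀)).sub
    ((Complex.hasSum_ofReal.2 (h1.mul_left (Real.exp (-(w₀ * κ)) / κ))).mul_left q)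
  have hκ' : (κ : ℂ) ≠ 0 := by exact_mod_cast hκ
  refine (congrArg₂ HasSum (funext fun k => ?_) ?_).mp h2
  · push_cast
    field_simp
    ring
  · have : Real.exp (-((w₀ - z) * κ)) = Real.exp (-(w₀ * κ)) * Real.exp (κ * z) := by
      rw [← Real.exp_add]; congr 1; ring
    rw [this]
    push_cast
    field_simp
    ring

/-- Of the extra decay `exp (-κ (w - W))` one half pays for the growth of `|κ w - k|`; the other
half is kept, so that distant rows of images can be summed. -/
theorem modeBound_le {W w κ : ℝ} (hw : W ≤ w) (hκ : 0 < κ) (k : ℕ) :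
    modeBound w k κ ≤ 2 * Real.exp (-(κ * (w - W) / 2)) * modeBound W k κ := by
  have h0 : 0 ≤ κ * (w - W) := mul_nonneg hκ.le (sub_nonneg.2 hw)
  have h1 : |κ * w - k| ≤ |κ * W - k| + κ * (w - W) := by
    have := abs_add_le (κ * W - k) (κ * (w - W))
    rw [abs_of_nonneg h0] at this
    rwa [show κ * W - k + κ * (w - W) = κ * w - k by ring] at this
  have h2 : 1 + |κ * w - k| ≤ (1 + |κ * W - k|) * (2 * Real.exp (κ * (w - W) / 2)) := by
    have h3 := Real.add_one_le_exp (κ * (w - W) / 2)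
    nlinarith [mul_le_mul_of_nonneg_left h3 (abs_nonneg (κ * W - k)),
      mul_nonneg h0 (abs_nonneg (κ * W - k)), abs_nonneg (κ * W - k)]
  have h4 : Real.exp (-(w * κ)) = Real.exp (-(κ * (w - W) / 2)) * Real.exp (-(κ * (w - W) / 2)) *
      Real.exp (-(W * κ)) := by
    rw [← Real.exp_add, ← Real.exp_add]; congr 1; ring
  have h5 : Real.exp (κ * (w - W) / 2) * Real.exp (-(κ * (w - W) / 2)) = 1 := by
    rw [← Real.exp_add]; simp
  unfold modeBound
  rw [h4]
  calc _ ≤ (1 + |κ * W - k|) * (2 * Real.exp (κ * (w - W) / 2)) * (κ ^ k / κ) *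
        (Real.exp (-(κ * (w - W) / 2)) * Real.exp (-(κ * (w - W) / 2)) *
        Real.exp (-(W * κ))) / k.factorial := by gcongr
    _ = (Real.exp (κ * (w - W) / 2) * Real.exp (-(κ * (w - W) / 2))) *
        (2 * Real.exp (-(κ * (w - W) / 2)) * ((1 + |κ * W - k|) * (κ ^ k / κ) *
        Real.exp (-(W * κ)) / k.factorial)) := by ring
    _ = _ := by rw [h5, one_mul]

theorem norm_mode_coeff_le {W w κ D : ℝ} (hw : W ≤ w) (hκ : 0 < κ) (hD : 0 ≤ D) {p q : ℂ}
    (hp : ‖p‖ ≤ D / κ) (hq : ‖q‖ ≤ D) (k : ℕ) :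
    ‖(p + q * (w - k / κ : ℝ)) * (Real.exp (-(w * κ)) * (κ ^ k / k.factorial) : ℝ)‖ ≤
      2 * D * Real.exp (-(κ * (w - W) / 2)) * modeBound W k κ := by
  have h1 : ‖p + q * (w - k / κ : ℝ)‖ ≤ D * (1 + |κ * w - k|) / κ := by
    refine (norm_add_le _ _).trans ?_
    rw [norm_mul, Complex.norm_real, Real.norm_eq_abs]
    have : w - k / κ = (κ * w - k) / κ := by field_simp
    rw [this, abs_div, abs_of_pos hκ]
    calc _ ≤ D / κ + D * (|κ * w - k| / κ) := by gcongr
      _ = _ := by ring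
  rw [norm_mul, Complex.norm_real, Real.norm_of_nonneg (by positivity)]
  calc _ ≤ D * (1 + |κ * w - k|) / κ * (Real.exp (-(w * κ)) * (κ ^ k / k.factorial)) := by gcongr
    _ = D * modeBound w k κ := by unfold modeBound; ring
    _ ≤ _ := by
      refine (mul_le_mul_of_nonneg_left (modeBound_le hw hκ k) hD).trans_eq ?_
      ring

/-- Series of modes over the nonzero wave numbers. -/
theorem exists_hasLogDecay_tsum_modes {d η : ℝ} (hd : 0 < d) (hη : 0 < η) (D : ℝ) (hD : 0 ≤ D) :
    ∃ A, ∀ p q : ℤ → ℂ,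
      (∀ m, m ≠ 0 → ‖p m‖ ≤ D / |waveNumber d m| ∧ ‖q m‖ ≤ D) → ∀ w₀, 2 * η ≤ w₀ →
      HasLogDecay η A fun z => ∑' m, if m = 0 then 0 else
        (p m + q m * (w₀ - z : ℝ)) * (Real.exp (-((w₀ - z) * |waveNumber d m|)) : ℝ) := by
  have ha : 0 < 2 * Real.pi / d := by positivity
  obtain ⟨C, hC0, hC⟩ := exists_tsum_modeBound_le (W := 2 * η) (by positivity) ha ha.le ha
  have hα : ∀ m : ℤ, |waveNumber d m| = 2 * Real.pi / d * |(m : ℝ)| := fun m => by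
    rw [waveNumber, mul_div_right_comm, abs_mul, abs_of_pos ha]
  refine ⟨2 * D * C, fun p q hpq w₀ hw₀ => ?_⟩
  -- The absent mode `m = 0` receives a dummy rate, so that all rates are bounded below.
  set κ : ℤ → ℝ := fun m => if m = 0 then 2 * Real.pi / d else |waveNumber d m| with hκ
  have hκb : ∀ m : ℤ, 2 * Real.pi / d * |(m : ℝ)| ≤ κ m ∧
      κ m ≤ 2 * Real.pi / d * |(m : ℝ)| + 2 * Real.pi / d ∧ 2 * Real.pi / d ≤ κ m := fun m => by
    by_cases hm : m = 0
    · simp [hκ, hm, ha.le]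
    · have h1 : (1 : ℝ) ≤ |(m : ℝ)| := by exact_mod_cast Int.one_le_abs hm
      simp only [hκ, if_neg hm, hα]
      exact ⟨le_rfl, by linarith, by nlinarith⟩
  have hκ0 : ∀ m, 0 < κ m := fun m => ha.trans_le (hκb m).2.2
  refine (HasLogDecay.tsum hη
    (c := fun m k => if m = 0 then 0 else (p m + q m * (w₀ - k / κ m : ℝ)) *
      (Real.exp (-(w₀ * κ m)) * (κ m ^ k / k.factorial) : ℝ))
    (b := fun m k => 2 * D * modeBound (2 * η) k (κ m)) (fun m z _ => ?_) (fun m k => ?_)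
    (fun k => (hC κ hκb k).1.mul_left _) (fun k => ?_)).2
  · by_cases hm : m = 0
    · simp only [hm, if_true, zero_mul]
      exact hasSum_zero
    · have := hasSum_mode (hκ0 m).ne' (p m) (q m) w₀ z
      simp only [if_neg hm]
      simp only [hκ, if_neg hm] at this ⊢
      exact this
  · by_cases hm : m = 0
    · simp only [hm, if_true, norm_zero]
      have := modeBound_nonneg (2 * η) k (hκ0 0).le
      positivity
    · simp only [if_neg hm]
      have hk : κ m = |waveNumber d m| := by simp only [hκ, if_neg hm]
      refine (norm_mode_coeff_le hw₀ (hκ0 m) hD (hk ▸ (hpq m hm).1) (hpq m hm).2 k).trans ?_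
      refine mul_le_mul_of_nonneg_right ?_ (modeBound_nonneg _ _ (hκ0 m).le)
      refine mul_le_of_le_one_right (by positivity) ?_
      rw [Real.exp_le_one_iff]
      have := mul_nonneg (hκ0 m).le (sub_nonneg.2 hw₀)
      linarith
  · rw [tsum_mul_left]
    refine (mul_le_mul_of_nonneg_left (hC κ hκb k).2 (by positivity)).trans_eq ?_
    ring

end PeriodicImages

namespace PeriodicImages

/-! ### The Poisson and Stokes kernels -/

theorem norm_exp_neg_Qexp (d ξ η : ℝ) (m : ℤ) :
    ‖Complex.exp (-Qexp d ξ η m)‖ = Real.exp (-(|waveNumber d m| * η)) := by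
  rw [Complex.norm_exp]; congr 1; simp [Qexp]

theorem abs_waveNumber_ge {d : ℝ} (hd : 0 < d) {m : ℤ} (hm : m ≠ 0) :
    2 * Real.pi / d ≤ |waveNumber d m| := by
  have h1 : (1 : ℝ) ≤ |(m : ℝ)| := by exact_mod_cast Int.one_le_abs hm
  rw [waveNumber, mul_div_right_comm _ (m : ℝ), abs_mul, abs_of_pos (by positivity)]
  exact le_mul_of_one_le_right (by positivity) h1

/-- Bounds for the geometric factors of the modes. -/
theorem exists_norm_geometric_factor_le {d η : ℝ} (hd : 0 < d) (hη : 0 < η) (ξ : ℝ) :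
    ∃ D, 1 ≤ D ∧ ∀ m : ℤ, m ≠ 0 → Complex.exp (-Qexp d ξ η m) ≠ 1 ∧
      ‖(1 - Complex.exp (-Qexp d ξ η m))⁻¹‖ ≤ D ∧
      ‖Complex.exp (-Qexp d ξ η m) / (1 - Complex.exp (-Qexp d ξ η m)) * η‖ ≤
        D / |waveNumber d m| := by
  set q := Real.exp (-(2 * Real.pi / d * η)) with hq
  have hq1 : q < 1 := by rw [hq, Real.exp_lt_one_iff, neg_lt_zero]; positivity
  have hq0 : 0 < q := Real.exp_pos _
  have h1q : 0 < 1 - q := sub_pos.2 hq1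
  refine ⟨(1 - q)⁻¹, (one_le_inv₀ h1q).2 (by linarith), fun m hm => ?_⟩
  have hα := abs_waveNumber_ge hd hm
  have hα0 : 0 < |waveNumber d m| := lt_of_lt_of_le (by positivity) hα
  have hn : ‖Complex.exp (-Qexp d ξ η m)‖ ≤ q := by
    rw [norm_exp_neg_Qexp, hq, Real.exp_le_exp]; nlinarith
  have h1 : 1 - q ≤ ‖1 - Complex.exp (-Qexp d ξ η m)‖ := by
    have := norm_sub_norm_le (1 : ℂ) (Complex.exp (-Qexp d ξ η m))
    rw [norm_one] at this
    linarith
  have h2 : ‖(1 - Complex.exp (-Qexp d ξ η m))⁻¹‖ ≤ (1 - q)⁻¹ := by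
    rw [norm_inv]; exact inv_anti₀ h1q h1
  refine ⟨fun h => ?_, h2, ?_⟩
  · rw [h, sub_self, norm_zero] at h1; linarith
  · rw [div_eq_mul_inv, norm_mul, norm_mul, norm_exp_neg_Qexp, Complex.norm_real,
      Real.norm_of_nonneg hη.le, le_div_iff₀ hα0]
    -- `t exp (-t) ≤ 1` trades the exponential for the factor `1 / |α_m|` required of the
    -- coefficient without `w`.
    have h3 : Real.exp (-(|waveNumber d m| * η)) * (|waveNumber d m| * η) ≤ 1 := by
      rw [Real.exp_neg, inv_mul_le_one₀ (Real.exp_pos _)]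
      linarith [Real.add_one_le_exp (|waveNumber d m| * η)]
    calc _ = (Real.exp (-(|waveNumber d m| * η)) * (|waveNumber d m| * η)) *
          ‖(1 - Complex.exp (-Qexp d ξ η m))⁻¹‖ := by ring
      _ ≤ 1 * (1 - q)⁻¹ := by gcongr
      _ = _ := one_mul _

/-- The factor of a mode of the south kernels that does not depend on `y` and `y'`. -/
noncomputable def southPhase (d ξ η : ℝ) (m : ℤ) (X : ℝ) : ℂ :=
  Complex.exp (Complex.I * ((waveNumber d m * (2 * ξ + X) : ℝ) : ℂ)) *
    (1 - Complex.exp (-Qexp d ξ η m))⁻¹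

theorem norm_southPhase (d ξ η : ℝ) (m : ℤ) (X : ℝ) :
    ‖southPhase d ξ η m X‖ = ‖(1 - Complex.exp (-Qexp d ξ η m))⁻¹‖ := by
  rw [southPhase, norm_mul, mul_comm Complex.I, Complex.norm_exp_ofReal_mul_I, one_mul]

/-- The modulus of `exp (-2 Q_m)` shifts `y - y'` by `2 η`, and its phase shifts `x - x'` by `2 ξ`.
-/
theorem south_factor_eq (d ξ η : ℝ) (m : ℤ) (x y x' y' : ℝ) :
    Complex.exp (-2 * Qexp d ξ η m) / (1 - Complex.exp (-Qexp d ξ η m)) *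
      planeWave d (-|waveNumber d m|) m (x, y) (x', y') =
    southPhase d ξ η m (x - x') *
      (Real.exp (-((y - y' + 2 * η) * |waveNumber d m|)) : ℝ) := by
  rw [southPhase, planeWave, div_eq_mul_inv, mul_right_comm, mul_right_comm _ _ (Complex.ofReal _),
    Complex.ofReal_exp, ← Complex.exp_add, ← Complex.exp_add]
  congr 2
  simp only [Qexp]
  push_cast
  ring

/-! ### Reflection of the Poisson and Stokes kernels -/

theorem planeWave_swap (d c : ℝ) (m : ℤ) (t s : ℝ × ℝ) :
    planeWave d (-c) (-m) s t = planeWave d c m t s := by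
  simp only [planeWave, waveNumber]
  congr 1
  push_cast
  ring

theorem waveNumber_neg (d : ℝ) (m : ℤ) : waveNumber d (-m) = -waveNumber d m := by
  simp only [waveNumber]; push_cast; ring

theorem Qexp_neg (d ξ η : ℝ) (m : ℤ) : Qexp d ξ η (-m) = star (Qexp d ξ η m) := by
  simp [Qexp, waveNumber_neg]

theorem poissonNorth_eq (d ξ η : ℝ) (t s : ℝ × ℝ) :
    poissonNorth d ξ η t s = poissonSouth d ξ η s t := by
  rw [poissonNorth, poissonSouth]
  congr 1
  · ring
  · congr 1
    rw [← (Equiv.neg ℤ).tsum_eq]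
    refine tsum_congr fun m => ?_
    simp only [Equiv.neg_apply, neg_eq_zero, Qexp_neg, waveNumber_neg, abs_neg, star_star]
    simp only [← planeWave_swap d |waveNumber d m| _ t s, neg_neg]

/-- Under `m ↦ -m` the exponent `Q_m` is conjugated and `σ` changes sign. The north matrix becomes
minus the south matrix, and the sign is absorbed by the bracket when `y` and `y'` are exchanged. -/
theorem stokesNorth_eq (d ξ η : ℝ) (i j : Fin 2) (t s : ℝ × ℝ) :
    stokesNorth d ξ η i j t s = stokesSouth d ξ η i j s t := by
  rw [stokesNorth, stokesSouth]
  congr 1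
  · simp only [stokesZerothMode, mul_right_comm _ (t.2 : ℂ)]
  · congr 1
    rw [← (Equiv.neg ℤ).tsum_eq]
    refine tsum_congr fun m => ?_
    simp only [Equiv.neg_apply, neg_eq_zero, Qexp_neg, waveNumber_neg, abs_neg, star_star]
    simp only [← planeWave_swap d |waveNumber d m| _ t s, neg_neg]
    split_ifs with hm
    · rfl
    · congr 2
      fin_cases i <;> fin_cases j <;> simp [Int.sign_neg] <;> ring

theorem interpolationEstimates_poissonSouth {d η : ℝ} (hd : 0 < d) (hη : 0 < η) (ξ : ℝ) :
    InterpolationEstimates η (poissonSouth d ξ η) := by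
  obtain ⟨D, hD1, hD⟩ := exists_norm_geometric_factor_le hd hη ξ
  have hD0 : 0 ≤ D := zero_le_one.trans hD1
  obtain ⟨A, hA⟩ := exists_hasLogDecay_tsum_modes hd hη D hD0
  refine interpolationEstimates_of_hasLogDecay hη (e := -(1 / (2 * d * η) : ℂ))
    (F := fun X w => 1 / (2 * d : ℂ) * ∑' m : ℤ, if m = 0 then 0 else
      (1 / ((|waveNumber d m| : ℝ) : ℂ) * southPhase d ξ η m X + 0 * (w : ℝ)) *
        (Real.exp (-(w * |waveNumber d m|)) : ℝ)) (fun x x' y _ y' _ => ?_)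
    (fun X w₀ hw₀ => (hA _ _ (fun m hm => ⟨?_, ?_⟩) w₀ hw₀).const_mul (1 / (2 * d : ℂ)))
  · rw [poissonSouth]
    congr 2
    refine tsum_congr fun m => ?_
    split_ifs
    · rfl
    · rw [mul_assoc, south_factor_eq]; ring
  · rw [norm_mul, norm_southPhase, norm_div, norm_one, Complex.norm_real, Real.norm_eq_abs, abs_abs,
      one_div, div_eq_inv_mul]
    exact mul_le_mul_of_nonneg_left (hD m hm).2.1 (by positivity)
  · simpa using hD0

theorem interpolationEstimates_stokesSouth {d η : ℝ} (hd : 0 < d) (hη : 0 < η) (ξ : ℝ)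
    (i j : Fin 2) : InterpolationEstimates η (stokesSouth d ξ η i j) := by
  obtain ⟨D, hD1, hD⟩ := exists_norm_geometric_factor_le hd hη ξ
  have hD0 : 0 ≤ D := zero_le_one.trans hD1
  obtain ⟨A, hA⟩ := exists_hasLogDecay_tsum_modes hd hη ((1 + D) * D) (by positivity)
  set B : ℤ → ℂ := fun m => (!![1, Complex.I * (m.sign : ℂ); Complex.I * (m.sign : ℂ), -1] :
    Matrix (Fin 2) (Fin 2) ℂ) i j with hB
  have hB1 : ∀ m, ‖B m‖ ≤ 1 := fun m => by
    have h : |(m.sign : ℝ)| ≤ 1 := by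
      rcases Int.sign_trichotomy m with h | h | h <;> simp [h]
    fin_cases i <;> fin_cases j <;> simp [hB, h]
  set δ : ℂ := (1 : Matrix (Fin 2) (Fin 2) ℂ) i j with hδ
  have hδ1 : ‖δ‖ ≤ 1 := by rw [hδ, Matrix.one_apply]; split_ifs <;> simp
  refine interpolationEstimates_of_hasLogDecay hη
    (e := -(1 / (2 * d * η) : ℂ) * (!![1, 0; 0, 0] : Matrix (Fin 2) (Fin 2) ℂ) i j)
    (F := fun X w => 1 / (4 * d : ℂ) * ∑' m : ℤ, if m = 0 then 0 else
      ((1 / ((|waveNumber d m| : ℝ) : ℂ) * δ -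
        Complex.exp (-Qexp d ξ η m) / (1 - Complex.exp (-Qexp d ξ η m)) * η * B m) *
          southPhase d ξ η m X + (-B m * southPhase d ξ η m X) * (w : ℝ)) *
        (Real.exp (-(w * |waveNumber d m|)) : ℝ)) (fun x x' y _ y' _ => ?_)
    (fun X w₀ hw₀ => (hA _ _ (fun m hm => ⟨?_, ?_⟩) w₀ hw₀).const_mul (1 / (4 * d : ℂ)))
  · rw [stokesSouth, stokesZerothMode]
    congr 1
    · rw [Matrix.smul_apply, smul_eq_mul]; ring
    congr 1
    refine tsum_congr fun m => ?_
    split_ifs with hm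
    · rfl
    · rw [mul_assoc _ (_ / _), south_factor_eq, Matrix.sub_apply, Matrix.smul_apply,
        Matrix.smul_apply, smul_eq_mul, smul_eq_mul]
      have h1 : 1 - Complex.exp (-Qexp d ξ η m) ≠ 0 := sub_ne_zero.2 (hD m hm).1.symm
      -- The summand 2 completes `y - y'` to `w = y - y' + 2 η`; the remainder is of size `1 /
      -- |α_m|` after multiplication by `η`.
      have h2 : (2 - Complex.exp (-Qexp d ξ η m)) / (1 - Complex.exp (-Qexp d ξ η m)) =
          2 + Complex.exp (-Qexp d ξ η m) / (1 - Complex.exp (-Qexp d ξ η m)) := by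
        field_simp; ring
      simp only [h2, ← hδ]
      rw [show (!![1, Complex.I * (m.sign : ℂ); Complex.I * (m.sign : ℂ), -1] :
        Matrix (Fin 2) (Fin 2) ℂ) i j = B m from rfl]
      push_cast
      ring
  · have h3 : ‖1 / ((|waveNumber d m| : ℝ) : ℂ) * δ -
        Complex.exp (-Qexp d ξ η m) / (1 - Complex.exp (-Qexp d ξ η m)) * η * B m‖ ≤
          1 / |waveNumber d m| * 1 + D / |waveNumber d m| * 1 := by
      refine (norm_sub_le _ _).trans ?_
      rw [norm_mul, norm_mul _ (B m), norm_div, norm_one, Complex.norm_real, Real.norm_eq_abs,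
        abs_abs]
      exact add_le_add (mul_le_mul_of_nonneg_left hδ1 (by positivity))
        (mul_le_mul (hD m hm).2.2 (hB1 m) (norm_nonneg _) (by positivity))
    rw [norm_mul, norm_southPhase]
    calc _ ≤ (1 / |waveNumber d m| * 1 + D / |waveNumber d m| * 1) * D :=
          mul_le_mul h3 (hD m hm).2.1 (norm_nonneg _) (by positivity)
      _ = _ := by ring
  · rw [norm_mul, norm_neg, norm_southPhase]
    calc _ ≤ 1 * D := mul_le_mul (hB1 m) (hD m hm).2.1 (norm_nonneg _) zero_le_one
      _ ≤ _ := by nlinarith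

end PeriodicImages

namespace PeriodicImages

open MeasureTheory Set

/-! ### Plane wave representation of the modified Bessel functions -/

theorem one_add_sq_le_cosh_sq (τ : ℝ) : 1 + τ ^ 2 ≤ Real.cosh τ ^ 2 := by
  have h : τ ^ 2 ≤ Real.sinh τ ^ 2 := by
    rw [sq_le_sq, Real.abs_sinh]
    exact Real.self_le_sinh_iff.2 (abs_nonneg τ)
  rw [Real.cosh_sq]; linarith

/-- Polynomial decay in `c` is enough: the exponential is traded for `N + 2` powers, two of which
supply the integrable majorant `1 / (1 + τ²)`. -/
theorem cosh_pow_mul_exp_le (N : ℕ) {c : ℝ} (hc : 0 < c) (τ : ℝ) :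
    Real.cosh τ ^ N * Real.exp (-(c * Real.cosh τ)) ≤
      (N + 2).factorial / c ^ (N + 2) * (1 + τ ^ 2)⁻¹ := by
  have h0 := Real.cosh_pos τ
  have h1 := Real.pow_div_factorial_le_exp (x := c * Real.cosh τ) (by positivity) (N + 2)
  have h2 : Real.exp (-(c * Real.cosh τ)) ≤
      (N + 2).factorial / c ^ (N + 2) * (Real.cosh τ ^ (N + 2))⁻¹ := by
    rw [Real.exp_neg]
    refine (inv_anti₀ (by positivity) h1).trans_eq ?_
    rw [mul_pow]
    field_simp
  have h3 : (Real.cosh τ ^ 2)⁻¹ ≤ (1 + τ ^ 2)⁻¹ :=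
    inv_anti₀ (by positivity) (one_add_sq_le_cosh_sq τ)
  calc _ ≤ Real.cosh τ ^ N * ((N + 2).factorial / c ^ (N + 2) * (Real.cosh τ ^ (N + 2))⁻¹) := by
        gcongr
    _ = (N + 2).factorial / c ^ (N + 2) * (Real.cosh τ ^ 2)⁻¹ := by
        field_simp; ring
    _ ≤ _ := by gcongr

theorem integrable_cosh_pow_mul_exp (N : ℕ) {c : ℝ} (hc : 0 < c) :
    Integrable fun τ : ℝ => Real.cosh τ ^ N * Real.exp (-(c * Real.cosh τ)) := by
  refine Integrable.mono' (integrable_inv_one_add_sq.const_mul ((N + 2).factorial / c ^ (N + 2)))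
    (by fun_prop) (Filter.Eventually.of_forall fun τ => ?_)
  have h0 := Real.cosh_pos τ
  rw [Real.norm_of_nonneg (by positivity)]
  exact cosh_pow_mul_exp_le N hc τ

theorem integral_cosh_pow_mul_exp_le (N : ℕ) {c : ℝ} (hc : 0 < c) :
    ∫ τ : ℝ, Real.cosh τ ^ N * Real.exp (-(c * Real.cosh τ)) ≤
      (N + 2).factorial / c ^ (N + 2) * Real.pi := by
  refine (integral_mono (integrable_cosh_pow_mul_exp N hc)
    (integrable_inv_one_add_sq.const_mul _) (cosh_pow_mul_exp_le N hc)).trans_eq ?_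
  rw [integral_const_mul, integral_univ_inv_one_add_sq]

theorem integrable_of_cosh_bound {F : ℝ → ℂ} (hF : Continuous F) {C c : ℝ} (hc : 0 < c) (N : ℕ)
    (h : ∀ τ, ‖F τ‖ ≤ C * (Real.cosh τ ^ N * Real.exp (-(c * Real.cosh τ)))) : Integrable F :=
  Integrable.mono' ((integrable_cosh_pow_mul_exp N hc).const_mul C) hF.aestronglyMeasurable
    (Filter.Eventually.of_forall h)

/-- The integrand of the modified Bessel function of order `j` on a horizontal line. -/
noncomputable def besselIntegrand (j z φ τ : ℝ) : ℂ :=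
  Complex.exp (j * (τ + φ * Complex.I) - z * Complex.cosh (τ + φ * Complex.I))

theorem cosh_add_mul_I (τ φ : ℝ) : Complex.cosh (τ + φ * Complex.I) =
    Real.cosh τ * Real.cos φ + Real.sinh τ * Real.sin φ * Complex.I := by
  rw [Complex.cosh_add, Complex.cosh_mul_I, Complex.sinh_mul_I]
  push_cast
  ring

theorem exp_mul_le_cosh_sq {j : ℝ} (hj : |j| ≤ 2) (τ : ℝ) :
    Real.exp (j * τ) ≤ 4 * Real.cosh τ ^ 2 := by
  have h1 : Real.exp |τ| ≤ 2 * Real.cosh τ := by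
    rw [← Real.cosh_abs τ, Real.cosh_eq]
    have := Real.exp_pos (-|τ|)
    linarith
  calc Real.exp (j * τ) ≤ Real.exp (2 * |τ|) := by
        rw [Real.exp_le_exp]
        refine (le_abs_self _).trans ?_
        rw [abs_mul]
        gcongr
    _ = Real.exp |τ| ^ 2 := by rw [← Real.exp_nat_mul]; norm_num
    _ ≤ (2 * Real.cosh τ) ^ 2 := by gcongr
    _ = _ := by ring

theorem norm_besselIntegrand (j z φ τ : ℝ) :
    ‖besselIntegrand j z φ τ‖ = Real.exp (j * τ) * Real.exp (-(z * Real.cos φ * Real.cosh τ)) := by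
  rw [besselIntegrand, Complex.norm_exp, cosh_add_mul_I, ← Real.exp_add]
  congr 1
  simp [Complex.cosh_ofReal_re, Complex.sinh_ofReal_re, Complex.cos_ofReal_re]
  ring

theorem continuous_besselIntegrand (j z φ : ℝ) : Continuous (besselIntegrand j z φ) := by
  unfold besselIntegrand
  have : Continuous fun τ : ℝ => Complex.cosh (τ + φ * Complex.I) :=
    Complex.continuous_cosh.comp (by fun_prop)
  fun_prop

theorem norm_besselIntegrand_le {j z φ : ℝ} (hj : |j| ≤ 2) (τ : ℝ) :
    ‖besselIntegrand j z φ τ‖ ≤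
      4 * (Real.cosh τ ^ 2 * Real.exp (-(z * Real.cos φ * Real.cosh τ))) := by
  rw [norm_besselIntegrand, ← mul_assoc]
  exact mul_le_mul_of_nonneg_right (exp_mul_le_cosh_sq hj τ) (Real.exp_pos _).le

/-- The factor arising from differentiating `besselIntegrand` along the line. -/
noncomputable def besselFactor (j z φ τ : ℝ) : ℂ :=
  j - z * Complex.sinh (τ + φ * Complex.I)

theorem continuous_besselFactor (j z φ : ℝ) : Continuous (besselFactor j z φ) := by
  unfold besselFactor
  have : Continuous fun τ : ℝ => Complex.sinh (τ + φ * Complex.I) :=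
    Complex.continuous_sinh.comp (by fun_prop)
  fun_prop

theorem norm_besselFactor_le {j z : ℝ} (hj : |j| ≤ 2) (hz : 0 < z) (φ τ : ℝ) :
    ‖besselFactor j z φ τ‖ ≤ (2 + z) * Real.cosh τ := by
  have h1 := Real.one_le_cosh τ
  have h2 : ‖Complex.sinh (τ + φ * Complex.I)‖ ≤ Real.cosh τ := by
    rw [Complex.sinh, norm_div, Complex.norm_ofNat, Real.cosh_eq]
    refine div_le_div_of_nonneg_right ((norm_sub_le _ _).trans_eq ?_) (by norm_num)
    rw [Complex.norm_exp, Complex.norm_exp]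
    simp
  rw [besselFactor]
  refine (norm_sub_le _ _).trans ?_
  rw [norm_mul, Complex.norm_real, Complex.norm_real, Real.norm_eq_abs, Real.norm_of_nonneg hz.le]
  nlinarith

theorem hasDerivAt_besselIntegrand (j z φ τ : ℝ) :
    HasDerivAt (fun τ => besselIntegrand j z φ τ)
      (besselFactor j z φ τ * besselIntegrand j z φ τ) τ ∧
    HasDerivAt (fun φ => besselIntegrand j z φ τ)
      (Complex.I * (besselFactor j z φ τ * besselIntegrand j z φ τ)) φ := by
  have h : ∀ u : ℂ, HasDerivAt (fun u : ℂ => Complex.exp (j * u - z * Complex.cosh u))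
      (Complex.exp (j * u - z * Complex.cosh u) * (j * 1 - z * Complex.sinh u)) u := fun u =>
    (((hasDerivAt_id u).const_mul (j : ℂ)).sub ((Complex.hasDerivAt_cosh u).const_mul (z : ℂ))).cexp
  have h1 : HasDerivAt (fun τ : ℝ => (τ : ℂ) + φ * Complex.I) 1 τ :=
    (Complex.ofRealCLM.hasDerivAt (x := τ)).add_const _
  have h2 : HasDerivAt (fun φ : ℝ => (τ : ℂ) + φ * Complex.I) (1 * Complex.I) φ :=
    ((Complex.ofRealCLM.hasDerivAt (x := φ)).mul_const Complex.I).const_add _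
  constructor
  · refine ((h _).comp τ h1).congr_deriv ?_
    simp only [besselFactor, besselIntegrand]; ring
  · refine ((h _).comp φ h2).congr_deriv ?_
    simp only [besselFactor, besselIntegrand]; ring

/-- The integral of the Bessel integrand does not depend on the line of integration. -/
theorem integral_besselIntegrand {j z : ℝ} (hj : |j| ≤ 2) (hz : 0 < z) {φ : ℝ}
    (hφ : φ ∈ Ioo (-(Real.pi / 2)) (Real.pi / 2)) :
    ∫ τ, besselIntegrand j z φ τ = ∫ τ, besselIntegrand j z 0 τ := by
  have hcos : ∀ φ ∈ Ioo (-(Real.pi / 2)) (Real.pi / 2), 0 < Real.cos φ := fun φ hφ =>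
    Real.cos_pos_of_mem_Ioo hφ
  have hint : ∀ φ ∈ Ioo (-(Real.pi / 2)) (Real.pi / 2), Integrable (besselIntegrand j z φ) :=
    fun φ hφ => integrable_of_cosh_bound (continuous_besselIntegrand j z φ)
      (mul_pos hz (hcos φ hφ)) 2 (norm_besselIntegrand_le hj)
  -- The integrand is holomorphic in `τ + i φ`, so its `φ`-derivative is `i` times its
  -- `τ`-derivative, whose integral over the line is zero.
  have hder : ∀ φ ∈ Ioo (-(Real.pi / 2)) (Real.pi / 2),
      HasDerivAt (fun φ => ∫ τ, besselIntegrand j z φ τ) 0 φ := fun φ₀ hφ₀ => by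
    obtain ⟨φ₁, h1, h2⟩ : ∃ φ₁, |φ₀| < φ₁ ∧ φ₁ < Real.pi / 2 := exists_between (abs_lt.2 hφ₀)
    have h0 : 0 < φ₁ := (abs_nonneg _).trans_lt h1
    have hc1 : 0 < Real.cos φ₁ := hcos φ₁ ⟨by linarith, h2⟩
    have hb : ∀ τ, ∀ φ ∈ Ioo (-φ₁) φ₁,
        ‖Complex.I * (besselFactor j z φ τ * besselIntegrand j z φ τ)‖ ≤
          (2 + z) * 4 * (Real.cosh τ ^ 3 * Real.exp (-(z * Real.cos φ₁ * Real.cosh τ))) := by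
      intro τ φ hφ
      have hcos1 : Real.cos φ₁ ≤ Real.cos φ := by
        rw [← Real.cos_abs φ]
        exact Real.cos_le_cos_of_nonneg_of_le_pi (abs_nonneg _) (by linarith) (abs_lt.2 hφ).le
      have hch := Real.cosh_pos τ
      rw [norm_mul, Complex.norm_I, one_mul, norm_mul]
      calc _ ≤ (2 + z) * Real.cosh τ *
            (4 * (Real.cosh τ ^ 2 * Real.exp (-(z * Real.cos φ * Real.cosh τ)))) :=
            mul_le_mul (norm_besselFactor_le hj hz φ τ) (norm_besselIntegrand_le hj τ)
              (norm_nonneg _) (by positivity)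
        _ ≤ (2 + z) * Real.cosh τ *
            (4 * (Real.cosh τ ^ 2 * Real.exp (-(z * Real.cos φ₁ * Real.cosh τ)))) := by gcongr
        _ = _ := by ring
    have hmem : φ₀ ∈ Ioo (-φ₁) φ₁ := abs_lt.1 h1
    have h := hasDerivAt_integral_of_dominated_loc_of_deriv_le (μ := volume)
      (F := fun φ τ => besselIntegrand j z φ τ)
      (F' := fun φ τ => Complex.I * (besselFactor j z φ τ * besselIntegrand j z φ τ))
      (isOpen_Ioo.mem_nhds hmem)
      (Filter.Eventually.of_forall fun φ => (continuous_besselIntegrand j z φ).aestronglyMeasurable)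
      (hint φ₀ hφ₀)
      (continuous_const.mul ((continuous_besselFactor j z φ₀).mul
        (continuous_besselIntegrand j z φ₀))).aestronglyMeasurable
      (Filter.Eventually.of_forall hb)
      ((integrable_cosh_pow_mul_exp 3 (mul_pos hz hc1)).const_mul _)
      (Filter.Eventually.of_forall fun τ φ _ => (hasDerivAt_besselIntegrand j z φ τ).2)
    have hi : Integrable fun τ => besselFactor j z φ₀ τ * besselIntegrand j z φ₀ τ := by
      have := h.1.const_mul (-Complex.I)
      refine this.congr (Filter.Eventually.of_forall fun τ => ?_)
      simp [← mul_assoc]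
    have h3 : ∫ τ, besselFactor j z φ₀ τ * besselIntegrand j z φ₀ τ = 0 :=
      integral_eq_zero_of_hasDerivAt_of_integrable
        (fun τ => (hasDerivAt_besselIntegrand j z φ₀ τ).1) hi (hint φ₀ hφ₀)
    have h4 := h.2
    rwa [integral_const_mul, h3, mul_zero] at h4
  exact IsOpen.is_const_of_deriv_eq_zero isOpen_Ioo isPreconnected_Ioo
    (fun φ hφ => (hder φ hφ).differentiableAt.differentiableWithinAt)
    (fun φ hφ => (hder φ hφ).deriv) hφ ⟨by linarith [Real.pi_pos], by linarith [Real.pi_pos]⟩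

/-- The exponent of a superposition of plane waves decaying in the half plane `0 < w`. -/
noncomputable def waveExponent (β x w τ : ℝ) : ℂ :=
  ((-(β * w * Real.cosh τ) : ℝ) : ℂ) + ((β * x * Real.sinh τ : ℝ) : ℂ) * Complex.I

theorem norm_exp_waveExponent (β x w τ : ℝ) :
    ‖Complex.exp (waveExponent β x w τ)‖ = Real.exp (-(β * w * Real.cosh τ)) := by
  rw [waveExponent, Complex.norm_exp]; congr 1; simp

/-- Plane wave representation of the modified Bessel functions. -/
theorem integral_exp_mul_waveExponent {β : ℝ} (hβ : 0 < β) {j : ℝ} (hj : |j| ≤ 2) (x : ℝ) {w : ℝ}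
    (hw : 0 < w) : ∃ φ : ℝ, ∫ τ : ℝ, (Real.exp (j * τ) : ℂ) * Complex.exp (waveExponent β x w τ) =
      Complex.exp (j * φ * Complex.I) * ∫ τ : ℝ, ((Real.exp (j * τ) *
        Real.exp (-(β * Real.sqrt (x ^ 2 + w ^ 2) * Real.cosh τ)) : ℝ) : ℂ) := by
  set r := Real.sqrt (x ^ 2 + w ^ 2) with hr
  have hr0 : 0 < r := Real.sqrt_pos.2 (by positivity)
  -- Polar coordinates: `w > 0` puts `φ` in the range in which the line may be shifted, and on the
  -- shifted line the oscillation in `x` has become decay in `r`.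
  obtain ⟨φ, hφ, hwr, hxr⟩ : ∃ φ ∈ Ioo (-(Real.pi / 2)) (Real.pi / 2),
      w = r * Real.cos φ ∧ x = r * Real.sin φ := by
    have hn : ‖(⟨w, x⟩ : ℂ)‖ = r := by rw [Complex.norm_def, Complex.normSq_mk, hr]; congr 1; ring
    refine ⟨Complex.arg ⟨w, x⟩, abs_lt.1 (Complex.abs_arg_lt_pi_div_two_iff.2 (Or.inl hw)), ?_, ?_⟩
    · rw [← hn, Complex.norm_mul_cos_arg]
    · rw [← hn, Complex.norm_mul_sin_arg]
  refine ⟨φ, ?_⟩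
  have h := integral_besselIntegrand hj (mul_pos hβ hr0) (φ := -φ)
    ⟨by linarith [hφ.2], by linarith [hφ.1]⟩
  have h1 : ∀ τ : ℝ, (Real.exp (j * τ) : ℂ) * Complex.exp (waveExponent β x w τ) =
      Complex.exp (j * φ * Complex.I) * besselIntegrand j (β * r) (-φ) τ := fun τ => by
    rw [besselIntegrand, cosh_add_mul_I, waveExponent, hwr, hxr, Complex.ofReal_exp,
      ← Complex.exp_add, ← Complex.exp_add, Real.cos_neg, Real.sin_neg]
    congr 1
    push_cast
    ring
  simp_rw [h1]
  rw [integral_const_mul, h]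
  congr 2
  ext τ
  rw [besselIntegrand, ← Real.exp_add, Complex.ofReal_exp]
  congr 1
  push_cast
  simp
  ring

/-- After the shift only `β r cosh τ` is left in the exponent. The bound `exp (j τ) ≤ 4 cosh² τ` and
`integral_cosh_pow_mul_exp_le` with `N = 2` give `96 = 4 * 4!`. -/
theorem norm_integral_exp_mul_waveExponent_le {β : ℝ} (hβ : 0 < β) {j : ℝ} (hj : |j| ≤ 2) (x : ℝ)
    {w : ℝ} (hw : 0 < w) :
    ‖∫ τ : ℝ, (Real.exp (j * τ) : ℂ) * Complex.exp (waveExponent β x w τ)‖ ≤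
      96 * Real.pi / β ^ 4 / (x ^ 2 + w ^ 2) ^ 2 := by
  obtain ⟨φ, h⟩ := integral_exp_mul_waveExponent hβ hj x hw
  have hr0 : 0 < x ^ 2 + w ^ 2 := by positivity
  have hr : 0 < β * Real.sqrt (x ^ 2 + w ^ 2) := mul_pos hβ (Real.sqrt_pos.2 hr0)
  rw [h, norm_mul, ← Complex.ofReal_mul, Complex.norm_exp_ofReal_mul_I, one_mul]
  refine (norm_integral_le_of_norm_le
    ((integrable_cosh_pow_mul_exp 2 hr).const_mul 4) (Filter.Eventually.of_forall fun τ => ?_)).trans ?_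
  · rw [Complex.norm_real, Real.norm_of_nonneg (by positivity), ← mul_assoc]
    exact mul_le_mul_of_nonneg_right (exp_mul_le_cosh_sq hj τ) (Real.exp_pos _).le
  · rw [integral_const_mul]
    refine (mul_le_mul_of_nonneg_left (integral_cosh_pow_mul_exp_le 2 hr) (by norm_num)).trans_eq ?_
    have : Real.sqrt (x ^ 2 + w ^ 2) ^ 4 = (x ^ 2 + w ^ 2) ^ 2 := by
      rw [show 4 = 2 * 2 from rfl, pow_mul, Real.sq_sqrt hr0.le]
    rw [mul_pow, this]
    norm_num [Nat.factorial]
    field_simp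
    norm_num

end PeriodicImages

namespace PeriodicImages

open MeasureTheory Set

/-! ### Derivatives of the modified biharmonic Green's function -/

/-- Superposition of decaying plane waves with amplitude `sinh τ ^ n * cosh τ ^ p`. -/
noncomputable def waveIntegral (β : ℝ) (n p : ℕ) (x w : ℝ) : ℂ :=
  ∫ τ : ℝ, ((Real.sinh τ ^ n * Real.cosh τ ^ p : ℝ) : ℂ) * Complex.exp (waveExponent β x w τ)

theorem continuous_wave (β : ℝ) (n p : ℕ) (x w : ℝ) : Continuous fun τ : ℝ =>
    ((Real.sinh τ ^ n * Real.cosh τ ^ p : ℝ) : ℂ) * Complex.exp (waveExponent β x w τ) := by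
  unfold waveExponent; fun_prop

theorem norm_wave_le (β : ℝ) (n p : ℕ) (x w τ : ℝ) :
    ‖((Real.sinh τ ^ n * Real.cosh τ ^ p : ℝ) : ℂ) * Complex.exp (waveExponent β x w τ)‖ ≤
      1 * (Real.cosh τ ^ (n + p) * Real.exp (-(β * w * Real.cosh τ))) := by
  have h0 := Real.cosh_pos τ
  have h1 : |Real.sinh τ| ≤ Real.cosh τ :=
    abs_le.2 ⟨by linarith [Real.cosh_add_sinh τ, Real.exp_pos τ], (Real.sinh_lt_cosh τ).le⟩
  rw [norm_mul, norm_exp_waveExponent, Complex.norm_real, Real.norm_eq_abs, abs_mul, abs_pow,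
    abs_of_pos (pow_pos h0 p), one_mul, pow_add]
  gcongr

theorem integrable_wave {β : ℝ} (hβ : 0 < β) (n p : ℕ) (x : ℝ) {w : ℝ} (hw : 0 < w) :
    Integrable fun τ : ℝ =>
      ((Real.sinh τ ^ n * Real.cosh τ ^ p : ℝ) : ℂ) * Complex.exp (waveExponent β x w τ) :=
  integrable_of_cosh_bound (continuous_wave β n p x w) (mul_pos hβ hw) (n + p)
    (norm_wave_le β n p x w)

theorem hasDerivAt_waveIntegral_left {β : ℝ} (hβ : 0 < β) (n p : ℕ) (x : ℝ) {w : ℝ} (hw : 0 < w) :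
    HasDerivAt (fun x => waveIntegral β n p x w)
      (Complex.I * β * waveIntegral β (n + 1) p x w) x := by
  have h := hasDerivAt_integral_of_dominated_loc_of_deriv_le (μ := volume)
    (F := fun x τ => ((Real.sinh τ ^ n * Real.cosh τ ^ p : ℝ) : ℂ) *
      Complex.exp (waveExponent β x w τ))
    (F' := fun x τ => Complex.I * β * (((Real.sinh τ ^ (n + 1) * Real.cosh τ ^ p : ℝ) : ℂ) *
      Complex.exp (waveExponent β x w τ)))
    (x₀ := x) (s := univ) Filter.univ_mem
    (Filter.Eventually.of_forall fun x => (continuous_wave β n p x w).aestronglyMeasurable)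
    (integrable_wave hβ n p x hw)
    (continuous_const.mul (continuous_wave β (n + 1) p x w)).aestronglyMeasurable
    (bound := fun τ => β * (1 * (Real.cosh τ ^ (n + 1 + p) * Real.exp (-(β * w * Real.cosh τ)))))
    (Filter.Eventually.of_forall fun τ x _ => by
      rw [norm_mul, norm_mul, Complex.norm_I, one_mul, Complex.norm_real,
        Real.norm_of_nonneg hβ.le]
      exact mul_le_mul_of_nonneg_left (norm_wave_le β (n + 1) p x w τ) hβ.le)
    (((integrable_cosh_pow_mul_exp _ (mul_pos hβ hw)).const_mul _).const_mul _)
    (Filter.Eventually.of_forall fun τ x _ => by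
      have h1 : HasDerivAt (fun x : ℝ => waveExponent β x w τ)
          (((β * 1 * Real.sinh τ : ℝ) : ℂ) * Complex.I) x :=
        ((((hasDerivAt_id x).const_mul β).mul_const (Real.sinh τ)).ofReal_comp.mul_const
          Complex.I).const_add _
      refine (h1.cexp.const_mul _).congr_deriv ?_
      push_cast
      ring)
  rw [integral_const_mul] at h
  exact h.2

theorem hasDerivAt_waveIntegral_right {β : ℝ} (hβ : 0 < β) (n p : ℕ) (x : ℝ) {w : ℝ}
    (hw : 0 < w) :
    HasDerivAt (fun w => waveIntegral β n p x w) (-(β * waveIntegral β n (p + 1) x w)) w := by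
  have h := hasDerivAt_integral_of_dominated_loc_of_deriv_le (μ := volume)
    (F := fun w τ => ((Real.sinh τ ^ n * Real.cosh τ ^ p : ℝ) : ℂ) *
      Complex.exp (waveExponent β x w τ))
    (F' := fun w τ => -β * (((Real.sinh τ ^ n * Real.cosh τ ^ (p + 1) : ℝ) : ℂ) *
      Complex.exp (waveExponent β x w τ)))
    (x₀ := w) (s := Ioi (w / 2)) (Ioi_mem_nhds (half_lt_self hw))
    (Filter.Eventually.of_forall fun w => (continuous_wave β n p x w).aestronglyMeasurable)
    (integrable_wave hβ n p x hw)
    (continuous_const.mul (continuous_wave β n (p + 1) x w)).aestronglyMeasurable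
    (bound := fun τ => β * (1 * (Real.cosh τ ^ (n + (p + 1)) *
      Real.exp (-(β * (w / 2) * Real.cosh τ)))))
    (Filter.Eventually.of_forall fun τ v hv => by
      have h0 := Real.cosh_pos τ
      rw [norm_mul, norm_neg, Complex.norm_real, Real.norm_of_nonneg hβ.le]
      refine mul_le_mul_of_nonneg_left ((norm_wave_le β n (p + 1) x v τ).trans ?_) hβ.le
      have : w / 2 ≤ v := (mem_Ioi.1 hv).le
      gcongr)
    (((integrable_cosh_pow_mul_exp _ (mul_pos hβ (half_pos hw))).const_mul _).const_mul _)
    (Filter.Eventually.of_forall fun τ v _ => by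
      have h1 : HasDerivAt (fun v : ℝ => waveExponent β x v τ)
          ((-(β * 1 * Real.cosh τ) : ℝ) : ℂ) v :=
        ((((hasDerivAt_id v).const_mul β).mul_const (Real.cosh τ)).neg.ofReal_comp).add_const _
      refine (h1.cexp.const_mul _).congr_deriv ?_
      push_cast
      ring)
  rw [integral_const_mul] at h
  exact h.2.congr_deriv (neg_mul _ _)

/-- For order `j = 0` the rotation factor is 1; the factor `1 / 2` passes from the half line to the
whole line. -/
theorem besselK0_eq_waveIntegral {β : ℝ} (hβ : 0 < β) (x : ℝ) {w : ℝ} (hw : 0 < w) :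
    (besselK0 (β * radius (x, w)) : ℂ) = 1 / 2 * waveIntegral β 0 0 x w := by
  obtain ⟨φ, h⟩ := integral_exp_mul_waveExponent hβ (j := 0) (by norm_num) x hw
  simp only [zero_mul, Real.exp_zero, Complex.ofReal_one, one_mul, Complex.ofReal_zero,
    Complex.exp_zero] at h
  simp only [waveIntegral, pow_zero, mul_one, Complex.ofReal_one, one_mul]
  rw [h, integral_complex_ofReal]
  have h2 := integral_comp_abs (f := fun τ => Real.exp (-(β * Real.sqrt (x ^ 2 + w ^ 2) * Real.cosh τ)))
  simp only [Real.cosh_abs] at h2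
  rw [h2, besselK0, radius]
  push_cast
  simp only [neg_mul]
  ring

theorem deriv_eq_of_forall_pos {f g : ℝ → ℝ} {y g' : ℝ} (hy : 0 < y) (h : ∀ b, 0 < b → f b = g b)
    (hg : HasDerivAt g g' y) : deriv f y = g' :=
  (hg.congr_of_eventuallyEq (Filter.eventually_of_mem (Ioi_mem_nhds hy) h)).deriv

theorem hasDerivAt_re {f : ℝ → ℂ} {f' : ℂ} {x : ℝ} (h : HasDerivAt f f' x) :
    HasDerivAt (fun x => (f x).re) f'.re x :=
  Complex.reCLM.hasFDerivAt.comp_hasDerivAt x h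

theorem modifiedBiharmonicGreen_eq {β : ℝ} (hβ : 0 < β) (x : ℝ) {y : ℝ} (hy : 0 < y) :
    modifiedBiharmonicGreen β (x, y) = -(1 / (2 * Real.pi * β ^ 2)) *
      (1 / 2 * (waveIntegral β 0 0 x y).re + 1 / 2 * Real.log (x ^ 2 + y ^ 2)) := by
  have h := congrArg Complex.re (besselK0_eq_waveIntegral hβ x hy)
  rw [Complex.ofReal_re] at h
  have hl : Real.log (1 / radius (x, y)) = -(1 / 2 * Real.log (x ^ 2 + y ^ 2)) := by
    rw [one_div, Real.log_inv, radius, Real.log_sqrt (by positivity)]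
    ring
  have h2 : (1 / 2 * waveIntegral β 0 0 x y).re = 1 / 2 * (waveIntegral β 0 0 x y).re := by simp
  rw [modifiedBiharmonicGreen, h, hl, h2, sub_neg_eq_add]

theorem hasDerivAt_sq_add (x y : ℝ) : HasDerivAt (fun y : ℝ => x ^ 2 + y ^ 2) (2 * y) y := by
  simpa using ((hasDerivAt_id y).pow 2).const_add (x ^ 2)

theorem partialY_modifiedBiharmonicGreen {β : ℝ} (hβ : 0 < β) (x : ℝ) {y : ℝ} (hy : 0 < y) :
    partialY (modifiedBiharmonicGreen β) (x, y) = -(1 / (2 * Real.pi * β ^ 2)) *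
      (1 / 2 * (-(β * waveIntegral β 0 1 x y)).re + y / (x ^ 2 + y ^ 2)) := by
  have hr : x ^ 2 + y ^ 2 ≠ 0 := by positivity
  refine deriv_eq_of_forall_pos hy (fun b hb => modifiedBiharmonicGreen_eq hβ x hb) ?_
  refine ((((hasDerivAt_re (hasDerivAt_waveIntegral_right hβ 0 0 x hy)).const_mul (1 / 2)).add
    (((hasDerivAt_sq_add x y).log hr).const_mul (1 / 2))).const_mul _).congr_deriv ?_
  congr 2
  field_simp

theorem partialX_modifiedBiharmonicGreen {β : ℝ} (hβ : 0 < β) (x : ℝ) {y : ℝ} (hy : 0 < y) :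
    partialX (modifiedBiharmonicGreen β) (x, y) = -(1 / (2 * Real.pi * β ^ 2)) *
      (1 / 2 * (Complex.I * β * waveIntegral β 1 0 x y).re + x / (x ^ 2 + y ^ 2)) := by
  have hr : y ^ 2 + x ^ 2 ≠ 0 := by positivity
  have h := ((((hasDerivAt_re (hasDerivAt_waveIntegral_left hβ 0 0 x hy)).const_mul (1 / 2)).add
    (((hasDerivAt_sq_add y x).log hr).const_mul (1 / 2))).const_mul (-(1 / (2 * Real.pi * β ^ 2))))
  have e : (fun a => modifiedBiharmonicGreen β (a, y)) = fun a => -(1 / (2 * Real.pi * β ^ 2)) *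
      (1 / 2 * (waveIntegral β 0 0 a y).re + 1 / 2 * Real.log (y ^ 2 + a ^ 2)) :=
    funext fun a => by rw [modifiedBiharmonicGreen_eq hβ a hy, add_comm (y ^ 2)]
  rw [partialX]
  simp only [e]
  refine (h.congr_deriv ?_).deriv
  congr 2
  rw [add_comm (x ^ 2)]
  field_simp

theorem partialY_partialY_modifiedBiharmonicGreen {β : ℝ} (hβ : 0 < β) (x : ℝ) {y : ℝ}
    (hy : 0 < y) : partialY (partialY (modifiedBiharmonicGreen β)) (x, y) =
      -(1 / (2 * Real.pi * β ^ 2)) * (1 / 2 * (β ^ 2 * waveIntegral β 0 2 x y).re +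
        (x ^ 2 - y ^ 2) / (x ^ 2 + y ^ 2) ^ 2) := by
  have hr : x ^ 2 + y ^ 2 ≠ 0 := by positivity
  refine deriv_eq_of_forall_pos hy (fun b hb => partialY_modifiedBiharmonicGreen hβ x hb) ?_
  refine ((((hasDerivAt_re (((hasDerivAt_waveIntegral_right hβ 0 1 x hy).const_mul
    (β : ℂ)).neg)).const_mul (1 / 2)).add
    ((hasDerivAt_id y).div (hasDerivAt_sq_add x y) hr)).const_mul _).congr_deriv ?_
  congr 2
  · congr 2; ring
  · simp only [id]; field_simp; ring

theorem partialX_partialY_modifiedBiharmonicGreen {β : ℝ} (hβ : 0 < β) (x : ℝ) {y : ℝ}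
    (hy : 0 < y) : partialX (partialY (modifiedBiharmonicGreen β)) (x, y) =
      -(1 / (2 * Real.pi * β ^ 2)) * (1 / 2 * (-Complex.I * (β ^ 2 * waveIntegral β 1 1 x y)).re -
        2 * x * y / (x ^ 2 + y ^ 2) ^ 2) := by
  have hr : y ^ 2 + x ^ 2 ≠ 0 := by positivity
  have h := ((hasDerivAt_re (((hasDerivAt_waveIntegral_left hβ 0 1 x hy).const_mul
    (β : ℂ)).neg)).const_mul (1 / 2)).add
    ((hasDerivAt_const x y).div (hasDerivAt_sq_add y x) hr) |>.const_mul
      (-(1 / (2 * Real.pi * β ^ 2)))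
  have e : (fun a => partialY (modifiedBiharmonicGreen β) (a, y)) = fun a =>
      -(1 / (2 * Real.pi * β ^ 2)) *
      (1 / 2 * (-(β * waveIntegral β 0 1 a y)).re + y / (y ^ 2 + a ^ 2)) :=
    funext fun a => by rw [partialY_modifiedBiharmonicGreen hβ a hy, add_comm (y ^ 2)]
  rw [partialX]
  simp only [e]
  refine (h.congr_deriv ?_).deriv
  rw [sub_eq_add_neg]
  congr 2
  · congr 2; ring
  · rw [add_comm (x ^ 2)]; field_simp; ring

theorem partialX_partialX_modifiedBiharmonicGreen {β : ℝ} (hβ : 0 < β) (x : ℝ) {y : ℝ}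
    (hy : 0 < y) : partialX (partialX (modifiedBiharmonicGreen β)) (x, y) =
      -(1 / (2 * Real.pi * β ^ 2)) * (1 / 2 * (-(β ^ 2 * waveIntegral β 2 0 x y)).re +
        (y ^ 2 - x ^ 2) / (x ^ 2 + y ^ 2) ^ 2) := by
  have hr : y ^ 2 + x ^ 2 ≠ 0 := by positivity
  have h := ((hasDerivAt_re ((hasDerivAt_waveIntegral_left hβ 1 0 x hy).const_mul
    (Complex.I * β))).const_mul (1 / 2)).add
    ((hasDerivAt_id x).div (hasDerivAt_sq_add y x) hr) |>.const_mul (-(1 / (2 * Real.pi * β ^ 2)))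
  have e : (fun a => partialX (modifiedBiharmonicGreen β) (a, y)) = fun a =>
      -(1 / (2 * Real.pi * β ^ 2)) *
      (1 / 2 * (Complex.I * β * waveIntegral β 1 0 a y).re + a / (y ^ 2 + a ^ 2)) :=
    funext fun a => by rw [partialX_modifiedBiharmonicGreen hβ a hy, add_comm (y ^ 2)]
  rw [partialX]
  simp only [e]
  refine (h.congr_deriv ?_).deriv
  congr 2
  · congr 2; linear_combination (β ^ 2 * waveIntegral β 2 0 x y) * Complex.I_mul_I
  · rw [add_comm (x ^ 2)]; simp only [id]; field_simp; ring

end PeriodicImages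

namespace PeriodicImages

open MeasureTheory Set Filter Topology

/-! ### Poisson summation and symbols of kernels -/

theorem isBigO_of_quadratic_decay {f : ℝ → ℂ} {C : ℝ} (h : ∀ x, ‖f x‖ ≤ C / (1 + x ^ 2)) :
    f =O[cocompact ℝ] (|·| ^ (-2 : ℝ)) := by
  have hC : 0 ≤ C := by simpa using (norm_nonneg _).trans (h 0)
  refine Asymptotics.IsBigO.of_bound C (eventually_of_mem
    (isCompact_singleton (x := (0 : ℝ))).compl_mem_cocompact fun x hx => ?_)
  have hx0 : 0 < |x| := abs_pos.2 (by simpa using hx)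
  refine (h x).trans ?_
  rw [Real.norm_of_nonneg (by positivity), Real.rpow_neg hx0.le, Real.rpow_two, sq_abs,
    div_eq_mul_inv]
  have : 0 < x ^ 2 := by rw [← sq_abs]; positivity
  gcongr
  linarith

theorem summable_of_quadratic_decay {f : ℝ → ℂ} {C : ℝ} (h : ∀ x, ‖f x‖ ≤ C / (1 + x ^ 2)) :
    Summable fun m : ℤ => f m :=
  summable_of_isBigO (Real.summable_abs_int_rpow one_lt_two)
    ((isBigO_of_quadratic_decay h).comp_tendsto Int.tendsto_coe_cofinite)

theorem quadratic_decay_comp {f : ℝ → ℂ} {C a b : ℝ} (ha : a ≠ 0)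
    (h : ∀ x, ‖f x‖ ≤ C / (1 + x ^ 2)) :
    ∀ x, ‖f (a * x + b)‖ ≤ C * (1 + 2 / a ^ 2 + 2 * b ^ 2 / a ^ 2) / (1 + x ^ 2) := fun x => by
  have hC : 0 ≤ C := by simpa using (norm_nonneg _).trans (h 0)
  refine (h _).trans ?_
  rw [div_le_div_iff₀ (by positivity) (by positivity), mul_assoc]
  refine mul_le_mul_of_nonneg_left ?_ hC
  have ha2 : 0 < a ^ 2 := by positivity
  have h1 : x ^ 2 ≤ 2 / a ^ 2 * (a * x + b) ^ 2 + 2 * b ^ 2 / a ^ 2 := by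
    rw [div_mul_eq_mul_div, ← add_div, le_div_iff₀ ha2]
    nlinarith [sq_nonneg (a * x + 2 * b)]
  have h2 : 0 ≤ 2 * b ^ 2 / a ^ 2 := by positivity
  have h3 : 0 ≤ 2 / a ^ 2 := by positivity
  nlinarith [sq_nonneg (a * x + b), mul_nonneg h2 (sq_nonneg (a * x + b))]

/-- The inverse Fourier transform of a symbol. -/
noncomputable def symbolIntegral (g : ℝ → ℂ) (x : ℝ) : ℂ :=
  ∫ k : ℝ, g k * Complex.exp (Complex.I * ((k * x : ℝ) : ℂ))

/-- Poisson summation for a symbol and its inverse Fourier transform. -/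
theorem tsum_symbolIntegral {d : ℝ} (hd : 0 < d) {g : ℝ → ℂ} (hg : Continuous g) {C C' : ℝ}
    (hgC : ∀ k, ‖g k‖ ≤ C / (1 + k ^ 2)) (hTC : ∀ x, ‖symbolIntegral g x‖ ≤ C' / (1 + x ^ 2))
    (X : ℝ) :
    (Summable fun m : ℤ => symbolIntegral g (X - m * d)) ∧
    ∑' m : ℤ, symbolIntegral g (X - m * d) = 2 * Real.pi / d *
      ∑' m : ℤ, g (waveNumber d m) *
        Complex.exp (Complex.I * ((waveNumber d m * X : ℝ) : ℂ)) := by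
  set a : ℝ := 2 * Real.pi / d with ha
  have ha0 : 0 < a := by positivity
  -- Scaled so that the integers sample `g` at the wave numbers; the phase turns into the
  -- translation by `X` in the Fourier transform.
  set f : ℝ → ℂ := fun u => g (a * u) * Complex.exp (Complex.I * ((a * u * X : ℝ) : ℂ)) with hf
  have hfc : Continuous f := by fun_prop
  have hfb : ∀ u, ‖f u‖ ≤ C * (1 + 2 / a ^ 2 + 2 * 0 ^ 2 / a ^ 2) / (1 + u ^ 2) := fun u => by
    have := quadratic_decay_comp (b := 0) ha0.ne' hgC u
    rw [add_zero] at this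
    rwa [hf, norm_mul, mul_comm Complex.I, Complex.norm_exp_ofReal_mul_I, mul_one]
  have hF : FourierTransform.fourier f = fun v => ((a⁻¹ : ℝ) : ℂ) * symbolIntegral g (-d * v + X) := by
    ext v
    rw [Real.fourier_real_eq_integral_exp_smul, symbolIntegral]
    have h := Measure.integral_comp_mul_left
      (fun k => g k * Complex.exp (Complex.I * ((k * (-d * v + X) : ℝ) : ℂ))) a
    rw [abs_of_pos (inv_pos.2 ha0)] at h
    rw [← Complex.real_smul, ← h]
    refine integral_congr_ae (Eventually.of_forall fun u => ?_)
    simp only [hf, smul_eq_mul]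
    rw [mul_left_comm, ← Complex.exp_add]
    congr 2
    have hd' : (d : ℂ) ≠ 0 := by exact_mod_cast hd.ne'
    rw [ha]
    push_cast
    field_simp
  have hTb := quadratic_decay_comp (b := X) (neg_ne_zero.2 hd.ne') hTC
  have hFO : FourierTransform.fourier f =O[cocompact ℝ] (|·| ^ (-2 : ℝ)) := by
    rw [hF]
    exact (isBigO_of_quadratic_decay hTb).const_mul_left _
  have hP := Real.tsum_eq_tsum_fourier_of_rpow_decay hfc one_lt_two (isBigO_of_quadratic_decay hfb)
    hFO 0
  have e1 : ∀ m : ℤ, symbolIntegral g (X - m * d) = symbolIntegral g (-d * (m : ℝ) + X) := fun m => by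
    congr 1; ring
  constructor
  · simp_rw [e1]
    exact summable_of_quadratic_decay hTb
  · have e2 : ∀ m : ℤ, f (0 + m) = g (waveNumber d m) *
        Complex.exp (Complex.I * ((waveNumber d m * X : ℝ) : ℂ)) := fun m => by
      have : a * (0 + (m : ℝ)) = waveNumber d m := by rw [ha, waveNumber]; ring
      simp only [hf, this]
    simp_rw [e2, hF] at hP
    rw [hP, ← tsum_mul_left]
    refine tsum_congr fun m => ?_
    rw [e1]
    have : (fourier m) ((0 : ℝ) : UnitAddCircle) = 1 := by
      rw [fourier_coe_apply]; simp
    rw [this, mul_one, ← mul_assoc]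
    have ha' : (2 * Real.pi / d : ℂ) * ((a⁻¹ : ℝ) : ℂ) = 1 := by
      rw [show (2 * Real.pi / d : ℂ) = ((a : ℝ) : ℂ) by rw [ha]; push_cast; ring]
      rw [← Complex.ofReal_mul, mul_inv_cancel₀ ha0.ne', Complex.ofReal_one]
    rw [ha', one_mul]

/-- Conditions on the symbol `g k w` of a kernel under which the image sums are given by rapidly
convergent series of modes. -/
structure IsAdmissibleSymbol (d η δ : ℝ) (g : ℝ → ℝ → ℂ) : Prop where
  continuous : ∀ w, 0 < w → Continuous fun k => g k w
  decay : ∀ w, 0 < w → ∃ C, ∀ k, ‖g k w‖ ≤ C / (1 + k ^ 2)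
  integral_decay : ∀ w, 0 < w → ∃ C, ∀ x, ‖symbolIntegral (fun k => g k w) x‖ ≤ C / (1 + x ^ 2)
  taylor : ∃ A, 0 ≤ A ∧ ∀ w, 2 * η ≤ w → ∃ c : ℤ → ℕ → ℂ,
    (∀ m, ∀ z ∈ Icc 0 η, HasSum (fun k => c m k * (z : ℂ) ^ k) (g (waveNumber d m) (w - z))) ∧
    ∀ k, (Summable fun m => ‖c m k‖) ∧
      ∑' m, ‖c m k‖ ≤ A * Real.exp (-(δ * (w - 2 * η))) * ((2 * η) ^ k)⁻¹ / Real.sqrt (k + 1)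

theorem integrable_symbol {g : ℝ → ℂ} (hg : Continuous g) {C : ℝ}
    (hgC : ∀ k, ‖g k‖ ≤ C / (1 + k ^ 2)) (x : ℝ) :
    Integrable fun k : ℝ => g k * Complex.exp (Complex.I * ((k * x : ℝ) : ℂ)) := by
  refine Integrable.mono' (integrable_inv_one_add_sq.const_mul C)
    (by fun_prop : Continuous _).aestronglyMeasurable (Eventually.of_forall fun k => ?_)
  rw [norm_mul, mul_comm Complex.I, Complex.norm_exp_ofReal_mul_I, mul_one, ← div_eq_mul_inv]
  exact hgC k

theorem IsAdmissibleSymbol.symbolIntegral_add {d η δ : ℝ} {g h : ℝ → ℝ → ℂ}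
    (hg : IsAdmissibleSymbol d η δ g) (hh : IsAdmissibleSymbol d η δ h) {w : ℝ} (hw : 0 < w)
    (x : ℝ) : symbolIntegral (fun k => g k w + h k w) x =
      symbolIntegral (fun k => g k w) x + symbolIntegral (fun k => h k w) x := by
  obtain ⟨C, hC⟩ := hg.decay w hw
  obtain ⟨C', hC'⟩ := hh.decay w hw
  simp only [symbolIntegral, add_mul]
  exact integral_add (integrable_symbol (hg.continuous w hw) hC x)
    (integrable_symbol (hh.continuous w hw) hC' x)

theorem symbolIntegral_const_mul (a : ℂ) (g : ℝ → ℂ) (x : ℝ) :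
    symbolIntegral (fun k => a * g k) x = a * symbolIntegral g x := by
  simp only [symbolIntegral, mul_assoc]
  exact integral_const_mul _ _

theorem IsAdmissibleSymbol.add {d η δ : ℝ} {g h : ℝ → ℝ → ℂ}
    (hg : IsAdmissibleSymbol d η δ g) (hh : IsAdmissibleSymbol d η δ h) :
    IsAdmissibleSymbol d η δ fun k w => g k w + h k w where
  continuous w hw := (hg.continuous w hw).add (hh.continuous w hw)
  decay w hw := by
    obtain ⟨C, hC⟩ := hg.decay w hw
    obtain ⟨C', hC'⟩ := hh.decay w hw
    exact ⟨C + C', fun k => (norm_add_le _ _).trans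
      ((add_le_add (hC k) (hC' k)).trans_eq (add_div _ _ _).symm)⟩
  integral_decay w hw := by
    obtain ⟨C, hC⟩ := hg.integral_decay w hw
    obtain ⟨C', hC'⟩ := hh.integral_decay w hw
    refine ⟨C + C', fun x => ?_⟩
    rw [hg.symbolIntegral_add hh hw]
    exact (norm_add_le _ _).trans ((add_le_add (hC x) (hC' x)).trans_eq (add_div _ _ _).symm)
  taylor := by
    obtain ⟨A, hA0, hA⟩ := hg.taylor
    obtain ⟨A', hA0', hA'⟩ := hh.taylor
    refine ⟨A + A', add_nonneg hA0 hA0', fun w hw => ?_⟩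
    obtain ⟨c, hc, hcb⟩ := hA w hw
    obtain ⟨c', hc', hcb'⟩ := hA' w hw
    refine ⟨fun m k => c m k + c' m k, fun m z hz => ?_, fun k => ?_⟩
    · simpa only [add_mul] using (hc m z hz).add (hc' m z hz)
    · have hle : ∀ m, ‖c m k + c' m k‖ ≤ ‖c m k‖ + ‖c' m k‖ := fun m => norm_add_le _ _
      have hs := (hcb k).1.add (hcb' k).1
      have hs' := Summable.of_nonneg_of_le (fun m => norm_nonneg _) hle hs
      refine ⟨hs', (hs'.tsum_le_tsum hle hs).trans ?_⟩
      rw [(hcb k).1.tsum_add (hcb' k).1]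
      refine (add_le_add (hcb k).2 (hcb' k).2).trans_eq ?_
      ring

theorem IsAdmissibleSymbol.const_mul {d η δ : ℝ} {g : ℝ → ℝ → ℂ}
    (hg : IsAdmissibleSymbol d η δ g) (a : ℂ) :
    IsAdmissibleSymbol d η δ fun k w => a * g k w where
  continuous w hw := (hg.continuous w hw).const_mul a
  decay w hw := by
    obtain ⟨C, hC⟩ := hg.decay w hw
    refine ⟨‖a‖ * C, fun k => ?_⟩
    rw [norm_mul, mul_div_assoc]
    exact mul_le_mul_of_nonneg_left (hC k) (norm_nonneg _)
  integral_decay w hw := by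
    obtain ⟨C, hC⟩ := hg.integral_decay w hw
    refine ⟨‖a‖ * C, fun x => ?_⟩
    rw [symbolIntegral_const_mul, norm_mul, mul_div_assoc]
    exact mul_le_mul_of_nonneg_left (hC x) (norm_nonneg _)
  taylor := by
    obtain ⟨A, hA0, hA⟩ := hg.taylor
    refine ⟨‖a‖ * A, mul_nonneg (norm_nonneg _) hA0, fun w hw => ?_⟩
    obtain ⟨c, hc, hcb⟩ := hA w hw
    refine ⟨fun m k => a * c m k, fun m z hz => ?_, fun k => ?_⟩
    · simpa only [mul_assoc] using (hc m z hz).mul_left a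
    · simp only [norm_mul]
      refine ⟨(hcb k).1.mul_left _, ?_⟩
      rw [tsum_mul_left]
      refine (mul_le_mul_of_nonneg_left (hcb k).2 (norm_nonneg a)).trans_eq ?_
      ring

end PeriodicImages

namespace PeriodicImages

open Set

/-! ### Image sums of kernels given by symbols -/

theorem HasLogDecay.ofReal_re {η A : ℝ} {f : ℝ → ℂ} (hf : HasLogDecay η A f) :
    HasLogDecay η A fun z => ((f z).re : ℂ) := by
  obtain ⟨c, hc, hs⟩ := hf
  refine ⟨fun k => ((c k).re : ℂ), fun k => ?_, fun z hz => ?_⟩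
  · rw [Complex.norm_real]
    exact (Complex.abs_re_le_norm _).trans (hc k)
  · have h := Complex.hasSum_ofReal.2 (Complex.hasSum_re (hs z hz))
    refine (congrArg₂ HasSum (funext fun k => ?_) rfl).mp h
    rw [← Complex.ofReal_pow, Complex.re_mul_ofReal]
    push_cast
    rfl

/-- The modes of the image sums, indexed by the row of images and the wave number. -/
noncomputable def imageMode (d ξ η : ℝ) (g : ℝ → ℝ → ℂ) (X w : ℝ) (p : ℕ × ℤ) : ℂ :=
  g (waveNumber d p.2) (w + p.1 * η) *
    Complex.exp (Complex.I * ((waveNumber d p.2 * (X + (2 + p.1) * ξ) : ℝ) : ℂ))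

/-- Row `j` lies farther away by `j η`, so the coefficient bounds fall geometrically with ratio `exp
(-δ η)` while their dependence on `k` is unchanged. -/
theorem IsAdmissibleSymbol.hasLogDecay_tsum_imageMode {d η δ : ℝ} (hη : 0 < η) (hδ : 0 < δ)
    {g : ℝ → ℝ → ℂ} (hg : IsAdmissibleSymbol d η δ g) (ξ : ℝ) :
    ∃ A, ∀ X w₀, 2 * η ≤ w₀ →
      (∀ z ∈ Icc 0 η, Summable (imageMode d ξ η g X (w₀ - z))) ∧
      HasLogDecay η A fun z => ∑' p, imageMode d ξ η g X (w₀ - z) p := by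
  obtain ⟨A, hA0, hA⟩ := hg.taylor
  set q := Real.exp (-(δ * η)) with hq
  have hq0 : 0 < q := Real.exp_pos _
  have hq1 : q < 1 := by rw [hq, Real.exp_lt_one_iff, neg_lt_zero]; positivity
  refine ⟨A * (1 - q)⁻¹, fun X w₀ hw₀ => ?_⟩
  have hwj : ∀ j : ℕ, 2 * η ≤ w₀ + j * η := fun j => by
    have : 0 ≤ (j : ℝ) * η := by positivity
    linarith
  choose c hc hcb using fun j : ℕ => hA (w₀ + j * η) (hwj j)
  have hgeo := (hasSum_geometric_of_lt_one hq0.le hq1)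
  have hrow : ∀ j k, ∑' m, ‖c j m k‖ ≤ A * ((2 * η) ^ k)⁻¹ / Real.sqrt (k + 1) * q ^ j := by
    intro j k
    refine (hcb j k).2.trans ?_
    have : Real.exp (-(δ * (w₀ + j * η - 2 * η))) ≤ q ^ j := by
      rw [hq, ← Real.exp_nat_mul, Real.exp_le_exp]
      nlinarith
    calc _ = A * ((2 * η) ^ k)⁻¹ / Real.sqrt (k + 1) *
          Real.exp (-(δ * (w₀ + j * η - 2 * η))) := by ring
      _ ≤ _ := by gcongr
  have hsum : ∀ k, Summable fun p : ℕ × ℤ => ‖c p.1 p.2 k‖ := fun k => by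
    have hnn : 0 ≤ fun p : ℕ × ℤ => ‖c p.1 p.2 k‖ := fun p => norm_nonneg _
    refine (summable_prod_of_nonneg hnn).2 ⟨fun j => (hcb j k).1, ?_⟩
    exact Summable.of_nonneg_of_le (fun j => tsum_nonneg fun m => norm_nonneg _)
      (fun j => hrow j k) (hgeo.summable.mul_left _)
  refine HasLogDecay.tsum hη
    (c := fun p k => c p.1 p.2 k *
      Complex.exp (Complex.I * ((waveNumber d p.2 * (X + (2 + p.1) * ξ) : ℝ) : ℂ)))
    (b := fun p k => ‖c p.1 p.2 k‖) (fun p z hz => ?_) (fun p k => ?_) hsum (fun k => ?_)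
  · have h := (hc p.1 p.2 z hz).mul_right
      (Complex.exp (Complex.I * ((waveNumber d p.2 * (X + (2 + p.1) * ξ) : ℝ) : ℂ)))
    rw [show w₀ + p.1 * η - z = w₀ - z + p.1 * η by ring] at h
    refine (congrArg₂ HasSum (funext fun k => ?_) rfl).mp h
    exact mul_right_comm _ _ _
  · rw [norm_mul, mul_comm Complex.I, Complex.norm_exp_ofReal_mul_I, mul_one]
  · rw [(hsum k).tsum_prod]
    have hs : Summable fun j : ℕ => ∑' m, ‖c j m k‖ := (hsum k).prod
    refine (hs.tsum_le_tsum (fun j => hrow j k) (hgeo.summable.mul_left _)).trans_eq ?_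
    rw [tsum_mul_left, hgeo.tsum_eq]
    ring

/-- The rows of images south of the unit cell and its neighbours. -/
def southRows : ℕ ≃ Iic (-2 : ℤ) where
  toFun j := ⟨-(2 + j), by simp⟩
  invFun n := (-2 - n : ℤ).toNat
  left_inv j := by simp
  right_inv n := by
    ext
    have := n.2
    simp only [mem_Iic] at this
    simp only
    omega

/-- The rows north of the unit cell mirror those south of it. -/
def northRows : Iic (-2 : ℤ) ≃ Ici (2 : ℤ) where
  toFun n := ⟨-n, by have := n.2; simp only [mem_Iic] at this; simp only [mem_Ici]; omega⟩
  invFun n := ⟨-n, by have := n.2; simp only [mem_Ici] at this; simp only [mem_Iic]; omega⟩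
  left_inv n := by ext; simp
  right_inv n := by ext; simp

/-! ### Reflection of the image sums -/

theorem latticeVector_neg (d ξ η : ℝ) (m n : ℤ) :
    latticeVector d ξ η (-m) (-n) = -latticeVector d ξ η m n := by
  simp only [latticeVector, Prod.neg_mk]
  push_cast
  congr 1 <;> ring

theorem green_reflect {d ξ η : ℝ} {G : ℝ × ℝ → ℝ × ℝ → ℝ} {H : ℝ × ℝ → ℝ}
    (hG : ∀ t s, G t s = H (t - s)) (hH : ∀ p, H (-p) = H p) (t s : ℝ × ℝ) (m n : ℤ) :
    G t (s + latticeVector d ξ η (-m) (-n)) = G s (t + latticeVector d ξ η m n) := by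
  rw [hG, hG, ← hH, latticeVector_neg]
  congr 1
  abel

theorem tsum_green_reflect {d ξ η : ℝ} {G : ℝ × ℝ → ℝ × ℝ → ℝ} {H : ℝ × ℝ → ℝ}
    (hG : ∀ t s, G t s = H (t - s)) (hH : ∀ p, H (-p) = H p) (t s : ℝ × ℝ) (n : ℤ) :
    ∑' m : ℤ, G t (s + latticeVector d ξ η m (-n)) =
      ∑' m : ℤ, G s (t + latticeVector d ξ η m n) := by
  rw [← (Equiv.neg ℤ).tsum_eq]
  exact tsum_congr fun m => green_reflect hG hH t s m n

theorem northKernel_eq {d ξ η : ℝ} {G : ℝ × ℝ → ℝ × ℝ → ℝ} {H : ℝ × ℝ → ℝ}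
    (hG : ∀ t s, G t s = H (t - s)) (hH : ∀ p, H (-p) = H p) (t s : ℝ × ℝ) :
    northKernel d ξ η G t s = southKernel d ξ η G s t := by
  rw [northKernel, southKernel, ← northRows.tsum_eq]
  exact tsum_congr fun n => tsum_green_reflect hG hH t s n

/-- Convergence of the image sums and interpolation estimates for Green's functions given by an
admissible symbol. -/
theorem IsAdmissibleSymbol.imageSums {d η δ : ℝ} (hd : 0 < d) (hη : 0 < η) (hδ : 0 < δ)
    {g : ℝ → ℝ → ℂ} (hg : IsAdmissibleSymbol d η δ g) (ξ : ℝ) {G : ℝ × ℝ → ℝ × ℝ → ℝ}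
    {H : ℝ × ℝ → ℝ} (hG : ∀ t s, G t s = H (t - s)) (hH : ∀ p, H (-p) = H p)
    (hHg : ∀ x w, 0 < w → H (x, w) = (symbolIntegral (fun k => g k w) x).re) :
    ImageSumsConverge d ξ η G ∧
      InterpolationEstimates η (fun t s => (southKernel d ξ η G t s : ℂ)) ∧
      InterpolationEstimates η (fun t s => (northKernel d ξ η G t s : ℂ)) := by
  obtain ⟨A, hA⟩ := hg.hasLogDecay_tsum_imageMode hη hδ ξ
  have hrow : ∀ (t s : ℝ × ℝ) (j : ℕ), 0 < t.2 - s.2 + 2 * η →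
      (Summable fun m : ℤ => G t (s + latticeVector d ξ η m (-(2 + j)))) ∧
      ∑' m : ℤ, G t (s + latticeVector d ξ η m (-(2 + j))) =
        (2 * Real.pi / d * ∑' m, imageMode d ξ η g (t.1 - s.1) (t.2 - s.2 + 2 * η) (j, m)).re := by
    intro t s j hw
    have hwj : 0 < t.2 - s.2 + 2 * η + j * η := by positivity
    obtain ⟨C, hC⟩ := hg.decay _ hwj
    obtain ⟨C', hC'⟩ := hg.integral_decay _ hwj
    obtain ⟨h1, h2⟩ := tsum_symbolIntegral hd (hg.continuous _ hwj) hC hC'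
      (t.1 - s.1 + (2 + j) * ξ)
    have e : ∀ m : ℤ, G t (s + latticeVector d ξ η m (-(2 + j))) =
        (symbolIntegral (fun k => g k (t.2 - s.2 + 2 * η + j * η))
          (t.1 - s.1 + (2 + j) * ξ - m * d)).re := fun m => by
      rw [hG, ← hHg _ _ hwj]
      congr 1
      simp only [latticeVector]
      ext
      · simp only [Prod.fst_sub, Prod.fst_add]; push_cast; ring
      · simp only [Prod.snd_sub, Prod.snd_add]; push_cast; ring
    simp_rw [e]
    refine ⟨(Complex.hasSum_re h1.hasSum).summable, ?_⟩
    rw [← Complex.re_tsum h1, h2]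
    rfl
  have hw : ∀ t s : ℝ × ℝ, t.2 ∈ Icc (-η / 2) (η / 2) → s.2 ∈ Icc (-η / 2) (η / 2) →
      0 < t.2 - s.2 + 2 * η := fun t s ht hs => by linarith [ht.1, hs.2]
  have hmodes : ∀ t s : ℝ × ℝ, t.2 ∈ Icc (-η / 2) (η / 2) → s.2 ∈ Icc (-η / 2) (η / 2) →
      Summable (imageMode d ξ η g (t.1 - s.1) (t.2 - s.2 + 2 * η)) := fun t s ht hs => by
    have := (hA (t.1 - s.1) (η / 2 - s.2 + 2 * η) (by linarith [hs.2])).1 (η / 2 - t.2)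
      ⟨by linarith [ht.2], by linarith [ht.1]⟩
    rwa [show η / 2 - s.2 + 2 * η - (η / 2 - t.2) = t.2 - s.2 + 2 * η by ring] at this
  have hsouth : ∀ t s : ℝ × ℝ, t.2 ∈ Icc (-η / 2) (η / 2) → s.2 ∈ Icc (-η / 2) (η / 2) →
      (Summable fun n : Iic (-2 : ℤ) => ∑' m : ℤ, G t (s + latticeVector d ξ η m n)) ∧
      southKernel d ξ η G t s = (2 * Real.pi / d *
        ∑' p, imageMode d ξ η g (t.1 - s.1) (t.2 - s.2 + 2 * η) p).re := fun t s ht hs => by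
    have hm := hmodes t s ht hs
    have h1 := hm.prod.mul_left (2 * Real.pi / d : ℂ)
    have e : ∀ j : ℕ, ∑' m : ℤ, G t (s + latticeVector d ξ η m (southRows j)) =
        (2 * Real.pi / d *
          ∑' m, imageMode d ξ η g (t.1 - s.1) (t.2 - s.2 + 2 * η) (j, m)).re :=
      fun j => (hrow t s j (hw t s ht hs)).2
    constructor
    · rw [← southRows.summable_iff]
      exact ((Complex.hasSum_re h1.hasSum).summable).congr fun j => (e j).symm
    · rw [southKernel, ← southRows.tsum_eq, hm.tsum_prod, ← tsum_mul_left, Complex.re_tsum h1]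
      exact tsum_congr e
  have hS : InterpolationEstimates η (fun t s => (southKernel d ξ η G t s : ℂ)) := by
    refine interpolationEstimates_of_hasLogDecay hη (e := 0)
      (F := fun X w => ((2 * Real.pi / d * ∑' p, imageMode d ξ η g X w p).re : ℂ))
      (fun x x' y hy y' hy' => ?_)
      (fun X w₀ hw₀ => (((hA X w₀ hw₀).2).const_mul (2 * Real.pi / d : ℂ)).ofReal_re)
    rw [(hsouth (x, y) (x', y') hy hy').2, zero_mul, zero_mul, zero_add]
  refine ⟨fun t s ht hs => ⟨fun n hn => ?_, (hsouth t s ht hs).1, ?_⟩, hS, ?_⟩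
  · rcases hn with hn | hn
    · obtain ⟨j, rfl⟩ : ∃ j : ℕ, n = -(2 + j) := ⟨(-2 - n).toNat, by omega⟩
      exact (hrow t s j (hw t s ht hs)).1
    · obtain ⟨j, rfl⟩ : ∃ j : ℕ, n = 2 + j := ⟨(n - 2).toNat, by omega⟩
      rw [← (Equiv.neg ℤ).summable_iff]
      refine ((hrow s t j (hw s t hs ht)).1).congr fun m => ?_
      have := green_reflect (d := d) (ξ := ξ) (η := η) hG hH t s m (-(2 + j))
      rw [neg_neg] at this
      exact this.symm
  · rw [← northRows.summable_iff]
    exact ((hsouth s t hs ht).1).congr fun n => (tsum_green_reflect hG hH t s n).symm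
  · simp_rw [northKernel_eq hG hH]
    exact interpolationEstimates_swap hS

end PeriodicImages

namespace PeriodicImages

open MeasureTheory Set Filter Topology

/-! ### Fourier representations -/

/-- The decay rate in `y` of the modes of wave number `k` of the modified equations. -/
noncomputable def decayRate (β k : ℝ) : ℝ := Real.sqrt (k ^ 2 + β ^ 2)

theorem continuous_decayRate (β : ℝ) : Continuous (decayRate β) := by
  unfold decayRate; fun_prop

theorem decayRate_sq (β k : ℝ) : decayRate β k ^ 2 = k ^ 2 + β ^ 2 :=
  Real.sq_sqrt (by positivity)

theorem decayRate_nonneg (β k : ℝ) : 0 ≤ decayRate β k := Real.sqrt_nonneg _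

theorem abs_le_decayRate (β k : ℝ) : |k| ≤ decayRate β k :=
  Real.abs_le_sqrt (by nlinarith [sq_nonneg β])

theorem le_decayRate (β k : ℝ) : β ≤ decayRate β k :=
  Real.le_sqrt_of_sq_le (by nlinarith [sq_nonneg k])

theorem decayRate_le {β : ℝ} (hβ : 0 ≤ β) (k : ℝ) : decayRate β k ≤ |k| + β :=
  Real.sqrt_le_iff.2 ⟨by positivity, by
    nlinarith [sq_abs k, mul_nonneg hβ (abs_nonneg k)]⟩

theorem decayRate_mul_sinh {β : ℝ} (hβ : 0 < β) (τ : ℝ) :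
    decayRate β (β * Real.sinh τ) = β * Real.cosh τ := by
  have h : (β * Real.sinh τ) ^ 2 + β ^ 2 = (β * Real.cosh τ) ^ 2 := by
    rw [mul_pow, mul_pow, Real.cosh_sq]; ring
  rw [decayRate, h, Real.sqrt_sq (mul_pos hβ (Real.cosh_pos τ)).le]

/-- The substitution `k = β sinh τ` makes the decay rate `β cosh τ`, which is also the Jacobian. -/
theorem symbolIntegral_eq_waveIntegral {β : ℝ} (hβ : 0 < β) {g : ℝ → ℂ} {c : ℂ} {n p : ℕ} {w : ℝ}
    (h : ∀ τ, ((β * Real.cosh τ : ℝ) : ℂ) * g (β * Real.sinh τ) =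
      c * (((Real.sinh τ ^ n * Real.cosh τ ^ p : ℝ) : ℂ) *
        (Real.exp (-(β * w * Real.cosh τ)) : ℝ))) (x : ℝ) :
    symbolIntegral g x = c * waveIntegral β n p x w := by
  have hs : (fun τ => β * Real.sinh τ) '' univ = univ := by
    rw [image_univ]
    refine Function.Surjective.range_eq fun k => ?_
    obtain ⟨τ, hτ⟩ := Real.sinh_surjective (k / β)
    exact ⟨τ, by simp only [hτ]; field_simp⟩
  have h1 := integral_image_eq_integral_abs_deriv_smul (s := univ) MeasurableSet.univ
    (fun τ _ => ((Real.hasDerivAt_sinh τ).const_mul β).hasDerivWithinAt)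
    (fun a _ b _ hab => Real.sinh_injective (mul_left_cancel₀ hβ.ne' hab))
    (fun k : ℝ => g k * Complex.exp (Complex.I * ((k * x : ℝ) : ℂ)))
  rw [hs, Measure.restrict_univ] at h1
  rw [symbolIntegral, h1, waveIntegral, ← integral_const_mul]
  refine integral_congr_ae (Eventually.of_forall fun τ => ?_)
  simp only
  rw [abs_of_pos (mul_pos hβ (Real.cosh_pos τ)), Complex.real_smul, ← mul_assoc, h, waveExponent,
    Complex.exp_add, Complex.ofReal_exp, mul_assoc, mul_assoc]
  congr 4
  push_cast
  ring

theorem mul_exp_decay {w : ℝ} (hw : 0 < w) {t : ℝ} (ht : 0 ≤ t) :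
    t * Real.exp (-(t * w)) * (1 + t ^ 2) ≤ 1 / w + 6 / w ^ 3 := by
  have h1 := Real.pow_div_factorial_le_exp (x := t * w) (by positivity) 1
  have h3 := Real.pow_div_factorial_le_exp (x := t * w) (by positivity) 3
  norm_num [Nat.factorial] at h1 h3
  have e1 : t * Real.exp (-(t * w)) ≤ 1 / w := by
    rw [Real.exp_neg, ← div_eq_mul_inv, div_le_div_iff₀ (Real.exp_pos _) hw]; linarith
  have e3 : t ^ 3 * Real.exp (-(t * w)) ≤ 6 / w ^ 3 := by
    rw [Real.exp_neg, ← div_eq_mul_inv, div_le_div_iff₀ (Real.exp_pos _) (by positivity)]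
    nlinarith
  linarith

theorem norm_le_of_exp_bound {w : ℝ} (hw : 0 < w) {a t k : ℝ} (hkt : |k| ≤ t) {z : ℂ}
    (hz : ‖z‖ ≤ a * (t * Real.exp (-(t * w)))) (ha : 0 ≤ a) :
    ‖z‖ ≤ a * (1 / w + 6 / w ^ 3) / (1 + k ^ 2) := by
  have ht : 0 ≤ t := (abs_nonneg k).trans hkt
  rw [le_div_iff₀ (by positivity)]
  calc ‖z‖ * (1 + k ^ 2) ≤ a * (t * Real.exp (-(t * w))) * (1 + t ^ 2) := by
        have := sq_le_sq' (neg_le_of_abs_le hkt) (le_of_abs_le hkt)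
        gcongr
    _ ≤ _ := by rw [mul_assoc]; exact mul_le_mul_of_nonneg_left (mul_exp_decay hw ht) ha

theorem integral_Ioi_mul_exp {w : ℝ} (hw : 0 < w) (x : ℝ) :
    ∫ k in Ioi (0 : ℝ), ((k * Real.exp (-(k * w)) : ℝ) : ℂ) *
      Complex.exp (Complex.I * ((k * x : ℝ) : ℂ)) = 1 / (w - Complex.I * x) ^ 2 := by
  set r : ℂ := w - Complex.I * x with hr
  have hr0 : r ≠ 0 := fun h => by
    have := congrArg Complex.re h
    simp [hr] at this
    exact hw.ne' this
  have e : ∀ k : ℝ, Complex.exp (-(k * r)) = ((Real.exp (-(k * w)) : ℝ) : ℂ) *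
      Complex.exp (Complex.I * ((k * x : ℝ) : ℂ)) := fun k => by
    rw [Complex.ofReal_exp, ← Complex.exp_add, hr]
    congr 1
    push_cast
    ring
  have hn : ∀ k : ℝ, ‖Complex.exp (-(k * r))‖ = Real.exp (-(k * w)) := fun k => by
    rw [e, norm_mul, mul_comm Complex.I, Complex.norm_exp_ofReal_mul_I, mul_one, Complex.norm_real,
      Real.norm_of_nonneg (Real.exp_pos _).le]
  have hF : ∀ k : ℝ, HasDerivAt (fun k : ℝ => -((k / r + 1 / r ^ 2) * Complex.exp (-(k * r))))
      (((k * Real.exp (-(k * w)) : ℝ) : ℂ) * Complex.exp (Complex.I * ((k * x : ℝ) : ℂ))) k := by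
    intro k
    have h1 : HasDerivAt (fun k : ℝ => (k : ℂ)) 1 k := Complex.ofRealCLM.hasDerivAt
    have h2 : HasDerivAt (fun k : ℝ => -((k : ℂ) * r)) (-(1 * r)) k := (h1.mul_const r).neg
    refine (((h1.div_const r).add_const (1 / r ^ 2)).mul h2.cexp).neg.congr_deriv ?_
    rw [Complex.ofReal_mul, mul_assoc, ← e]
    field_simp
    ring
  have hint : IntegrableOn (fun k : ℝ => ((k * Real.exp (-(k * w)) : ℝ) : ℂ) *
      Complex.exp (Complex.I * ((k * x : ℝ) : ℂ))) (Ioi 0) := by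
    refine Integrable.mono' (integrable_inv_one_add_sq.const_mul (1 * (1 / w + 6 / w ^ 3))).integrableOn
      (by fun_prop : Continuous _).aestronglyMeasurable
      ((ae_restrict_mem measurableSet_Ioi).mono fun k hk => ?_)
    rw [← div_eq_mul_inv]
    refine norm_le_of_exp_bound hw (abs_of_pos hk).le ?_ zero_le_one
    rw [norm_mul, mul_comm Complex.I, Complex.norm_exp_ofReal_mul_I, mul_one, Complex.norm_real,
      one_mul, Real.norm_of_nonneg (mul_pos hk (Real.exp_pos _)).le]
  have hlim : Tendsto (fun k : ℝ => -((k / r + 1 / r ^ 2) * Complex.exp (-(k * r)))) atTop (𝓝 0) := by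
    have hkw : Tendsto (fun k : ℝ => k * w) atTop atTop := tendsto_id.atTop_mul_const hw
    have h0 := (Real.tendsto_pow_mul_exp_neg_atTop_nhds_zero 0).comp hkw
    have h1 := (Real.tendsto_pow_mul_exp_neg_atTop_nhds_zero 1).comp hkw
    have h2 := (h1.mul_const (1 / (w * ‖r‖))).add (h0.mul_const (1 / ‖r‖ ^ 2))
    rw [zero_mul, zero_mul, add_zero] at h2
    refine squeeze_zero_norm' ((eventually_ge_atTop 0).mono fun k hk => ?_) h2
    rw [norm_neg, norm_mul, hn]
    refine (mul_le_mul_of_nonneg_right (norm_add_le _ _) (Real.exp_pos _).le).trans_eq ?_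
    have : ‖r‖ ≠ 0 := norm_ne_zero_iff.2 hr0
    simp only [Function.comp, norm_div, Complex.norm_real, Real.norm_of_nonneg hk, norm_one,
      norm_pow]
    field_simp
  rw [integral_Ioi_of_hasDerivAt_of_tendsto (hF 0).continuousAt.continuousWithinAt
    (fun k _ => hF k) hint hlim]
  simp

/-- The cases `a = 1` and `a = -1` are the even and odd symbols `|k| exp (-|k| w)` and `k exp (-|k|
w)`, which represent the second derivatives of the logarithm. -/
theorem symbolIntegral_laplace {w : ℝ} (hw : 0 < w) {g : ℝ → ℂ} (hg : Continuous g) {a : ℂ}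
    (hg0 : ∀ k, 0 ≤ k → g k = ((k * Real.exp (-(k * w)) : ℝ) : ℂ))
    (hg1 : ∀ k, 0 ≤ k → g (-k) = a * ((k * Real.exp (-(k * w)) : ℝ) : ℂ)) (x : ℝ) :
    symbolIntegral g x = 1 / (w - Complex.I * x) ^ 2 + a * (1 / (w + Complex.I * x) ^ 2) := by
  have hb : ∀ k, ‖g k‖ ≤ (1 + ‖a‖) * (1 / w + 6 / w ^ 3) / (1 + k ^ 2) := fun k => by
    refine norm_le_of_exp_bound hw le_rfl (t := |k|) ?_ (by positivity)
    have h0 : 0 ≤ |k| * Real.exp (-(|k| * w)) := by positivity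
    rcases le_total 0 k with hk | hk
    · rw [hg0 k hk, Complex.norm_real, abs_of_nonneg hk] at *
      rw [Real.norm_of_nonneg h0]
      nlinarith [mul_nonneg (norm_nonneg a) h0]
    · have := hg1 (-k) (neg_nonneg.2 hk)
      rw [neg_neg] at this
      rw [this, norm_mul, Complex.norm_real, ← abs_of_nonpos hk, Real.norm_of_nonneg h0]
      nlinarith
  have hi := integrable_symbol hg hb x
  rw [symbolIntegral, ← intervalIntegral.integral_Iic_add_Ioi (b := 0) hi.integrableOn
    hi.integrableOn, add_comm]
  congr 1
  · rw [← integral_Ioi_mul_exp hw]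
    exact setIntegral_congr_fun measurableSet_Ioi fun k hk => by
      simp only [hg0 k (mem_Ioi.1 hk).le]
  · have h := integral_Ioi_mul_exp hw (-x)
    have e := integral_comp_neg_Iic 0
      fun k : ℝ => g (-k) * Complex.exp (Complex.I * ((-k * x : ℝ) : ℂ))
    simp only [neg_neg, neg_zero] at e
    rw [Complex.ofReal_neg, mul_neg, sub_neg_eq_add] at h
    rw [e, ← h, ← integral_const_mul]
    refine setIntegral_congr_fun measurableSet_Ioi fun k hk => ?_
    simp only [hg1 k (mem_Ioi.1 hk).le]
    rw [mul_assoc, neg_mul, mul_neg]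

/-! ### Decay of the wave integrals in `x` -/

theorem integrable_exp_mul_waveExponent {β : ℝ} (hβ : 0 < β) {j : ℝ} (hj : |j| ≤ 2) (x : ℝ) {w : ℝ}
    (hw : 0 < w) :
    Integrable fun τ : ℝ => (Real.exp (j * τ) : ℂ) * Complex.exp (waveExponent β x w τ) := by
  refine integrable_of_cosh_bound (C := 4) (by unfold waveExponent; fun_prop) (mul_pos hβ hw) 2
    fun τ => ?_
  rw [norm_mul, norm_exp_waveExponent, ← mul_assoc, Complex.norm_real,
    Real.norm_of_nonneg (Real.exp_pos _).le]
  exact mul_le_mul_of_nonneg_right (exp_mul_le_cosh_sq hj τ) (Real.exp_pos _).le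

/-- The amplitude is split into exponentials because the contour shift acts on each of them
separately; absolute values on the original line would show no decay in `x`. -/
theorem norm_waveIntegral_le {β : ℝ} (hβ : 0 < β) (x : ℝ) {w : ℝ} (hw : 0 < w) {n p : ℕ}
    {a b c : ℝ} (habc : |a| + |b| + |c| ≤ 1) (h : ∀ τ, Real.sinh τ ^ n * Real.cosh τ ^ p =
      a * Real.exp (2 * τ) + b * Real.exp (0 * τ) + c * Real.exp (-2 * τ)) :
    ‖waveIntegral β n p x w‖ ≤ 96 * Real.pi / β ^ 4 / (x ^ 2 + w ^ 2) ^ 2 := by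
  have h1 := fun j (hj : |j| ≤ 2) => integrable_exp_mul_waveExponent hβ hj x hw
  have h2 := fun j (hj : |j| ≤ 2) => norm_integral_exp_mul_waveExponent_le hβ hj x hw
  have k1 : |(2 : ℝ)| ≤ 2 := by norm_num
  have k2 : |(0 : ℝ)| ≤ 2 := by norm_num
  have k3 : |(-2 : ℝ)| ≤ 2 := by norm_num
  set B := 96 * Real.pi / β ^ 4 / (x ^ 2 + w ^ 2) ^ 2 with hB
  have hB0 : 0 ≤ B := by positivity
  have e : waveIntegral β n p x w =
      a * (∫ τ : ℝ, (Real.exp (2 * τ) : ℂ) * Complex.exp (waveExponent β x w τ)) +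
      b * (∫ τ : ℝ, (Real.exp (0 * τ) : ℂ) * Complex.exp (waveExponent β x w τ)) +
      c * (∫ τ : ℝ, (Real.exp (-2 * τ) : ℂ) * Complex.exp (waveExponent β x w τ)) := by
    simp only [waveIntegral, h]
    rw [← integral_const_mul, ← integral_const_mul, ← integral_const_mul, ← integral_add
      ((h1 _ k1).const_mul _) ((h1 _ k2).const_mul _), ← integral_add
      (by exact ((h1 _ k1).const_mul _).add ((h1 _ k2).const_mul _)) ((h1 _ k3).const_mul _)]
    refine integral_congr_ae (Eventually.of_forall fun τ => ?_)
    simp only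
    push_cast
    ring
  rw [e]
  refine (norm_add₃_le).trans ?_
  rw [norm_mul, norm_mul, norm_mul, Complex.norm_real, Complex.norm_real, Complex.norm_real]
  simp only [Real.norm_eq_abs]
  calc _ ≤ |a| * B + |b| * B + |c| * B := by
        gcongr
        exacts [h2 _ k1, h2 _ k2, h2 _ k3]
    _ = (|a| + |b| + |c|) * B := by ring
    _ ≤ _ := mul_le_of_le_one_left hB0 habc

theorem norm_waveIntegral_zero_zero_le {β : ℝ} (hβ : 0 < β) (x : ℝ) {w : ℝ} (hw : 0 < w) :
    ‖waveIntegral β 0 0 x w‖ ≤ 96 * Real.pi / β ^ 4 / (x ^ 2 + w ^ 2) ^ 2 :=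
  norm_waveIntegral_le hβ x hw (a := 0) (b := 1) (c := 0) (by norm_num) (by simp)

theorem norm_waveIntegral_zero_two_le {β : ℝ} (hβ : 0 < β) (x : ℝ) {w : ℝ} (hw : 0 < w) :
    ‖waveIntegral β 0 2 x w‖ ≤ 96 * Real.pi / β ^ 4 / (x ^ 2 + w ^ 2) ^ 2 := by
  refine norm_waveIntegral_le hβ x hw (a := 1 / 4) (b := 1 / 2) (c := 1 / 4)
    (by norm_num [abs_of_pos]) fun τ => ?_
  have h1 : Real.exp τ * Real.exp (-τ) = 1 := by rw [← Real.exp_add]; simp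
  rw [Real.cosh_eq, two_mul, Real.exp_add, neg_mul, two_mul, neg_add, Real.exp_add, zero_mul,
    Real.exp_zero]
  linear_combination (1 / 2) * h1

theorem norm_waveIntegral_one_one_le {β : ℝ} (hβ : 0 < β) (x : ℝ) {w : ℝ} (hw : 0 < w) :
    ‖waveIntegral β 1 1 x w‖ ≤ 96 * Real.pi / β ^ 4 / (x ^ 2 + w ^ 2) ^ 2 := by
  refine norm_waveIntegral_le hβ x hw (a := 1 / 4) (b := 0) (c := -(1 / 4))
    (by norm_num [abs_of_pos]) fun τ => ?_
  rw [Real.cosh_eq, Real.sinh_eq, show -2 * τ = -τ + -τ by ring, two_mul, Real.exp_add,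
    Real.exp_add]
  ring

/-- Functions with the decay of the Fourier representations of the kernels. -/
theorem exists_quadratic_decay {f : ℝ → ℂ} {w B E : ℝ} (hw : 0 < w) (hB : 0 ≤ B) (hE : 0 ≤ E)
    (h : ∀ x, ‖f x‖ ≤ B / (x ^ 2 + w ^ 2) ^ 2 + E / (x ^ 2 + w ^ 2)) :
    ∃ C, ∀ x, ‖f x‖ ≤ C / (1 + x ^ 2) := by
  refine ⟨(B / w ^ 2 + E) * (1 + 1 / w ^ 2), fun x => (h x).trans ?_⟩
  have h0 : 0 < x ^ 2 + w ^ 2 := by positivity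
  have h1 : B / (x ^ 2 + w ^ 2) ^ 2 ≤ B / w ^ 2 / (x ^ 2 + w ^ 2) := by
    rw [div_div, sq (x ^ 2 + w ^ 2)]
    gcongr
    nlinarith [sq_nonneg x]
  have h2 : 1 + x ^ 2 ≤ (1 + 1 / w ^ 2) * (x ^ 2 + w ^ 2) := by
    have : 1 / w ^ 2 * w ^ 2 = 1 := by field_simp
    nlinarith [mul_nonneg (by positivity : 0 ≤ 1 / w ^ 2) (sq_nonneg x), sq_nonneg w]
  calc _ ≤ B / w ^ 2 / (x ^ 2 + w ^ 2) + E / (x ^ 2 + w ^ 2) := by gcongr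
    _ = (B / w ^ 2 + E) / (x ^ 2 + w ^ 2) := by ring
    _ ≤ _ := by
      rw [div_le_div_iff₀ h0 (by positivity), mul_assoc]
      gcongr

/-! ### The symbols -/

/-- The symbol of the Green's function of the modified Helmholtz equation. -/
noncomputable def helmholtzSymbol (β k w : ℝ) : ℂ :=
  ((Real.exp (-(w * decayRate β k)) / decayRate β k : ℝ) : ℂ)

/-- The symbol of the second `y`-derivative of the modified biharmonic Green's function. -/
noncomputable def normalSymbol (β k w : ℝ) : ℂ :=
  ((decayRate β k * Real.exp (-(w * decayRate β k)) - |k| * Real.exp (-(w * |k|)) : ℝ) : ℂ)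

/-- The symbol of the mixed second derivative of the modified biharmonic Green's function. -/
noncomputable def mixedSymbol (β k w : ℝ) : ℂ :=
  ((k * (Real.exp (-(w * decayRate β k)) - Real.exp (-(w * |k|))) : ℝ) : ℂ)

theorem decayRate_pos {β : ℝ} (hβ : 0 < β) (k : ℝ) : 0 < decayRate β k :=
  hβ.trans_le (le_decayRate β k)

theorem symbolIntegral_helmholtzSymbol {β : ℝ} (hβ : 0 < β) (x w : ℝ) :
    symbolIntegral (fun k => helmholtzSymbol β k w) x = waveIntegral β 0 0 x w := by
  rw [← one_mul (waveIntegral β 0 0 x w)]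
  refine symbolIntegral_eq_waveIntegral hβ (fun τ => ?_) x
  have := (Real.cosh_pos τ).ne'
  rw [helmholtzSymbol, decayRate_mul_sinh hβ, ← Complex.ofReal_mul]
  have e : β * Real.cosh τ * (Real.exp (-(w * (β * Real.cosh τ))) / (β * Real.cosh τ)) =
      Real.exp (-(β * w * Real.cosh τ)) := by
    rw [show w * (β * Real.cosh τ) = β * w * Real.cosh τ by ring]
    field_simp
  rw [e]
  simp

theorem integrable_decay_symbol {g : ℝ → ℝ} (hg : Continuous g) {a w : ℝ} (hw : 0 < w) (ha : 0 ≤ a)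
    {t : ℝ → ℝ} (ht : ∀ k, |k| ≤ t k) (h : ∀ k, |g k| ≤ a * (t k * Real.exp (-(t k * w)))) (x : ℝ) :
    Integrable fun k : ℝ => (g k : ℂ) * Complex.exp (Complex.I * ((k * x : ℝ) : ℂ)) :=
  integrable_symbol (by fun_prop) (C := a * (1 / w + 6 / w ^ 3)) (fun k => by
    refine norm_le_of_exp_bound hw (ht k) ?_ ha
    rw [Complex.norm_real]; exact h k) x

theorem symbolIntegral_sub {g h : ℝ → ℝ} {x : ℝ}
    (hg : Integrable fun k : ℝ => (g k : ℂ) * Complex.exp (Complex.I * ((k * x : ℝ) : ℂ)))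
    (hh : Integrable fun k : ℝ => (h k : ℂ) * Complex.exp (Complex.I * ((k * x : ℝ) : ℂ))) :
    symbolIntegral (fun k => ((g k - h k : ℝ) : ℂ)) x =
      symbolIntegral (fun k => (g k : ℂ)) x - symbolIntegral (fun k => (h k : ℂ)) x := by
  simp only [symbolIntegral, Complex.ofReal_sub, sub_mul]
  exact integral_sub hg hh

theorem add_I_mul_ne_zero {w : ℝ} (hw : 0 < w) (x : ℝ) :
    (w : ℂ) - Complex.I * x ≠ 0 ∧ (w : ℂ) + Complex.I * x ≠ 0 ∧ (x : ℂ) ^ 2 + w ^ 2 ≠ 0 := by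
  refine ⟨fun h => ?_, fun h => ?_, fun h => ?_⟩
  · have := congrArg Complex.re h
    simp at this
    exact hw.ne' this
  · have := congrArg Complex.re h
    simp at this
    exact hw.ne' this
  · have h2 : x ^ 2 + w ^ 2 = 0 := by exact_mod_cast h
    have : 0 < x ^ 2 + w ^ 2 := by positivity
    exact this.ne' h2

theorem symbolIntegral_normalSymbol {β : ℝ} (hβ : 0 < β) (x : ℝ) {w : ℝ} (hw : 0 < w) :
    symbolIntegral (fun k => normalSymbol β k w) x =
      β ^ 2 * waveIntegral β 0 2 x w - ((2 * (w ^ 2 - x ^ 2) / (x ^ 2 + w ^ 2) ^ 2 : ℝ) : ℂ) := by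
  have hc := continuous_decayRate β
  simp only [normalSymbol]
  rw [symbolIntegral_sub]
  · congr 1
    · refine symbolIntegral_eq_waveIntegral hβ (fun τ => ?_) x
      rw [decayRate_mul_sinh hβ, show w * (β * Real.cosh τ) = β * w * Real.cosh τ by ring]
      push_cast
      ring
    · rw [symbolIntegral_laplace hw (a := 1) (by fun_prop)]
      · obtain ⟨h1, h2, h3⟩ := add_I_mul_ne_zero hw x
        have : (x : ℂ) ^ 2 + w ^ 2 = (w - Complex.I * x) * (w + Complex.I * x) := by
          linear_combination (x : ℂ) ^ 2 * Complex.I_sq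
        push_cast
        rw [this]
        field_simp
        linear_combination (2 * (x : ℂ) ^ 2) * Complex.I_sq
      · intro k hk
        rw [abs_of_nonneg hk, mul_comm w]
      · intro k hk
        rw [abs_neg, abs_of_nonneg hk, mul_comm w, one_mul]
  · refine integrable_decay_symbol (by fun_prop) hw zero_le_one (abs_le_decayRate β) (fun k => ?_) x
    rw [one_mul, mul_comm w, abs_of_nonneg (mul_nonneg (decayRate_nonneg β k) (Real.exp_pos _).le)]
  · refine integrable_decay_symbol (by fun_prop) hw zero_le_one (fun k => le_rfl) (fun k => ?_) x
    rw [one_mul, mul_comm w, abs_of_nonneg (by positivity)]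

theorem symbolIntegral_mixedSymbol {β : ℝ} (hβ : 0 < β) (x : ℝ) {w : ℝ} (hw : 0 < w) :
    symbolIntegral (fun k => mixedSymbol β k w) x =
      β ^ 2 * waveIntegral β 1 1 x w -
        Complex.I * ((4 * x * w / (x ^ 2 + w ^ 2) ^ 2 : ℝ) : ℂ) := by
  have hc := continuous_decayRate β
  simp only [mixedSymbol, mul_sub]
  rw [symbolIntegral_sub]
  · congr 1
    · refine symbolIntegral_eq_waveIntegral hβ (fun τ => ?_) x
      rw [decayRate_mul_sinh hβ, show w * (β * Real.cosh τ) = β * w * Real.cosh τ by ring]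
      push_cast
      ring
    · rw [symbolIntegral_laplace hw (a := -1) (by fun_prop)]
      · obtain ⟨h1, h2, h3⟩ := add_I_mul_ne_zero hw x
        have : (x : ℂ) ^ 2 + w ^ 2 = (w - Complex.I * x) * (w + Complex.I * x) := by
          linear_combination (x : ℂ) ^ 2 * Complex.I_sq
        push_cast
        rw [this]
        field_simp
        ring
      · intro k hk
        rw [abs_of_nonneg hk, mul_comm w]
      · intro k hk
        rw [abs_neg, abs_of_nonneg hk, mul_comm w]
        push_cast
        ring
  · refine integrable_decay_symbol (by fun_prop) hw zero_le_one (abs_le_decayRate β) (fun k => ?_) x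
    rw [one_mul, mul_comm w, abs_mul, abs_of_pos (Real.exp_pos _)]
    exact mul_le_mul_of_nonneg_right (abs_le_decayRate β k) (Real.exp_pos _).le
  · refine integrable_decay_symbol (by fun_prop) hw zero_le_one (fun k => le_rfl) (fun k => ?_) x
    rw [one_mul, mul_comm w, abs_mul, abs_of_pos (Real.exp_pos _)]

end PeriodicImages

namespace PeriodicImages

open Set

/-! ### Taylor coefficients of the symbols -/

/-- The rate `κ` may depend on `k` as well as on `m`, since it will come from the mean value theorem
applied to each coefficient. The rate `δ / 2` is the half of the decay kept in `modeBound_le`. -/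
theorem exists_taylor_bound {η a b δ D : ℝ} (hη : 0 < η) (ha : 0 < a) (hb : 0 ≤ b) (hδ : 0 < δ)
    (hD : 0 ≤ D) : ∃ A, 0 ≤ A ∧ ∀ w, 2 * η ≤ w → ∀ c : ℤ → ℕ → ℂ,
      (∀ (m : ℤ) (k : ℕ), ∃ κ, a * |(m : ℝ)| ≤ κ ∧ κ ≤ a * |(m : ℝ)| + b ∧ δ ≤ κ ∧
        ‖c m k‖ ≤ D * modeBound w k κ) → ∀ k, (Summable fun m => ‖c m k‖) ∧
      ∑' m, ‖c m k‖ ≤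
        A * Real.exp (-(δ / 2 * (w - 2 * η))) * ((2 * η) ^ k)⁻¹ / Real.sqrt (k + 1) := by
  obtain ⟨C, hC0, hC⟩ := exists_tsum_modeBound_le (W := 2 * η) (by positivity) ha hb hδ
  refine ⟨D * 2 * C, by positivity, fun w hw c hc k => ?_⟩
  choose κ h1 h2 h3 h4 using fun m => hc m k
  obtain ⟨hs, ht⟩ := hC κ (fun m => ⟨h1 m, h2 m, h3 m⟩) k
  set E := Real.exp (-(δ / 2 * (w - 2 * η))) with hE
  have hle : ∀ m, ‖c m k‖ ≤ D * 2 * E * modeBound (2 * η) k (κ m) := fun m => by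
    have hκ : 0 < κ m := hδ.trans_le (h3 m)
    have hB := modeBound_nonneg (2 * η) k hκ.le
    have hexp : Real.exp (-(κ m * (w - 2 * η) / 2)) ≤ E := by
      rw [hE, Real.exp_le_exp]
      nlinarith [mul_le_mul_of_nonneg_right (h3 m) (sub_nonneg.2 hw)]
    calc _ ≤ D * (2 * Real.exp (-(κ m * (w - 2 * η) / 2)) * modeBound (2 * η) k (κ m)) :=
          (h4 m).trans (mul_le_mul_of_nonneg_left (modeBound_le hw hκ k) hD)
      _ ≤ D * (2 * E * modeBound (2 * η) k (κ m)) := by gcongr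
      _ = _ := by ring
  have hs' := Summable.of_nonneg_of_le (fun m => norm_nonneg _) hle (hs.mul_left _)
  refine ⟨hs', (hs'.tsum_le_tsum hle (hs.mul_left _)).trans ?_⟩
  rw [tsum_mul_left]
  have hE0 : 0 < E := Real.exp_pos _
  refine (mul_le_mul_of_nonneg_left ht (by positivity)).trans_eq ?_
  ring

theorem hasSum_exp_mode (κ w z : ℝ) :
    HasSum (fun k : ℕ => κ ^ k * Real.exp (-(w * κ)) / k.factorial * z ^ k)
      (Real.exp (-((w - z) * κ))) := by
  have h0 : HasSum (fun k : ℕ => (κ * z) ^ k / k.factorial) (Real.exp (κ * z)) := by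
    rw [Real.exp_eq_exp_ℝ]
    exact NormedSpace.expSeries_div_hasSum_exp (κ * z)
  refine (congrArg₂ HasSum (funext fun k => ?_) ?_).mp (h0.mul_left (Real.exp (-(w * κ))))
  · rw [mul_pow]; ring
  · rw [← Real.exp_add]; congr 1; ring

/-- Lipschitz bound for the Taylor coefficients, as functions of the decay rate. -/
theorem exists_mode_sub_le {α χ : ℝ} (hα : 0 < α) (hαχ : α ≤ χ) (w : ℝ) (j k : ℕ) (hj : j ≤ 1) :
    ∃ κ, α ≤ κ ∧ κ ≤ χ ∧
      |χ ^ (k + j) * Real.exp (-(w * χ)) - α ^ (k + j) * Real.exp (-(w * α))| / k.factorial ≤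
        (χ - α) * κ ^ j * modeBound w k κ := by
  have hderiv : ∀ κ : ℝ, HasDerivAt (fun κ : ℝ => κ ^ (k + j) * Real.exp (-(w * κ)))
      (((k + j : ℕ) * κ ^ (k + j - 1)) * Real.exp (-(w * κ)) +
        κ ^ (k + j) * (Real.exp (-(w * κ)) * -(w * 1))) κ := fun κ => by
    have h2 : HasDerivAt (fun κ : ℝ => -(w * κ)) (-(w * 1)) κ := ((hasDerivAt_id κ).const_mul w).neg
    exact (hasDerivAt_pow (k + j) κ).mul h2.exp
  rcases hαχ.eq_or_lt with rfl | hlt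
  · exact ⟨α, le_rfl, le_rfl, by simp⟩
  obtain ⟨κ, hκ, h⟩ := exists_hasDerivAt_eq_slope
    (fun κ : ℝ => κ ^ (k + j) * Real.exp (-(w * κ))) _ hlt (by fun_prop) fun κ _ => hderiv κ
  have hκ0 : 0 < κ := hα.trans hκ.1
  refine ⟨κ, hκ.1.le, hκ.2.le, ?_⟩
  have hd : 0 < χ - α := sub_pos.2 hlt
  rw [eq_div_iff hd.ne'] at h
  rw [← h, abs_mul, abs_of_pos hd, modeBound]
  -- The logarithmic derivative is `(k + j - w κ) / κ`; this is the source of the factor `|κ w - k|`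
  -- in `modeBound`.
  have e : ((k + j : ℕ) : ℝ) * κ ^ (k + j - 1) * Real.exp (-(w * κ)) +
      κ ^ (k + j) * (Real.exp (-(w * κ)) * -(w * 1)) =
      (j - (κ * w - k)) * (κ ^ j * (κ ^ k / κ)) * Real.exp (-(w * κ)) := by
    rcases Nat.eq_zero_or_pos (k + j) with h0 | h0
    · obtain ⟨rfl, rfl⟩ : k = 0 ∧ j = 0 := by omega
      simp
      field_simp
    · have : κ ^ (k + j - 1) = κ ^ j * (κ ^ k / κ) := by
        rw [eq_comm, ← mul_div_assoc, div_eq_iff hκ0.ne', ← pow_succ, Nat.sub_add_cancel h0,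
          pow_add, mul_comm]
      have h3 : κ ^ (k + j) = κ * (κ ^ j * (κ ^ k / κ)) := by
        rw [pow_add]; field_simp
      rw [this, h3]
      push_cast
      ring
  have hj' : |(j : ℝ) - (κ * w - k)| ≤ 1 + |κ * w - k| := by
    refine (abs_sub _ _).trans ?_
    rw [Nat.abs_cast]
    gcongr
    exact_mod_cast hj
  rw [e, abs_mul, abs_mul, abs_of_pos (Real.exp_pos _),
    abs_of_pos (show 0 < κ ^ j * (κ ^ k / κ) by positivity)]
  calc _ ≤ (1 + |κ * w - k|) * (κ ^ j * (κ ^ k / κ)) * Real.exp (-(w * κ)) * (χ - α) /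
        k.factorial := by gcongr
    _ = _ := by ring

theorem abs_waveNumber {d : ℝ} (hd : 0 < d) (m : ℤ) :
    |waveNumber d m| = 2 * Real.pi / d * |(m : ℝ)| := by
  rw [waveNumber, mul_div_right_comm, abs_mul, abs_of_pos (by positivity)]

/-- The range of decay rates between those of the Laplace and the modified Helmholtz equation. -/
theorem decayRate_range {β d : ℝ} (hβ : 0 < β) (hd : 0 < d) {m : ℤ} {κ : ℝ}
    (h1 : |waveNumber d m| ≤ κ) (h2 : κ ≤ decayRate β (waveNumber d m)) (h3 : m = 0 → β ≤ κ) :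
    2 * Real.pi / d * |(m : ℝ)| ≤ κ ∧ κ ≤ 2 * Real.pi / d * |(m : ℝ)| + β ∧
      min β (2 * Real.pi / d) ≤ κ := by
  rw [← abs_waveNumber hd]
  refine ⟨h1, h2.trans (decayRate_le hβ.le _), ?_⟩
  by_cases hm : m = 0
  · exact (min_le_left _ _).trans (h3 hm)
  · exact (min_le_right _ _).trans ((abs_waveNumber_ge hd hm).trans h1)

theorem isAdmissibleSymbol_helmholtzSymbol {β d η : ℝ} (hβ : 0 < β) (hd : 0 < d) (hη : 0 < η) :
    IsAdmissibleSymbol d η (min β (2 * Real.pi / d) / 2) (helmholtzSymbol β) where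
  continuous w _ := by
    have hc := continuous_decayRate β
    unfold helmholtzSymbol
    refine Complex.continuous_ofReal.comp (Continuous.div (by fun_prop) hc fun k =>
      (decayRate_pos hβ k).ne')
  decay w hw := by
    refine ⟨1 / β ^ 2 * (1 / w + 6 / w ^ 3), fun k =>
      norm_le_of_exp_bound hw (abs_le_decayRate β k) ?_ (by positivity)⟩
    have h0 := decayRate_pos hβ k
    rw [helmholtzSymbol, Complex.norm_real, Real.norm_of_nonneg (by positivity), mul_comm w,
      div_eq_mul_inv, mul_comm, ← mul_assoc]
    refine mul_le_mul_of_nonneg_right ?_ (Real.exp_pos _).le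
    rw [div_mul_eq_mul_div, one_mul, le_div_iff₀ (by positivity), inv_mul_eq_div,
      div_le_iff₀ h0, ← sq]
    exact pow_le_pow_left₀ hβ.le (le_decayRate β k) 2
  integral_decay w hw := by
    refine exists_quadratic_decay hw (B := 96 * Real.pi / β ^ 4) (E := 0) (by positivity) le_rfl
      fun x => ?_
    rw [symbolIntegral_helmholtzSymbol hβ, zero_div, add_zero]
    exact norm_waveIntegral_zero_zero_le hβ x hw
  taylor := by
    obtain ⟨A, hA0, hA⟩ := exists_taylor_bound hη (by positivity : 0 < 2 * Real.pi / d)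
      hβ.le (by positivity : 0 < min β (2 * Real.pi / d)) zero_le_one
    refine ⟨A, hA0, fun w hw => ⟨fun m k => ((decayRate β (waveNumber d m) ^ k *
      Real.exp (-(w * decayRate β (waveNumber d m))) / k.factorial /
        decayRate β (waveNumber d m) : ℝ) : ℂ), fun m z _ => ?_, hA w hw _ fun m k => ?_⟩⟩
    · refine (congrArg₂ HasSum (funext fun k => ?_) rfl).mp (Complex.hasSum_ofReal.2
        ((hasSum_exp_mode (decayRate β (waveNumber d m)) w z).div_const
          (decayRate β (waveNumber d m))))
      push_cast
      ring
    · have h0 := decayRate_pos hβ (waveNumber d m)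
      obtain ⟨h1, h2, h3⟩ := decayRate_range hβ hd (abs_le_decayRate β _) le_rfl
        fun _ => le_decayRate β (waveNumber d m)
      refine ⟨_, h1, h2, h3, ?_⟩
      rw [Complex.norm_real, Real.norm_of_nonneg (by positivity), one_mul, modeBound]
      set χ := decayRate β (waveNumber d m)
      calc _ = 1 * (χ ^ k / χ) * Real.exp (-(w * χ)) / k.factorial := by ring
        _ ≤ _ := by
          gcongr
          linarith [abs_nonneg (χ * w - k)]

/-- Each term alone is too large, by its extra power of the rate. With `χ` the decay rate and `α`
the wave number, the difference is controlled by `(χ - |α|) κ ≤ (χ - |α|) (χ + |α|) = β²`. At `m =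
0` only the Bessel term remains and `κ = β` serves. -/
theorem exists_normal_coeff_le {β d : ℝ} (hβ : 0 < β) (hd : 0 < d) (w : ℝ) (m : ℤ) (k : ℕ) :
    ∃ κ, |waveNumber d m| ≤ κ ∧ κ ≤ decayRate β (waveNumber d m) ∧ (m = 0 → β ≤ κ) ∧
      |decayRate β (waveNumber d m) ^ (k + 1) * Real.exp (-(w * decayRate β (waveNumber d m))) -
        |waveNumber d m| ^ (k + 1) * Real.exp (-(w * |waveNumber d m|))| / k.factorial ≤
        β ^ 2 * modeBound w k κ := by
  by_cases hm : m = 0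
  · have h0 : waveNumber d m = 0 := by simp [hm, waveNumber]
    have h1 : decayRate β (waveNumber d m) = β := by
      rw [h0, decayRate, zero_pow two_ne_zero, zero_add, Real.sqrt_sq hβ.le]
    refine ⟨β, by rw [h0, abs_zero]; exact hβ.le, h1.ge, fun _ => le_rfl, ?_⟩
    rw [h1, h0, abs_zero, zero_pow (by omega), zero_mul, sub_zero, abs_of_pos (by positivity),
      modeBound]
    calc _ = β ^ 2 * (1 * (β ^ k / β) * Real.exp (-(w * β)) / k.factorial) := by
          field_simp
          ring
      _ ≤ _ := by
        gcongr
        linarith [abs_nonneg (β * w - k)]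
  · have hα : 0 < |waveNumber d m| := lt_of_lt_of_le (by positivity) (abs_waveNumber_ge hd hm)
    have hαχ := abs_le_decayRate β (waveNumber d m)
    obtain ⟨κ, h1, h2, h3⟩ := exists_mode_sub_le hα hαχ w 1 k le_rfl
    have hκ := hα.trans_le h1
    refine ⟨κ, h1, h2, fun h => absurd h hm, h3.trans ?_⟩
    refine mul_le_mul_of_nonneg_right ?_ (modeBound_nonneg w k hκ.le)
    rw [pow_one]
    nlinarith [decayRate_sq β (waveNumber d m), sq_abs (waveNumber d m),
      mul_le_mul_of_nonneg_left h2 (sub_nonneg.2 hαχ),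
      mul_nonneg hα.le (sub_nonneg.2 hαχ)]

theorem exists_mixed_coeff_le {β d : ℝ} (hβ : 0 < β) (hd : 0 < d) (w : ℝ) (m : ℤ) (k : ℕ) :
    ∃ κ, |waveNumber d m| ≤ κ ∧ κ ≤ decayRate β (waveNumber d m) ∧ (m = 0 → β ≤ κ) ∧
      |waveNumber d m| *
      (|decayRate β (waveNumber d m) ^ k * Real.exp (-(w * decayRate β (waveNumber d m))) -
        |waveNumber d m| ^ k * Real.exp (-(w * |waveNumber d m|))| / k.factorial) ≤
        β ^ 2 * modeBound w k κ := by
  by_cases hm : m = 0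
  · have h0 : waveNumber d m = 0 := by simp [hm, waveNumber]
    have hB := modeBound_nonneg w k hβ.le
    refine ⟨β, by rw [h0, abs_zero]; exact hβ.le, le_decayRate _ _, fun _ => le_rfl, ?_⟩
    rw [h0, abs_zero, zero_mul]
    positivity
  · have hα : 0 < |waveNumber d m| := lt_of_lt_of_le (by positivity) (abs_waveNumber_ge hd hm)
    have hαχ := abs_le_decayRate β (waveNumber d m)
    obtain ⟨κ, h1, h2, h3⟩ := exists_mode_sub_le hα hαχ w 0 k zero_le_one
    have hκ := hα.trans_le h1
    refine ⟨κ, h1, h2, fun h => absurd h hm, (mul_le_mul_of_nonneg_left h3 hα.le).trans ?_⟩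
    rw [← mul_assoc]
    refine mul_le_mul_of_nonneg_right ?_ (modeBound_nonneg w k hκ.le)
    rw [pow_zero, mul_one]
    nlinarith [decayRate_sq β (waveNumber d m), sq_abs (waveNumber d m),
      mul_le_mul_of_nonneg_left hαχ (sub_nonneg.2 hαχ),
      mul_nonneg hα.le (sub_nonneg.2 hαχ)]

theorem exp_decayRate_le {β w : ℝ} (hw : 0 < w) (k : ℝ) :
    Real.exp (-(w * decayRate β k)) ≤ Real.exp (-(w * |k|)) := by
  rw [Real.exp_le_exp, neg_le_neg_iff]
  exact mul_le_mul_of_nonneg_left (abs_le_decayRate β k) hw.le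

theorem isAdmissibleSymbol_normalSymbol {β d η : ℝ} (hβ : 0 < β) (hd : 0 < d) (hη : 0 < η) :
    IsAdmissibleSymbol d η (min β (2 * Real.pi / d) / 2) (normalSymbol β) where
  continuous w _ := by
    have hc := continuous_decayRate β
    unfold normalSymbol
    fun_prop
  decay w hw := by
    refine ⟨1 * (1 / w + 6 / w ^ 3) + 1 * (1 / w + 6 / w ^ 3), fun k => ?_⟩
    have h1 := norm_le_of_exp_bound (a := 1) (z := ((decayRate β k *
      Real.exp (-(w * decayRate β k)) : ℝ) : ℂ)) hw (abs_le_decayRate β k) (by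
        rw [Complex.norm_real, one_mul, mul_comm w, Real.norm_of_nonneg
          (mul_nonneg (decayRate_nonneg β k) (Real.exp_pos _).le)]) zero_le_one
    have h2 := norm_le_of_exp_bound (a := 1) (z := ((|k| * Real.exp (-(w * |k|)) : ℝ) : ℂ)) hw
      (le_refl |k|) (by
        rw [Complex.norm_real, one_mul, mul_comm w, Real.norm_of_nonneg (by positivity)])
      zero_le_one
    rw [normalSymbol, Complex.ofReal_sub, add_div]
    exact (norm_sub_le _ _).trans (add_le_add h1 h2)
  integral_decay w hw := by
    refine exists_quadratic_decay hw (B := β ^ 2 * (96 * Real.pi / β ^ 4)) (E := 2) (by positivity)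
      zero_le_two fun x => ?_
    have h0 : 0 < x ^ 2 + w ^ 2 := by positivity
    rw [symbolIntegral_normalSymbol hβ x hw]
    refine (norm_sub_le _ _).trans (add_le_add ?_ ?_)
    · rw [norm_mul, norm_pow, Complex.norm_real, Real.norm_of_nonneg hβ.le, mul_div_assoc]
      exact mul_le_mul_of_nonneg_left (norm_waveIntegral_zero_two_le hβ x hw) (by positivity)
    · rw [Complex.norm_real, Real.norm_eq_abs, abs_div, abs_of_pos (by positivity : 0 < (x ^ 2 + w ^ 2) ^ 2),
        div_le_div_iff₀ (by positivity) h0, sq (x ^ 2 + w ^ 2), ← mul_assoc]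
      refine mul_le_mul_of_nonneg_right (abs_le.2 ⟨?_, ?_⟩) h0.le <;> nlinarith [sq_nonneg x, sq_nonneg w]
  taylor := by
    obtain ⟨A, hA0, hA⟩ := exists_taylor_bound hη (by positivity : 0 < 2 * Real.pi / d)
      hβ.le (by positivity : 0 < min β (2 * Real.pi / d)) (sq_nonneg β)
    refine ⟨A, hA0, fun w hw => ⟨fun m k => (((decayRate β (waveNumber d m) ^ (k + 1) *
      Real.exp (-(w * decayRate β (waveNumber d m))) - |waveNumber d m| ^ (k + 1) *
        Real.exp (-(w * |waveNumber d m|))) / k.factorial : ℝ) : ℂ),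
        fun m z _ => ?_, hA w hw _ fun m k => ?_⟩⟩
    · refine (congrArg₂ HasSum (funext fun k => ?_) rfl).mp (Complex.hasSum_ofReal.2
        (((hasSum_exp_mode (decayRate β (waveNumber d m)) w z).mul_left
          (decayRate β (waveNumber d m))).sub ((hasSum_exp_mode |waveNumber d m| w z).mul_left
          |waveNumber d m|)))
      push_cast
      ring
    · obtain ⟨κ, h1, h2, h3, h4⟩ := exists_normal_coeff_le hβ hd w m k
      obtain ⟨h5, h6, h7⟩ := decayRate_range hβ hd h1 h2 h3
      refine ⟨κ, h5, h6, h7, ?_⟩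
      rwa [Complex.norm_real, Real.norm_eq_abs, abs_div, Nat.abs_cast]

theorem isAdmissibleSymbol_mixedSymbol {β d η : ℝ} (hβ : 0 < β) (hd : 0 < d) (hη : 0 < η) :
    IsAdmissibleSymbol d η (min β (2 * Real.pi / d) / 2) (mixedSymbol β) where
  continuous w _ := by
    have hc := continuous_decayRate β
    unfold mixedSymbol
    fun_prop
  decay w hw := by
    refine ⟨1 * (1 / w + 6 / w ^ 3), fun k =>
      norm_le_of_exp_bound hw (le_refl |k|) ?_ zero_le_one⟩
    rw [mixedSymbol, Complex.norm_real, Real.norm_eq_abs, abs_mul, one_mul, mul_comm |k| w]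
    refine mul_le_mul_of_nonneg_left ?_ (abs_nonneg k)
    rw [abs_le]
    have := exp_decayRate_le (β := β) hw k
    constructor <;> linarith [Real.exp_pos (-(w * decayRate β k)), Real.exp_pos (-(w * |k|))]
  integral_decay w hw := by
    refine exists_quadratic_decay hw (B := β ^ 2 * (96 * Real.pi / β ^ 4)) (E := 2) (by positivity)
      zero_le_two fun x => ?_
    have h0 : 0 < x ^ 2 + w ^ 2 := by positivity
    rw [symbolIntegral_mixedSymbol hβ x hw]
    refine (norm_sub_le _ _).trans (add_le_add ?_ ?_)
    · rw [norm_mul, norm_pow, Complex.norm_real, Real.norm_of_nonneg hβ.le, mul_div_assoc]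
      exact mul_le_mul_of_nonneg_left (norm_waveIntegral_one_one_le hβ x hw) (by positivity)
    · rw [norm_mul, Complex.norm_I, one_mul, Complex.norm_real, Real.norm_eq_abs, abs_div,
        abs_of_pos (by positivity : 0 < (x ^ 2 + w ^ 2) ^ 2),
        div_le_div_iff₀ (by positivity) h0, sq (x ^ 2 + w ^ 2), ← mul_assoc]
      refine mul_le_mul_of_nonneg_right (abs_le.2 ⟨?_, ?_⟩) h0.le <;>
        nlinarith [sq_nonneg (x + w), sq_nonneg (x - w)]
  taylor := by
    obtain ⟨A, hA0, hA⟩ := exists_taylor_bound hη (by positivity : 0 < 2 * Real.pi / d)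
      hβ.le (by positivity : 0 < min β (2 * Real.pi / d)) (sq_nonneg β)
    refine ⟨A, hA0, fun w hw => ⟨fun m k => ((waveNumber d m * ((decayRate β (waveNumber d m) ^ k *
      Real.exp (-(w * decayRate β (waveNumber d m))) - |waveNumber d m| ^ k *
        Real.exp (-(w * |waveNumber d m|))) / k.factorial) : ℝ) : ℂ),
        fun m z _ => ?_, hA w hw _ fun m k => ?_⟩⟩
    · refine (congrArg₂ HasSum (funext fun k => ?_) rfl).mp (Complex.hasSum_ofReal.2
        (((hasSum_exp_mode (decayRate β (waveNumber d m)) w z).sub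
          (hasSum_exp_mode |waveNumber d m| w z)).mul_left (waveNumber d m)))
      push_cast
      ring
    · obtain ⟨κ, h1, h2, h3, h4⟩ := exists_mixed_coeff_le hβ hd w m k
      obtain ⟨h5, h6, h7⟩ := decayRate_range hβ hd h1 h2 h3
      refine ⟨κ, h5, h6, h7, ?_⟩
      rwa [Complex.norm_real, Real.norm_eq_abs, abs_mul, abs_div, Nat.abs_cast]

end PeriodicImages

namespace PeriodicImages

/-! ### The modified Helmholtz and Stokes kernels -/

theorem radius_neg (p : ℝ × ℝ) : radius (-p) = radius p := by
  simp [radius]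

/-- The rules for `deriv` used here need no differentiability, so the parity also holds at the
singular point 0, as the reflection argument asks for all `p`. -/
theorem partialX_neg {f : ℝ × ℝ → ℝ} {s : ℝ} (h : ∀ p, f (-p) = s * f p) (p : ℝ × ℝ) :
    partialX f (-p) = -s * partialX f p := by
  have e : (fun a => f (a, (-p).2)) = fun a => s * f (-a, p.2) := funext fun a => by
    rw [← h]; simp
  rw [partialX, e, deriv_const_mul_field, deriv_comp_neg (fun a => f (a, p.2)), partialX]
  simp

theorem partialY_neg {f : ℝ × ℝ → ℝ} {s : ℝ} (h : ∀ p, f (-p) = s * f p) (p : ℝ × ℝ) :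
    partialY f (-p) = -s * partialY f p := by
  have e : (fun b => f ((-p).1, b)) = fun b => s * f (p.1, -b) := funext fun b => by
    rw [← h]; simp
  rw [partialY, e, deriv_const_mul_field, deriv_comp_neg (fun b => f (p.1, b)), partialY]
  simp

theorem modifiedBiharmonicGreen_neg (β : ℝ) (p : ℝ × ℝ) :
    modifiedBiharmonicGreen β (-p) = 1 * modifiedBiharmonicGreen β p := by
  rw [modifiedBiharmonicGreen, radius_neg, one_mul, modifiedBiharmonicGreen]

theorem waveIntegral_two_zero {β : ℝ} (hβ : 0 < β) (x : ℝ) {w : ℝ} (hw : 0 < w) :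
    waveIntegral β 2 0 x w = waveIntegral β 0 2 x w - waveIntegral β 0 0 x w := by
  simp only [waveIntegral]
  rw [← MeasureTheory.integral_sub (integrable_wave hβ 0 2 x hw) (integrable_wave hβ 0 0 x hw)]
  refine MeasureTheory.integral_congr_ae (Filter.Eventually.of_forall fun τ => ?_)
  simp only
  rw [← sub_mul, ← Complex.ofReal_sub, Real.sinh_sq]
  congr 2
  ring

theorem imageSums_modifiedHelmholtzGreen {β d η : ℝ} (hβ : 0 < β) (hd : 0 < d) (hη : 0 < η)
    (ξ : ℝ) : ImageSumsConverge d ξ η (modifiedHelmholtzGreen β) ∧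
      InterpolationEstimates η (fun t s =>
        (southKernel d ξ η (modifiedHelmholtzGreen β) t s : ℂ)) ∧
      InterpolationEstimates η (fun t s =>
        (northKernel d ξ η (modifiedHelmholtzGreen β) t s : ℂ)) := by
  refine ((isAdmissibleSymbol_helmholtzSymbol hβ hd hη).const_mul
    ((1 / (4 * Real.pi) : ℝ) : ℂ)).imageSums hd hη (by positivity) ξ
    (H := fun p => 1 / (2 * Real.pi) * besselK0 (β * radius p)) (fun t s => rfl)
    (fun p => by rw [radius_neg]) fun x w hw => ?_
  have h := congrArg Complex.re (besselK0_eq_waveIntegral hβ x hw)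
  have h2 : (1 / 2 * waveIntegral β 0 0 x w).re = 1 / 2 * (waveIntegral β 0 0 x w).re := by simp
  rw [Complex.ofReal_re, h2] at h
  rw [symbolIntegral_const_mul, symbolIntegral_helmholtzSymbol hβ, Complex.re_ofReal_mul, h]
  field_simp
  ring

theorem re_sq_mul (β : ℝ) (z : ℂ) : ((β : ℂ) ^ 2 * z).re = β ^ 2 * z.re := by
  rw [← Complex.ofReal_pow, Complex.re_ofReal_mul]

theorem imageSums_partialY_partialY {β d η : ℝ} (hβ : 0 < β) (hd : 0 < d) (hη : 0 < η) (ξ : ℝ)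
    {G : ℝ × ℝ → ℝ × ℝ → ℝ}
    (hG : ∀ t s, G t s = -partialY (partialY (modifiedBiharmonicGreen β)) (t - s)) :
    ImageSumsConverge d ξ η G ∧
      InterpolationEstimates η (fun t s => (southKernel d ξ η G t s : ℂ)) ∧
      InterpolationEstimates η (fun t s => (northKernel d ξ η G t s : ℂ)) := by
  refine ((isAdmissibleSymbol_normalSymbol hβ hd hη).const_mul
    ((1 / (4 * Real.pi * β ^ 2) : ℝ) : ℂ)).imageSums hd hη (by positivity) ξ
    (H := fun p => -partialY (partialY (modifiedBiharmonicGreen β)) p) hG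
    (fun p => by rw [partialY_neg (partialY_neg (modifiedBiharmonicGreen_neg β))]; ring)
    fun x w hw => ?_
  rw [symbolIntegral_const_mul, symbolIntegral_normalSymbol hβ x hw,
    partialY_partialY_modifiedBiharmonicGreen hβ x hw, Complex.re_ofReal_mul, Complex.sub_re,
    Complex.ofReal_re, re_sq_mul]
  have := hβ.ne'
  have h0 : x ^ 2 + w ^ 2 ≠ 0 := by positivity
  field_simp
  ring

theorem imageSums_partialX_partialY {β d η : ℝ} (hβ : 0 < β) (hd : 0 < d) (hη : 0 < η) (ξ : ℝ)
    {G : ℝ × ℝ → ℝ × ℝ → ℝ}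
    (hG : ∀ t s, G t s = partialX (partialY (modifiedBiharmonicGreen β)) (t - s)) :
    ImageSumsConverge d ξ η G ∧
      InterpolationEstimates η (fun t s => (southKernel d ξ η G t s : ℂ)) ∧
      InterpolationEstimates η (fun t s => (northKernel d ξ η G t s : ℂ)) := by
  refine ((isAdmissibleSymbol_mixedSymbol hβ hd hη).const_mul
    (((1 / (4 * Real.pi * β ^ 2) : ℝ) : ℂ) * Complex.I)).imageSums hd hη (by positivity) ξ
    (H := fun p => partialX (partialY (modifiedBiharmonicGreen β)) p) hG
    (fun p => by rw [partialX_neg (partialY_neg (modifiedBiharmonicGreen_neg β))]; ring)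
    fun x w hw => ?_
  have e : Complex.I * (β ^ 2 * waveIntegral β 1 1 x w -
      Complex.I * ((4 * x * w / (x ^ 2 + w ^ 2) ^ 2 : ℝ) : ℂ)) =
      -(-Complex.I * (β ^ 2 * waveIntegral β 1 1 x w)) +
        ((4 * x * w / (x ^ 2 + w ^ 2) ^ 2 : ℝ) : ℂ) := by
    linear_combination (-((4 * x * w / (x ^ 2 + w ^ 2) ^ 2 : ℝ) : ℂ)) * Complex.I_sq
  rw [symbolIntegral_const_mul, symbolIntegral_mixedSymbol hβ x hw,
    partialX_partialY_modifiedBiharmonicGreen hβ x hw,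
    mul_assoc ((1 / (4 * Real.pi * β ^ 2) : ℝ) : ℂ), e, Complex.re_ofReal_mul,
    Complex.add_re, Complex.neg_re, Complex.ofReal_re]
  have := hβ.ne'
  have h0 : x ^ 2 + w ^ 2 ≠ 0 := by positivity
  field_simp
  ring

/-- By `sinh² = cosh² - 1` and the harmonicity of the logarithm, this entry is a combination of the
Helmholtz and normal symbols, so no further symbol is needed. -/
theorem imageSums_partialX_partialX {β d η : ℝ} (hβ : 0 < β) (hd : 0 < d) (hη : 0 < η) (ξ : ℝ)
    {G : ℝ × ℝ → ℝ × ℝ → ℝ}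
    (hG : ∀ t s, G t s = -partialX (partialX (modifiedBiharmonicGreen β)) (t - s)) :
    ImageSumsConverge d ξ η G ∧
      InterpolationEstimates η (fun t s => (southKernel d ξ η G t s : ℂ)) ∧
      InterpolationEstimates η (fun t s => (northKernel d ξ η G t s : ℂ)) := by
  have h1 := (isAdmissibleSymbol_helmholtzSymbol hβ hd hη).const_mul ((1 / (4 * Real.pi) : ℝ) : ℂ)
  have h2 := (isAdmissibleSymbol_normalSymbol hβ hd hη).const_mul
    ((-(1 / (4 * Real.pi * β ^ 2)) : ℝ) : ℂ)
  refine (h1.add h2).imageSums hd hη (by positivity) ξ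
    (H := fun p => -partialX (partialX (modifiedBiharmonicGreen β)) p) hG
    (fun p => by rw [partialX_neg (partialX_neg (modifiedBiharmonicGreen_neg β))]; ring)
    fun x w hw => ?_
  rw [h1.symbolIntegral_add h2 hw, symbolIntegral_const_mul, symbolIntegral_const_mul,
    symbolIntegral_helmholtzSymbol hβ, symbolIntegral_normalSymbol hβ x hw,
    partialX_partialX_modifiedBiharmonicGreen hβ x hw, waveIntegral_two_zero hβ x hw,
    Complex.add_re, Complex.re_ofReal_mul, Complex.re_ofReal_mul, Complex.sub_re,
    Complex.ofReal_re, Complex.neg_re, re_sq_mul, re_sq_mul, Complex.sub_re]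
  have := hβ.ne'
  have h0 : x ^ 2 + w ^ 2 ≠ 0 := by positivity
  field_simp
  ring

theorem imageSums_modifiedStokeslet {β d η : ℝ} (hβ : 0 < β) (hd : 0 < d) (hη : 0 < η) (ξ : ℝ)
    (i j : Fin 2) :
    ImageSumsConverge d ξ η (fun t s => modifiedStokeslet β t s i j) ∧
      InterpolationEstimates η (fun t s =>
        (southKernel d ξ η (fun t s => modifiedStokeslet β t s i j) t s : ℂ)) ∧
      InterpolationEstimates η (fun t s =>
        (northKernel d ξ η (fun t s => modifiedStokeslet β t s i j) t s : ℂ)) := by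
  fin_cases i <;> fin_cases j
  · exact imageSums_partialY_partialY hβ hd hη ξ fun t s => rfl
  · exact imageSums_partialX_partialY hβ hd hη ξ fun t s => rfl
  · exact imageSums_partialX_partialY hβ hd hη ξ fun t s => rfl
  · exact imageSums_partialX_partialX hβ hd hη ξ fun t s => rfl

end PeriodicImages

theorem mainTheorem11 (d ξ η : ℝ) (hd : 0 < d) (hη : 0 < η) :
    -- modified Helmholtz equation
    (∀ β : ℝ, 0 < β →
      PeriodicImages.ImageSumsConverge d ξ η (PeriodicImages.modifiedHelmholtzGreen β) ∧
      PeriodicImages.InterpolationEstimates η (fun t s =>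
        (PeriodicImages.southKernel d ξ η (PeriodicImages.modifiedHelmholtzGreen β) t s : ℂ)) ∧
      PeriodicImages.InterpolationEstimates η (fun t s =>
        (PeriodicImages.northKernel d ξ η (PeriodicImages.modifiedHelmholtzGreen β) t s : ℂ))) ∧
    -- Poisson equation
    (PeriodicImages.InterpolationEstimates η (PeriodicImages.poissonSouth d ξ η) ∧
      PeriodicImages.InterpolationEstimates η (PeriodicImages.poissonNorth d ξ η)) ∧
    -- modified Stokes equations
    (∀ β : ℝ, 0 < β → ∀ i j : Fin 2,
      PeriodicImages.ImageSumsConverge d ξ η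
        (fun t s => PeriodicImages.modifiedStokeslet β t s i j) ∧
      PeriodicImages.InterpolationEstimates η (fun t s =>
        (PeriodicImages.southKernel d ξ η
          (fun t s => PeriodicImages.modifiedStokeslet β t s i j) t s : ℂ)) ∧
      PeriodicImages.InterpolationEstimates η (fun t s =>
        (PeriodicImages.northKernel d ξ η
          (fun t s => PeriodicImages.modifiedStokeslet β t s i j) t s : ℂ))) ∧
    -- Stokes equations
    (∀ i j : Fin 2,
      PeriodicImages.InterpolationEstimates η (PeriodicImages.stokesSouth d ξ η i j) ∧
      PeriodicImages.InterpolationEstimates η (PeriodicImages.stokesNorth d ξ η i j)) := by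
  have hP := PeriodicImages.interpolationEstimates_poissonSouth hd hη ξ
  have hS := fun i j => PeriodicImages.interpolationEstimates_stokesSouth hd hη ξ i j
  refine ⟨fun β hβ => PeriodicImages.imageSums_modifiedHelmholtzGreen hβ hd hη ξ, ⟨hP, ?_⟩,
    fun β hβ => PeriodicImages.imageSums_modifiedStokeslet hβ hd hη ξ, fun i j => ⟨hS i j, ?_⟩⟩
  · rw [show PeriodicImages.poissonNorth d ξ η = fun t s => PeriodicImages.poissonSouth d ξ η s t from
      funext fun t => funext fun s => PeriodicImages.poissonNorth_eq d ξ η t s]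
    exact PeriodicImages.interpolationEstimates_swap hP
  · rw [show PeriodicImages.stokesNorth d ξ η i j = fun t s => PeriodicImages.stokesSouth d ξ η i j s t from
      funext fun t => funext fun s => PeriodicImages.stokesNorth_eq d ξ η i j t s]
    exact PeriodicImages.interpolationEstimates_swap (hS i j)
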